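/- Let $d\in\mathbb N$, $\alpha\in[-1/2,\infty)^d$, and let $\mu=\mu_1\otimes\cdots\otimes\mu_d$ be the probability measure on $X=(0,\infty)^d$ with $d\mu_i(x_i)=\frac{1}{\Gamma(\alpha_i+1)}x_i^{\alpha_i}e^{-x_i}\,dx_i$. Write $L^p=L^p(X,\mu)$ for real-valued functions and, for ${\bf g}=(g_1,\dots,g_d)$, $\|{\bf g}\|_p=\big(\int_X(\sum_i|g_i|^2)^{p/2}\,d\mu\big)^{1/p}$. Let $\varphi_k=\tilde L^{\alpha_1}_{k_1}\otimes\cdots\otimes\tilde L^{\alpha_d}_{k_d}$, $k\in\mathbb N^d$, be the tensor products of the $L^2(\mu_i)$-normalized Laguerre polynomials $\tilde L^{\alpha_i}_{k_i}$, let $\delta_i=\sqrt{x_i}\,\partial_{x_i}$ and $|k|=k_1+\cdots+k_d$. For $f\in L^2$ the vector of Riesz transforms is ${\bf R}f=(R_1f,\dots,R_df)$, where $$R_if=\sum_{k\in\mathbb N^d,\,k\ne0}|k|^{-1/2}\,\langle f,\varphi_k\rangle_{L^2}\,\delta_i\varphi_k ,$$ the series converging unconditionally in $L^2$. Let $1<p<\infty$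 and $p^*=\max\big(p,\frac{p}{p-1}\big)$. Then ${\bf R}$, defined on $L^2\cap L^p$ by the series above, extends uniquely to a bounded linear operator ${\bf R}\colon L^p(X,\mu)\to L^p(X,\mu;\mathbb R^d)$, and for every $f\in L^p$ with $\int_X f\,d\mu=0$, $$\|{\bf R}f\|_p\le 24\,(p^*-1)\,\|f\|_p .$$ In particular, the bound is independent of the dimension $d$ and of the parameter $\alpha$, and is linear in $p^*$. -/

import Mathlib

open MeasureTheory Filter Topology
open scoped ENNReal

noncomputable section

namespace LaguerreRiesz

/-- The generalized Laguerre polynomial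
`L_n^a(x) = ∑_{j ≤ n} (-1)^j Γ(n+a+1) / (Γ(j+a+1) (n-j)! j!) x^j` (for `a > -1`). -/
def laguerre (a : ℝ) (n : ℕ) : Polynomial ℝ :=
  ∑ j ∈ Finset.range (n + 1),
    Polynomial.C ((-1) ^ j * Real.Gamma (n + a + 1) /
      (Real.Gamma (j + a + 1) * (n - j).factorial * j.factorial)) * Polynomial.X ^ j

/-- The one-dimensional measure `Γ(a+1)⁻¹ x^a e^{-x} dx` on `(0,∞)`, viewed as a measure on `ℝ`
(the Gamma distribution with shape `a + 1` and rate `1`). -/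
def lagMeasure₁ (a : ℝ) : Measure ℝ :=
  ProbabilityTheory.gammaMeasure (a + 1) 1

/-- The product measure on `(0,∞)^d`, viewed as a measure on `ℝ^d`. -/
def lagMeasure {d : ℕ} (α : Fin d → ℝ) : Measure (Fin d → ℝ) :=
  Measure.pi fun i => lagMeasure₁ (α i)

/-- The `L²`-normalized one-dimensional Laguerre polynomial. -/
def lagNormalized₁ (a : ℝ) (n : ℕ) (x : ℝ) : ℝ :=
  (laguerre a n).eval x / √(∫ y, ((laguerre a n).eval y) ^ 2 ∂lagMeasure₁ a)

/-- The `L²`-normalized multi-dimensional Laguerre polynomial (tensor product). -/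
def lagNormalized {d : ℕ} (α : Fin d → ℝ) (k : Fin d → ℕ) (x : Fin d → ℝ) : ℝ :=
  ∏ i, lagNormalized₁ (α i) (k i) (x i)

/-- The derivation `δ_i = √x_i ∂_{x_i}`. -/
def delta {d : ℕ} (i : Fin d) (g : (Fin d → ℝ) → ℝ) (x : Fin d → ℝ) : ℝ :=
  √(x i) * deriv (fun t => g (Function.update x i t)) (x i)

/-- The partial sum over the finite set `s` of nonzero multi-indices of the series whose `i`-th
component is `∑_{k ≠ 0} |k|^{-1/2} ⟨f, φ_k⟩ δ_i φ_k`, where `φ_k` are the normalized Laguerre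
polynomials. -/
def rieszPartialSum {d : ℕ} (α : Fin d → ℝ) (f : (Fin d → ℝ) → ℝ)
    (s : Finset {k : Fin d → ℕ // k ≠ 0}) (x : Fin d → ℝ) : EuclideanSpace ℝ (Fin d) :=
  WithLp.toLp 2 fun i => ∑ k ∈ s,
    (√(∑ j, (k.1 j : ℝ)))⁻¹ * (∫ y, f y * lagNormalized α k.1 y ∂lagMeasure α) *
      delta i (lagNormalized α k.1) x

/-- `g = (g_1, …, g_d)` is (a version of) the vector `(R_1 f, …, R_d f)` of Riesz transforms of
`f ∈ L²`: the defining series converges to `g`, unconditionally, in `L²(μ; ℝ^d)`. -/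
def IsRieszVector {d : ℕ} (α : Fin d → ℝ) (f : (Fin d → ℝ) → ℝ)
    (g : (Fin d → ℝ) → EuclideanSpace ℝ (Fin d)) : Prop :=
  MemLp g 2 (lagMeasure α) ∧
    Tendsto (fun s => eLpNorm (fun x => g x - rieszPartialSum α f s x) 2 (lagMeasure α))
      atTop (𝓝 0)

/-- `T` is a bounded extension to `L^p` of the vector of Riesz transforms given on `L² ∩ L^p` by
the `L²`-convergent series. -/
def ExtendsRiesz {d : ℕ} (α : Fin d → ℝ) (p : ℝ≥0∞) [Fact (1 ≤ p)]
    (T : Lp ℝ p (lagMeasure α) →L[ℝ] Lp (EuclideanSpace ℝ (Fin d)) p (lagMeasure α)) : Prop :=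
  ∀ f : Lp ℝ p (lagMeasure α), MemLp f 2 (lagMeasure α) → IsRieszVector α f (T f)

end LaguerreRiesz

end

/-!
Notation: `φ_k` are the normalized Laguerre polynomials, `δ_i = √x_i ∂_i`, and
`Λ = ∑ (x_i ∂_i² + (α_i + 1 - x_i) ∂_i)` is the Laguerre operator, so that `Λ φ_k = -|k| φ_k`.

On `L²` everything is orthogonality: the `φ_k` are orthonormal, and, integrating by parts, so are the
vector fields `|k|^{-1/2} (δ_i φ_k)_i`, `k ≠ 0`. The defining series therefore converges
unconditionally and defines a bounded operator (`exists_hasSum_inner_smul`, `exists_rieszL2`).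

The `L^p` bound is proved by the Bellman function method, first for a finite expansion
`f = ∑ c_k φ_k` paired with a field `g = (√x_j h_j)_j`, where each `h_j` is a finite combination of
the polynomials `∂_j φ_k`. Extend both to `t > -1` by the Poisson semigroups, with the factors
`e^{-t√|k|}`. The extension of `f` is annihilated by the generator `∂_t² + Λ`
(`gen_poissonJet_ell`). The extension of `h_j` satisfies a similar equation with lower order terms
(`gen_poissonJet_dpoly`), whose contribution to the generator of `|g|²` is
`∑ (x_j + α_j + 1/2) h_j²`; this is where `α_j ≥ -1/2` enters (`vectorSq_dominates`). For `P ≥ 2`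
with conjugate exponent `Q`, a function `b` of Nazarov–Treil type, evaluated at
`U = |f|² + ε`, `V = |g|² + ε`, satisfies `0 ≤ b ≤ U^{P/2} + 6 (P - 1) V^{Q/2}` (`bell_le`), and its
Hessian dominates the product of the two gradients (`bell_hessian`). Hence
`(∂_t² + Λ) b ≥ 2 |∑_j δ_j f ∂_t g_j|` (`Jet.two_mul_abs_le_gen_bellman`).

Integration in `x` removes `Λ`. The integral of `δf · ∂_t g` is the second derivative of an explicit
sum `H` of decaying exponentials with `4 |H(0)| = |⟨R f, g⟩|`. Therefore `∫ b ∓ 2 H` is convex and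
bounded in `t`, hence nonincreasing, and `2 |H(0)| ≤ ∫ b` at `t = 0`
(`Jet.two_mul_abs_le_integral`). Normalizing `f` and `g` gives
`|⟨R f, g⟩| ≤ 14 (p* - 1) ‖f‖_p ‖g‖_q` (`abs_pairing_le`), for `p ≥ 2` and `p ≤ 2` alike: the roles
of `U` and `V` in `b` are exchanged when `p < 2`.

Polynomials are dense in `L^p(ν)` for every measure `ν` on the orthant with an exponential moment
(`inPolyClosure_of_memLp`). For `ν = μ` this makes finite expansions dense in `L^p(μ)`; for
`ν = x_j^{q/2} μ` it makes the functions `√x_j h_j` dense in `L^q(μ)`. The second fact and duality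
turn the bilinear estimate into `‖R f‖_p ≤ 14 (p* - 1) ‖f‖_p` for finite expansions
(`lpNorm_gradField_rieszCoeff_le`), and the first allows the extension to `L^p`. To identify the
extension with the series on `L^p ∩ L²`, approximate by finite expansions in `L^r`,
`r = max p 2`, and compare the limits in measure.
-/

noncomputable section

namespace LaguerreRiesz

open Polynomial in
/-- The `L²`-normalized Laguerre polynomial as a polynomial. -/
def nlag (a : ℝ) (n : ℕ) : ℝ[X] :=
  C (√(∫ y, ((laguerre a n).eval y) ^ 2 ∂lagMeasure₁ a))⁻¹ * laguerre a n

lemma lagNormalized₁_eq (a : ℝ) (n : ℕ) (x : ℝ) : lagNormalized₁ a n x = (nlag a n).eval x := by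
  simp [lagNormalized₁, nlag, div_eq_inv_mul]

/-! ### The one-dimensional Laguerre measure -/

section OneDim

variable {a : ℝ}

lemma isProbabilityMeasure_lagMeasure₁ (ha : -(1 / 2 : ℝ) ≤ a) :
    IsProbabilityMeasure (lagMeasure₁ a) :=
  ProbabilityTheory.isProbabilityMeasure_gammaMeasure (by linarith) one_pos

lemma measurable_gammaPDF (a r : ℝ) : Measurable (ProbabilityTheory.gammaPDF a r) :=
  (ProbabilityTheory.measurable_gammaPDFReal a r).ennreal_ofReal

lemma ae_pos_lagMeasure₁ (a : ℝ) : ∀ᵐ x ∂lagMeasure₁ a, 0 < x := by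
  rw [lagMeasure₁, ProbabilityTheory.gammaMeasure, ae_withDensity_iff (measurable_gammaPDF _ _)]
  have h0 : ∀ᵐ x : ℝ, x ≠ 0 := by simp [ae_iff]
  filter_upwards [h0] with x hx hne
  by_contra h
  exact hne (ProbabilityTheory.gammaPDF_of_neg (lt_of_le_of_ne (not_lt.mp h) hx))

lemma integrable_lagMeasure₁_iff (ha : -(1 / 2 : ℝ) ≤ a) (f : ℝ → ℝ) :
    Integrable f (lagMeasure₁ a) ↔
      IntegrableOn (fun x => x ^ a * Real.exp (-x) * f x) (Set.Ioi 0) := by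
  have hG : 0 < Real.Gamma (a + 1) := Real.Gamma_pos_of_pos (by linarith)
  rw [lagMeasure₁, ProbabilityTheory.gammaMeasure,
    integrable_withDensity_iff (measurable_gammaPDF _ _) (by simp [ProbabilityTheory.gammaPDF]),
    ← integrableOn_univ, ← Set.Iic_union_Ioi (a := (0 : ℝ)), integrableOn_union]
  have h1 : IntegrableOn (fun x => f x * (ProbabilityTheory.gammaPDF (a + 1) 1 x).toReal)
      (Set.Iic 0) := by
    rw [integrableOn_Iic_iff_integrableOn_Iio]
    refine (integrableOn_zero).congr_fun (fun x hx => ?_) measurableSet_Iio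
    simp [ProbabilityTheory.gammaPDF_of_neg (Set.mem_Iio.mp hx)]
  rw [and_iff_right h1]
  have h2 : IntegrableOn (fun x => f x * (ProbabilityTheory.gammaPDF (a + 1) 1 x).toReal)
      (Set.Ioi 0) ↔ IntegrableOn (fun x => (Real.Gamma (a + 1))⁻¹ *
        (x ^ a * Real.exp (-x) * f x)) (Set.Ioi 0) := by
    refine integrableOn_congr_fun (fun x hx => ?_) measurableSet_Ioi
    have hx' : 0 < x := hx
    rw [ProbabilityTheory.gammaPDF_of_nonneg hx'.le, ENNReal.toReal_ofReal (by positivity)]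
    simp only [Real.one_rpow, add_sub_cancel_right, one_mul]
    ring
  rw [h2]
  exact integrable_const_mul_iff (IsUnit.mk0 _ (inv_ne_zero hG.ne')) _

lemma integral_lagMeasure₁ (ha : -(1 / 2 : ℝ) ≤ a) (f : ℝ → ℝ) :
    ∫ x, f x ∂lagMeasure₁ a =
      (Real.Gamma (a + 1))⁻¹ * ∫ x in Set.Ioi 0, x ^ a * Real.exp (-x) * f x := by
  have hG : 0 < Real.Gamma (a + 1) := Real.Gamma_pos_of_pos (by linarith)
  rw [lagMeasure₁, ProbabilityTheory.gammaMeasure,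
    integral_withDensity_eq_integral_toReal_smul (measurable_gammaPDF _ _)
      (by simp [ProbabilityTheory.gammaPDF]), ← integral_const_mul, ← integral_Ici_eq_integral_Ioi]
  have h1 : ∀ x ∉ Set.Ici (0 : ℝ),
      (ProbabilityTheory.gammaPDF (a + 1) 1 x).toReal • f x = 0 := fun x hx => by
    simp [ProbabilityTheory.gammaPDF_of_neg (not_le.mp hx)]
  rw [← setIntegral_eq_integral_of_forall_compl_eq_zero h1]
  refine setIntegral_congr_fun measurableSet_Ici (fun x hx => ?_)
  have hx' : 0 ≤ x := hx
  rw [ProbabilityTheory.gammaPDF_of_nonneg hx', ENNReal.toReal_ofReal (by positivity)]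
  simp only [Real.one_rpow, add_sub_cancel_right, one_mul, smul_eq_mul]
  ring

lemma integrable_exp_half_lagMeasure₁ (ha : -(1 / 2 : ℝ) ≤ a) :
    Integrable (fun x => Real.exp (x / 2)) (lagMeasure₁ a) := by
  rw [integrable_lagMeasure₁_iff ha]
  have := integrableOn_rpow_mul_exp_neg_mul_rpow (p := 1) (s := a) (b := 1 / 2) (by linarith)
    one_pos (by norm_num)
  refine this.congr_fun (fun x hx => ?_) measurableSet_Ioi
  simp only [Real.rpow_one]
  rw [mul_assoc, ← Real.exp_add]
  congr 2
  ring

lemma exists_pow_le_exp (N : ℕ) {c : ℝ} (hc : 0 < c) :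
    ∃ C : ℝ, 0 < C ∧ ∀ x : ℝ, 0 ≤ x → (1 + x) ^ N ≤ C * Real.exp (c * x) := by
  refine ⟨N.factorial / c ^ N * Real.exp c, by positivity, fun x hx => ?_⟩
  have h := Real.pow_div_factorial_le_exp (x := c * (1 + x)) (by positivity) N
  rw [mul_pow, div_le_iff₀ (by positivity)] at h
  have : Real.exp (c * (1 + x)) = Real.exp c * Real.exp (c * x) := by
    rw [← Real.exp_add]; ring_nf
  rw [this] at h
  calc (1 + x) ^ N = c ^ N * (1 + x) ^ N / c ^ N := by field_simp
    _ ≤ Real.exp c * Real.exp (c * x) * N.factorial / c ^ N := by gcongr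
    _ = _ := by ring

lemma integrable_of_poly_growth₁ (ha : -(1 / 2 : ℝ) ≤ a) {f : ℝ → ℝ}
    (hf : AEStronglyMeasurable f (lagMeasure₁ a)) {C : ℝ} {N : ℕ}
    (h : ∀ x, 0 < x → |f x| ≤ C * (1 + x) ^ N) : Integrable f (lagMeasure₁ a) := by
  obtain ⟨D, hD, hD'⟩ := exists_pow_le_exp N (c := 1 / 2) (by norm_num)
  have hC : 0 ≤ C := by
    have := (abs_nonneg _).trans (h 1 one_pos)
    exact nonneg_of_mul_nonneg_left this (by positivity)
  refine ((integrable_exp_half_lagMeasure₁ ha).const_mul (C * D)).mono' hf ?_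
  filter_upwards [ae_pos_lagMeasure₁ a] with x hx
  rw [Real.norm_eq_abs]
  calc |f x| ≤ C * (1 + x) ^ N := h x hx
    _ ≤ C * (D * Real.exp (1 / 2 * x)) := by gcongr; exact hD' x hx.le
    _ = _ := by ring_nf

/-- Integration by parts in divergence form: `x v' + (a + 1 - x) v` is `x⁻ᵃ eˣ` times the derivative
of `x ^ (a + 1) e⁻ˣ v`, which vanishes at `0` and at infinity. -/
lemma integral_divergence₁ (ha : -(1 / 2 : ℝ) ≤ a) {v v' : ℝ → ℝ}
    (hv : ∀ x, 0 < x → HasDerivAt v (v' x) x) (hm : Measurable v') {C : ℝ} {N : ℕ}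
    (h : ∀ x, 0 < x → |v x| ≤ C * (1 + x) ^ N) (h' : ∀ x, 0 < x → |v' x| ≤ C * (1 + x) ^ N) :
    ∫ x, (x * v' x + (a + 1 - x) * v x) ∂lagMeasure₁ a = 0 := by
  have hC : 0 ≤ C := by
    have := (abs_nonneg _).trans (h 1 one_pos)
    exact nonneg_of_mul_nonneg_left this (by positivity)
  have ha1 : 0 < a + 1 := by linarith
  -- `v` is only controlled on `(0, ∞)`, where it is continuous and which carries the measure
  have hvm : AEStronglyMeasurable v (lagMeasure₁ a) := by
    have hc : ContinuousOn v (Set.Ioi 0) := fun x hx => (hv x hx).continuousAt.continuousWithinAt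
    have := hc.aestronglyMeasurable (μ := lagMeasure₁ a) measurableSet_Ioi
    rwa [Measure.restrict_eq_self_of_ae_mem (s := Set.Ioi 0) (ae_pos_lagMeasure₁ a)] at this
  have hint : Integrable (fun x => x * v' x + (a + 1 - x) * v x) (lagMeasure₁ a) := by
    refine integrable_of_poly_growth₁ ha (C := C * (a + 3)) (N := N + 1) ?_ ?_
    · exact (measurable_id.mul hm).aestronglyMeasurable.add
        (((measurable_const.sub measurable_id).aestronglyMeasurable).mul hvm)
    · intro x hx
      have h1 := h x hx
      have h2 := h' x hx
      have h3 : |a + 1 - x| ≤ a + 1 + x := by rw [abs_le]; constructor <;> linarith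
      calc |x * v' x + (a + 1 - x) * v x| ≤ |x * v' x| + |(a + 1 - x) * v x| := abs_add_le _ _
        _ = x * |v' x| + |a + 1 - x| * |v x| := by rw [abs_mul, abs_mul, abs_of_pos hx]
        _ ≤ x * (C * (1 + x) ^ N) + (a + 1 + x) * (C * (1 + x) ^ N) := by gcongr
        _ = (a + 1 + 2 * x) * (C * (1 + x) ^ N) := by ring
        _ ≤ ((a + 3) * (1 + x)) * (C * (1 + x) ^ N) := by gcongr; nlinarith
        _ = _ := by ring
  rw [integral_lagMeasure₁ ha]
  have hderiv : ∀ x ∈ Set.Ioi (0 : ℝ), HasDerivAt (fun x => x ^ (a + 1) * Real.exp (-x) * v x)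
      (x ^ a * Real.exp (-x) * (x * v' x + (a + 1 - x) * v x)) x := by
    intro x hx
    have hx0 : x ≠ 0 := ne_of_gt hx
    have h1 : HasDerivAt (fun x : ℝ => x ^ (a + 1)) ((a + 1) * x ^ a) x := by
      simpa using Real.hasDerivAt_rpow_const (p := a + 1) (Or.inl hx0)
    have h2 : HasDerivAt (fun x : ℝ => Real.exp (-x)) (-Real.exp (-x)) x := by
      simpa using (hasDerivAt_neg x).exp
    refine ((h1.mul h2).mul (hv x hx)).congr_deriv ?_
    simp only [Pi.mul_apply]
    rw [Real.rpow_add_one hx0]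
    ring
  have hz : (0 : ℝ) ^ (a + 1) * Real.exp (-0) * v 0 = 0 := by
    simp [Real.zero_rpow ha1.ne']
  have hcont : ContinuousWithinAt (fun x => x ^ (a + 1) * Real.exp (-x) * v x) (Set.Ici 0) 0 := by
    have hb : Tendsto (fun x : ℝ => |x| ^ (a + 1) * Real.exp (-x) * (C * (1 + |x|) ^ N)) (𝓝 0)
        (𝓝 0) := by
      have : Continuous (fun x : ℝ => |x| ^ (a + 1) * Real.exp (-x) * (C * (1 + |x|) ^ N)) := by
        have : Continuous (fun x : ℝ => |x| ^ (a + 1)) :=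
          continuous_abs.rpow_const (fun x => Or.inr ha1.le)
        fun_prop
      have h0 := this.tendsto 0
      simpa [Real.zero_rpow ha1.ne'] using h0
    rw [ContinuousWithinAt, hz]
    refine squeeze_zero_norm' ?_ (hb.mono_left nhdsWithin_le_nhds)
    filter_upwards [self_mem_nhdsWithin] with x hx
    rcases (Set.mem_Ici.mp hx).eq_or_lt with rfl | hx
    · simp [Real.zero_rpow ha1.ne']
    · rw [norm_mul, norm_mul, Real.norm_of_nonneg (by positivity), Real.norm_of_nonneg
        (by positivity), abs_of_pos hx, Real.norm_eq_abs]
      gcongr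
      exact h x hx
  obtain ⟨D, hD, hD'⟩ := exists_pow_le_exp N (c := 1 / 2) (by norm_num)
  have htop : Tendsto (fun x => x ^ (a + 1) * Real.exp (-x) * v x) atTop (𝓝 0) := by
    have hb := (tendsto_rpow_mul_exp_neg_mul_atTop_nhds_zero (a + 1) (1 / 2)
      (by norm_num)).const_mul (C * D)
    rw [mul_zero] at hb
    refine squeeze_zero_norm' ?_ hb
    filter_upwards [eventually_gt_atTop 0] with x hx
    rw [norm_mul, norm_mul, Real.norm_of_nonneg (by positivity), Real.norm_of_nonneg
        (by positivity), Real.norm_eq_abs]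
    have he : Real.exp (-x) * Real.exp (1 / 2 * x) = Real.exp (-(1 / 2) * x) := by
      rw [← Real.exp_add]; ring_nf
    calc x ^ (a + 1) * Real.exp (-x) * |v x| ≤ x ^ (a + 1) * Real.exp (-x) *
          (C * (D * Real.exp (1 / 2 * x))) := by
          gcongr
          exact (h x hx).trans (by gcongr; exact hD' x hx.le)
      _ = C * D * (x ^ (a + 1) * (Real.exp (-x) * Real.exp (1 / 2 * x))) := by ring
      _ = _ := by rw [he]
  rw [integral_Ioi_of_hasDerivAt_of_tendsto hcont hderiv
    ((integrable_lagMeasure₁_iff ha _).mp hint) htop, hz]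
  simp

end OneDim

/-! ### Laguerre polynomials -/

section Laguerre

open Polynomial

lemma exists_abs_eval_le (p : ℝ[X]) :
    ∃ C : ℝ, ∃ N : ℕ, 0 ≤ C ∧ ∀ x : ℝ, 0 ≤ x → |p.eval x| ≤ C * (1 + x) ^ N := by
  induction p using Polynomial.induction_on' with
  | add p q hp hq =>
    obtain ⟨C, N, hC, h⟩ := hp
    obtain ⟨D, M, hD, h'⟩ := hq
    refine ⟨C + D, N + M, by positivity, fun x hx => ?_⟩
    have h1 : (1 : ℝ) ≤ 1 + x := by linarith
    rw [eval_add, add_mul]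
    refine (abs_add_le _ _).trans (add_le_add ((h x hx).trans ?_) ((h' x hx).trans ?_))
    · gcongr ?_ * ?_
      exact pow_le_pow_right₀ h1 (by omega)
    · gcongr ?_ * ?_
      exact pow_le_pow_right₀ h1 (by omega)
  | monomial n c =>
    refine ⟨|c|, n, abs_nonneg _, fun x hx => ?_⟩
    rw [eval_monomial, abs_mul, abs_pow, abs_of_nonneg hx]
    gcongr
    linarith

variable {a : ℝ}

lemma integrable_eval_lagMeasure₁ (ha : -(1 / 2 : ℝ) ≤ a) (p : ℝ[X]) :
    Integrable (fun x => p.eval x) (lagMeasure₁ a) := by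
  obtain ⟨C, N, -, h⟩ := exists_abs_eval_le p
  exact integrable_of_poly_growth₁ ha p.continuous.measurable.aestronglyMeasurable
    (fun x hx => h x hx.le)

lemma laguerre_coeff (a : ℝ) (n j : ℕ) : (laguerre a n).coeff j = if j ≤ n then
    (-1) ^ j * Real.Gamma (n + a + 1) /
      (Real.Gamma (j + a + 1) * (n - j).factorial * j.factorial) else 0 := by
  simp only [laguerre, finsetSum_coeff, coeff_C_mul, coeff_X_pow, mul_ite, mul_one, mul_zero]
  rw [Finset.sum_ite_eq]
  simp

/-- The two-term recurrence of the coefficients, which is the Laguerre equation read off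
coefficientwise. -/
lemma laguerre_coeff_succ (ha : -(1 / 2 : ℝ) ≤ a) (n j : ℕ) :
    (j + 1) * (j + a + 1) * (laguerre a n).coeff (j + 1) =
      -((n : ℝ) - j) * (laguerre a n).coeff j := by
  rw [laguerre_coeff, laguerre_coeff]
  rcases lt_trichotomy j n with h | h | h
  · obtain ⟨k, rfl⟩ : ∃ k, n = j + k + 1 := ⟨n - j - 1, by omega⟩
    rw [if_pos (by omega), if_pos (by omega)]
    have e1 : j + k + 1 - (j + 1) = k := by omega
    have e2 : j + k + 1 - j = k + 1 := by omega
    have hj : (j : ℝ) + a + 1 ≠ 0 := by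
      have : (0 : ℝ) ≤ j := Nat.cast_nonneg j
      intro h0; linarith
    have hG : Real.Gamma (((j + 1 : ℕ) : ℝ) + a + 1) = (j + a + 1) * Real.Gamma (j + a + 1) := by
      rw [← Real.Gamma_add_one hj]; congr 1; push_cast; ring
    have hG0 : Real.Gamma (j + a + 1) ≠ 0 := by
      have : (0 : ℝ) ≤ j := Nat.cast_nonneg j
      exact (Real.Gamma_pos_of_pos (by linarith)).ne'
    rw [e1, e2, hG, Nat.factorial_succ k, Nat.factorial_succ j]
    have : (k.factorial : ℝ) ≠ 0 := by positivity
    have : (j.factorial : ℝ) ≠ 0 := by positivity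
    have : (k : ℝ) + 1 ≠ 0 := by positivity
    have : (j : ℝ) + 1 ≠ 0 := by positivity
    push_cast
    field_simp
    ring
  · subst h
    simp
  · rw [if_neg (by omega), if_neg (by omega)]; simp

/-- The Laguerre differential equation. -/
lemma laguerre_ode (ha : -(1 / 2 : ℝ) ≤ a) (n : ℕ) :
    X * derivative (derivative (laguerre a n)) + (C (a + 1) - X) * derivative (laguerre a n) =
      -(C (n : ℝ) * laguerre a n) := by
  ext j
  have h := laguerre_coeff_succ ha n j
  rcases j with _ | j
  · simp only [coeff_add, sub_mul, coeff_sub, coeff_C_mul, coeff_neg, coeff_X_mul_zero,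
      coeff_derivative]
    simp only [Nat.cast_zero, zero_add, sub_zero] at h ⊢
    linarith
  · simp only [coeff_add, sub_mul, coeff_sub, coeff_C_mul, coeff_neg, coeff_X_mul,
      coeff_derivative]
    push_cast at h ⊢
    linarith

lemma laguerre_degree (ha : -(1 / 2 : ℝ) ≤ a) (n : ℕ) : (laguerre a n).degree = n := by
  apply le_antisymm
  · rw [degree_le_iff_coeff_zero]
    intro m hm
    rw [laguerre_coeff, if_neg (by simpa using hm)]
  · apply le_degree_of_ne_zero
    rw [laguerre_coeff, if_pos le_rfl]
    have h0 : (0 : ℝ) ≤ n := Nat.cast_nonneg n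
    have hG : Real.Gamma (n + a + 1) ≠ 0 := (Real.Gamma_pos_of_pos (by linarith)).ne'
    have : ((n.factorial : ℕ) : ℝ) ≠ 0 := by positivity
    simp only [Nat.sub_self, Nat.factorial_zero, Nat.cast_one, mul_one]
    positivity

lemma integral_sq_pos (ha : -(1 / 2 : ℝ) ≤ a) {p : ℝ[X]} (hp : p ≠ 0) :
    0 < ∫ x, p.eval x ^ 2 ∂lagMeasure₁ a := by
  have hi : Integrable (fun x => p.eval x ^ 2) (lagMeasure₁ a) := by
    have := integrable_eval_lagMeasure₁ ha (p ^ 2)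
    simp only [eval_pow] at this
    exact this
  rw [integral_pos_iff_support_of_nonneg (fun x => sq_nonneg _) hi]
  by_contra h0
  have h0' : ∀ᵐ x ∂lagMeasure₁ a, p.eval x = 0 := by
    rw [ae_iff]
    have := le_antisymm (not_lt.mp h0) zero_le
    convert this using 2
    ext x; simp [Function.support]
  rw [lagMeasure₁, ProbabilityTheory.gammaMeasure,
    ae_withDensity_iff (measurable_gammaPDF _ _)] at h0'
  have h1 : ∀ᵐ x : ℝ, ¬ 0 < x := by
    have hfin : ∀ᵐ x : ℝ, p.eval x ≠ 0 := by
      rw [ae_iff]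
      have : {x | ¬ p.eval x ≠ 0} = p.rootSet ℝ := by
        ext x; simp [mem_rootSet, hp]
      rw [this]
      exact (p.rootSet_finite ℝ).measure_zero _
    filter_upwards [h0', hfin] with x hx hx' hpos
    refine hx' (hx ?_)
    have := ProbabilityTheory.gammaPDFReal_pos (a := a + 1) (r := 1) (by linarith) one_pos hpos
    simp [ProbabilityTheory.gammaPDF, this]
  have h2 : volume (Set.Ioi (0 : ℝ)) = 0 := by
    rw [ae_iff] at h1
    simp only [not_not] at h1
    exact h1
  simp at h2

/-- The Dirichlet form of the one-dimensional Laguerre operator. -/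
lemma integral_dirichlet₁ (ha : -(1 / 2 : ℝ) ≤ a) (p q : ℝ[X]) :
    ∫ x, x * (derivative p).eval x * (derivative q).eval x ∂lagMeasure₁ a =
      -∫ x, (X * derivative (derivative p) + (C (a + 1) - X) * derivative p).eval x * q.eval x
        ∂lagMeasure₁ a := by
  obtain ⟨C₁, N₁, h₁, hb₁⟩ := exists_abs_eval_le (derivative p * q)
  obtain ⟨C₂, N₂, h₂, hb₂⟩ := exists_abs_eval_le (derivative (derivative p * q))
  have key := integral_divergence₁ ha (v := fun x => (derivative p * q).eval x)
    (v' := fun x => (derivative (derivative p * q)).eval x)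
    (fun x _ => (derivative p * q).hasDerivAt x) (derivative (derivative p * q)).continuous.measurable
    (C := C₁ + C₂) (N := N₁ + N₂) (fun x hx => (hb₁ x hx.le).trans ?_)
    (fun x hx => (hb₂ x hx.le).trans ?_)
  · rw [eq_neg_iff_add_eq_zero, ← integral_add, ← key]
    · refine integral_congr_ae (ae_of_all _ fun x => ?_)
      simp only [eval_mul, eval_add, eval_sub, eval_X, eval_C, derivative_mul]
      ring
    · have := integrable_eval_lagMeasure₁ ha (X * derivative p * derivative q)
      simp only [eval_mul, eval_X] at this
      exact this
    · have := integrable_eval_lagMeasure₁ ha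
        ((X * derivative (derivative p) + (C (a + 1) - X) * derivative p) * q)
      simp only [eval_mul (q := q)] at this
      exact this
  · gcongr
    · linarith
    · linarith
    · omega
  · gcongr
    · linarith
    · linarith
    · omega

lemma sqrt_integral_laguerre_pos (ha : -(1 / 2 : ℝ) ≤ a) (n : ℕ) :
    0 < √(∫ y, ((laguerre a n).eval y) ^ 2 ∂lagMeasure₁ a) := by
  apply Real.sqrt_pos.mpr (integral_sq_pos ha _)
  intro h
  simpa [h] using laguerre_degree ha n

lemma nlag_ode (ha : -(1 / 2 : ℝ) ≤ a) (n : ℕ) :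
    X * derivative (derivative (nlag a n)) + (C (a + 1) - X) * derivative (nlag a n) =
      -(C (n : ℝ) * nlag a n) := by
  have h := congrArg
    (fun p => C (√(∫ y, ((laguerre a n).eval y) ^ 2 ∂lagMeasure₁ a))⁻¹ * p) (laguerre_ode ha n)
  simp only [nlag, derivative_C_mul]
  linear_combination h

/-- The derivatives of Laguerre polynomials satisfy the Laguerre equation with parameter `a + 1`. -/
lemma derivative_nlag_ode (ha : -(1 / 2 : ℝ) ≤ a) (n : ℕ) :
    X * derivative (derivative (derivative (nlag a n))) +
      (C (a + 2) - X) * derivative (derivative (nlag a n)) =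
      -(C ((n : ℝ) - 1) * derivative (nlag a n)) := by
  have h := congrArg derivative (nlag_ode ha n)
  simp only [derivative_add, derivative_mul, derivative_X, derivative_sub, derivative_C,
    derivative_neg] at h
  have e1 : (C (a + 2) : ℝ[X]) = C (a + 1) + 1 := by
    rw [← C_1, ← C_add]; congr 1; ring
  rw [e1, C_sub, C_1]
  linear_combination h

lemma integral_nlag_mul_nlag (ha : -(1 / 2 : ℝ) ≤ a) (m n : ℕ) :
    ∫ x, (nlag a m).eval x * (nlag a n).eval x ∂lagMeasure₁ a = if m = n then 1 else 0 := by
  split_ifs with hmn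
  · subst hmn
    have hpos := sqrt_integral_laguerre_pos ha m
    have h0 : 0 ≤ ∫ y, ((laguerre a m).eval y) ^ 2 ∂lagMeasure₁ a :=
      integral_nonneg fun x => sq_nonneg _
    have hsq := Real.sq_sqrt h0
    calc ∫ x, (nlag a m).eval x * (nlag a m).eval x ∂lagMeasure₁ a
        = ∫ x, ((√(∫ y, ((laguerre a m).eval y) ^ 2 ∂lagMeasure₁ a)) ^ 2)⁻¹ *
            (laguerre a m).eval x ^ 2 ∂lagMeasure₁ a := by
          refine integral_congr_ae (ae_of_all _ fun x => ?_)
          simp only [nlag, eval_mul, eval_C]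
          ring
      _ = 1 := by
          rw [integral_const_mul, hsq, inv_mul_cancel₀]
          rw [← hsq]; positivity
  -- eigenfunctions of the symmetric Dirichlet form with distinct eigenvalues are orthogonal
  · have h1 := integral_dirichlet₁ ha (nlag a m) (nlag a n)
    have h2 := integral_dirichlet₁ ha (nlag a n) (nlag a m)
    rw [nlag_ode ha] at h1 h2
    have e1 : ∀ k l : ℕ, -∫ x, (-(C (k : ℝ) * nlag a k)).eval x * (nlag a l).eval x ∂lagMeasure₁ a
        = k * ∫ x, (nlag a k).eval x * (nlag a l).eval x ∂lagMeasure₁ a := by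
      intro k l
      rw [← integral_neg, ← integral_const_mul]
      refine integral_congr_ae (ae_of_all _ fun x => ?_)
      simp only [eval_neg, eval_mul, eval_C]
      ring
    rw [e1] at h1 h2
    have e2 : ∫ x, (nlag a n).eval x * (nlag a m).eval x ∂lagMeasure₁ a =
        ∫ x, (nlag a m).eval x * (nlag a n).eval x ∂lagMeasure₁ a := by
      simp_rw [mul_comm]
    have e3 : ∫ x, x * (derivative (nlag a n)).eval x * (derivative (nlag a m)).eval x
        ∂lagMeasure₁ a = ∫ x, x * (derivative (nlag a m)).eval x * (derivative (nlag a n)).eval x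
        ∂lagMeasure₁ a := by
      refine integral_congr_ae (ae_of_all _ fun x => ?_)
      simp only
      ring
    rw [e3, h1, e2] at h2
    have hne : (m : ℝ) - n ≠ 0 := sub_ne_zero.mpr (by exact_mod_cast hmn)
    have : ((m : ℝ) - n) * ∫ x, (nlag a m).eval x * (nlag a n).eval x ∂lagMeasure₁ a = 0 := by
      linarith
    exact (mul_eq_zero.mp this).resolve_left hne

/-- The derivatives of Laguerre polynomials are orthogonal with respect to `x dμ`. -/
lemma integral_derivative_nlag (ha : -(1 / 2 : ℝ) ≤ a) (m n : ℕ) :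
    ∫ x, x * (derivative (nlag a m)).eval x * (derivative (nlag a n)).eval x ∂lagMeasure₁ a =
      if m = n then (m : ℝ) else 0 := by
  rw [integral_dirichlet₁ ha, nlag_ode ha, ← integral_neg]
  calc _ = ∫ x, (m : ℝ) * ((nlag a m).eval x * (nlag a n).eval x) ∂lagMeasure₁ a := by
        refine integral_congr_ae (ae_of_all _ fun x => ?_)
        simp only [eval_neg, eval_mul, eval_C]
        ring
    _ = _ := by rw [integral_const_mul, integral_nlag_mul_nlag ha]; simp

lemma span_range_nlag (ha : -(1 / 2 : ℝ) ≤ a) :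
    Submodule.span ℝ (Set.range (nlag a)) = ⊤ := by
  let S : Polynomial.Sequence ℝ :=
    { elems' := nlag a
      degree_eq' := fun n => by
        rw [nlag, degree_C_mul (inv_ne_zero (sqrt_integral_laguerre_pos ha n).ne')]
        exact laguerre_degree ha n }
  exact S.span (fun i => IsUnit.mk0 _ (leadingCoeff_ne_zero.mpr (S.ne_zero i)))

lemma span_range_derivative_nlag (ha : -(1 / 2 : ℝ) ≤ a) :
    Submodule.span ℝ (Set.range fun n => derivative (nlag a n)) = ⊤ := by
  have h1 : (Set.range fun n => derivative (nlag a n)) =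
      (derivative : ℝ[X] →ₗ[ℝ] ℝ[X]) '' Set.range (nlag a) := by
    rw [← Set.range_comp]; rfl
  rw [h1, Submodule.span_image, span_range_nlag ha, Submodule.map_top, LinearMap.range_eq_top]
  intro p
  induction p using Polynomial.induction_on' with
  | add p q hp hq =>
    obtain ⟨p', rfl⟩ := hp
    obtain ⟨q', rfl⟩ := hq
    exact ⟨p' + q', map_add _ _ _⟩
  | monomial n c =>
    refine ⟨monomial (n + 1) (c / (n + 1)), ?_⟩
    rw [derivative_monomial]
    congr 1
    push_cast
    field_simp

end Laguerre

/-! ### Functions of polynomial growth on the orthant -/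

section Growth

variable {d : ℕ}

/-- Polynomial growth in `x ∈ (0,∞)^d`, uniformly in the time `t > -1`. Functions of `x` alone are
regarded as constant in time; the open half-line contains `0` so that derivatives at `t = 0` are
two-sided. -/
def PolyGrowth (h : (Fin d → ℝ) → ℝ → ℝ) : Prop :=
  ∃ C : ℝ, ∃ N : ℕ, 0 ≤ C ∧ ∀ x : Fin d → ℝ, (∀ i, 0 < x i) → ∀ t : ℝ, -1 < t →
    |h x t| ≤ C * (1 + ∑ i, x i) ^ N

lemma one_le_one_add_sum {x : Fin d → ℝ} (hx : ∀ i, 0 < x i) : 1 ≤ 1 + ∑ i, x i := by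
  have : 0 ≤ ∑ i, x i := Finset.sum_nonneg fun i _ => (hx i).le
  linarith

lemma PolyGrowth.const (c : ℝ) : PolyGrowth (fun (_ : Fin d → ℝ) _ => c) :=
  ⟨|c|, 0, abs_nonneg _, fun x _ t _ => by simp⟩

lemma PolyGrowth.coord (i : Fin d) : PolyGrowth (fun (x : Fin d → ℝ) _ => x i) := by
  refine ⟨1, 1, zero_le_one, fun x hx t _ => ?_⟩
  rw [abs_of_pos (hx i), one_mul, pow_one]
  have := Finset.single_le_sum (f := x) (fun j _ => (hx j).le) (Finset.mem_univ i)
  linarith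

lemma PolyGrowth.add {f g : (Fin d → ℝ) → ℝ → ℝ} (hf : PolyGrowth f) (hg : PolyGrowth g) :
    PolyGrowth (fun x t => f x t + g x t) := by
  obtain ⟨C, N, hC, h⟩ := hf
  obtain ⟨D, M, hD, h'⟩ := hg
  refine ⟨C + D, N + M, by positivity, fun x hx t ht => ?_⟩
  have h1 := one_le_one_add_sum hx
  rw [add_mul]
  refine (abs_add_le _ _).trans (add_le_add ((h x hx t ht).trans ?_) ((h' x hx t ht).trans ?_))
  · gcongr ?_ * ?_
    exact pow_le_pow_right₀ h1 (by omega)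
  · gcongr ?_ * ?_
    exact pow_le_pow_right₀ h1 (by omega)

lemma PolyGrowth.mul {f g : (Fin d → ℝ) → ℝ → ℝ} (hf : PolyGrowth f) (hg : PolyGrowth g) :
    PolyGrowth (fun x t => f x t * g x t) := by
  obtain ⟨C, N, hC, h⟩ := hf
  obtain ⟨D, M, hD, h'⟩ := hg
  refine ⟨C * D, N + M, by positivity, fun x hx t ht => ?_⟩
  have h1 := one_le_one_add_sum hx
  have h0 := (abs_nonneg _).trans (h x hx t ht)
  rw [abs_mul]
  calc |f x t| * |g x t| ≤ (C * (1 + ∑ i, x i) ^ N) * (D * (1 + ∑ i, x i) ^ M) := by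
        gcongr
        · exact h x hx t ht
        · exact h' x hx t ht
    _ = _ := by ring

lemma PolyGrowth.mono {f g : (Fin d → ℝ) → ℝ → ℝ} (hg : PolyGrowth g)
    (h : ∀ x : Fin d → ℝ, (∀ i, 0 < x i) → ∀ t : ℝ, -1 < t → |f x t| ≤ |g x t|) :
    PolyGrowth f := by
  obtain ⟨D, M, hD, h'⟩ := hg
  exact ⟨D, M, hD, fun x hx t ht => (h x hx t ht).trans (h' x hx t ht)⟩

lemma PolyGrowth.neg {f : (Fin d → ℝ) → ℝ → ℝ} (hf : PolyGrowth f) :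
    PolyGrowth (fun x t => -f x t) :=
  hf.mono fun _ _ _ _ => (abs_neg _).le

lemma PolyGrowth.sub {f g : (Fin d → ℝ) → ℝ → ℝ} (hf : PolyGrowth f) (hg : PolyGrowth g) :
    PolyGrowth (fun x t => f x t - g x t) := by
  simpa only [sub_eq_add_neg] using hf.add hg.neg

lemma PolyGrowth.pow {f : (Fin d → ℝ) → ℝ → ℝ} (hf : PolyGrowth f) (n : ℕ) :
    PolyGrowth (fun x t => f x t ^ n) := by
  induction n with
  | zero => simpa using PolyGrowth.const 1
  | succ n ih => simpa only [pow_succ] using ih.mul hf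

lemma PolyGrowth.sum {ι : Type*} (s : Finset ι) {f : ι → (Fin d → ℝ) → ℝ → ℝ}
    (hf : ∀ i, PolyGrowth (f i)) : PolyGrowth (fun x t => ∑ i ∈ s, f i x t) := by
  classical
  induction s using Finset.induction_on with
  | empty => simpa using PolyGrowth.const 0
  | insert a s ha ih => simpa only [Finset.sum_insert ha] using (hf a).add ih

lemma PolyGrowth.prod {ι : Type*} (s : Finset ι) {f : ι → (Fin d → ℝ) → ℝ → ℝ}
    (hf : ∀ i, PolyGrowth (f i)) : PolyGrowth (fun x t => ∏ i ∈ s, f i x t) := by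
  classical
  induction s using Finset.induction_on with
  | empty => simpa using PolyGrowth.const 1
  | insert a s ha ih => simpa only [Finset.prod_insert ha] using (hf a).mul ih

/-- Real powers preserve polynomial growth for functions bounded away from zero. -/
lemma PolyGrowth.rpow {f : (Fin d → ℝ) → ℝ → ℝ} (hf : PolyGrowth f) (r : ℝ) {ε : ℝ} (hε : 0 < ε)
    (h : ∀ x : Fin d → ℝ, (∀ i, 0 < x i) → ∀ t : ℝ, -1 < t → ε ≤ f x t) :
    PolyGrowth (fun x t => f x t ^ r) := by
  rcases le_or_gt 0 r with hr | hr
  · refine (((PolyGrowth.const 1).add hf).pow ⌈r⌉₊).mono fun x hx t ht => ?_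
    have hpos := hε.trans_le (h x hx t ht)
    rw [abs_of_pos (by positivity), abs_of_pos (by positivity)]
    calc f x t ^ r ≤ (1 + f x t) ^ r := Real.rpow_le_rpow hpos.le (by linarith) hr
      _ ≤ (1 + f x t) ^ ((⌈r⌉₊ : ℕ) : ℝ) :=
          Real.rpow_le_rpow_of_exponent_le (by linarith) (Nat.le_ceil r)
      _ = _ := Real.rpow_natCast _ _
  · refine (PolyGrowth.const (ε ^ r)).mono fun x hx t ht => ?_
    have hpos := hε.trans_le (h x hx t ht)
    rw [abs_of_pos (by positivity), abs_of_pos (by positivity)]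
    exact Real.rpow_le_rpow_of_nonpos hε (h x hx t ht) hr.le

lemma PolyGrowth.inv {f : (Fin d → ℝ) → ℝ → ℝ} {ε : ℝ} (hε : 0 < ε)
    (h : ∀ x : Fin d → ℝ, (∀ i, 0 < x i) → ∀ t : ℝ, -1 < t → ε ≤ f x t) :
    PolyGrowth (fun x t => (f x t)⁻¹) := by
  refine (PolyGrowth.const ε⁻¹).mono fun x hx t ht => ?_
  have hpos := hε.trans_le (h x hx t ht)
  rw [abs_of_pos (by positivity), abs_of_pos (by positivity)]
  exact inv_anti₀ hε (h x hx t ht)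

lemma PolyGrowth.eval (p : Polynomial ℝ) (i : Fin d) :
    PolyGrowth (fun (x : Fin d → ℝ) _ => p.eval (x i)) := by
  obtain ⟨C, N, hC, h⟩ := exists_abs_eval_le p
  refine ((PolyGrowth.const C).mul (((PolyGrowth.const 1).add (PolyGrowth.coord i)).pow N)).mono ?_
  intro x hx t _
  exact (h (x i) (hx i).le).trans (le_abs_self _)

end Growth

/-! ### The product measure -/

section Product

variable {d : ℕ} {α : Fin d → ℝ}

lemma isProbabilityMeasure_lagMeasure (hα : ∀ i, -(1 / 2 : ℝ) ≤ α i) :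
    IsProbabilityMeasure (lagMeasure α) := by
  have := fun i => isProbabilityMeasure_lagMeasure₁ (hα i)
  unfold lagMeasure
  infer_instance

lemma ae_pos_lagMeasure (hα : ∀ i, -(1 / 2 : ℝ) ≤ α i) :
    ∀ᵐ x ∂lagMeasure α, ∀ i, 0 < x i := by
  have := fun i => isProbabilityMeasure_lagMeasure₁ (hα i)
  rw [ae_all_iff]
  intro i
  exact Measure.tendsto_eval_ae_ae (μ := fun i => lagMeasure₁ (α i)) (i := i)
    (ae_pos_lagMeasure₁ (α i))

lemma integral_prod_lagMeasure (hα : ∀ i, -(1 / 2 : ℝ) ≤ α i) (f : Fin d → ℝ → ℝ) :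
    ∫ x, ∏ i, f i (x i) ∂lagMeasure α = ∏ i, ∫ x, f i x ∂lagMeasure₁ (α i) := by
  have := fun i => isProbabilityMeasure_lagMeasure₁ (hα i)
  exact integral_fintype_prod_eq_prod f

lemma integrable_exp_lagMeasure (hα : ∀ i, -(1 / 2 : ℝ) ≤ α i) :
    Integrable (fun x => Real.exp (1 / 2 * ∑ i, x i)) (lagMeasure α) := by
  have := fun i => isProbabilityMeasure_lagMeasure₁ (hα i)
  have := Integrable.fintype_prod (μ := fun i => lagMeasure₁ (α i))
    (f := fun _ x => Real.exp (x / 2)) (fun i => integrable_exp_half_lagMeasure₁ (hα i))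
  refine this.congr (ae_of_all _ fun x => ?_)
  simp only
  rw [← Real.exp_sum, ← Finset.sum_div]
  ring_nf

lemma integrable_pow_lagMeasure (hα : ∀ i, -(1 / 2 : ℝ) ≤ α i) (C : ℝ) (N : ℕ) :
    Integrable (fun x => C * (1 + ∑ i, x i) ^ N) (lagMeasure α) := by
  obtain ⟨D, hD, hD'⟩ := exists_pow_le_exp N (c := 1 / 2) (by norm_num)
  refine Integrable.const_mul ?_ C
  refine ((integrable_exp_lagMeasure hα).const_mul D).mono' ?_ ?_
  · exact Measurable.aestronglyMeasurable (by fun_prop)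
  · filter_upwards [ae_pos_lagMeasure hα] with x hx
    have h1 := one_le_one_add_sum hx
    rw [Real.norm_of_nonneg (by positivity)]
    exact hD' _ (by linarith)

lemma PolyGrowth.integrable (hα : ∀ i, -(1 / 2 : ℝ) ≤ α i) {h : (Fin d → ℝ) → ℝ → ℝ}
    (hh : PolyGrowth h) {t : ℝ} (ht : -1 < t) (hm : Measurable fun x => h x t) :
    Integrable (fun x => h x t) (lagMeasure α) := by
  obtain ⟨C, N, hC, hb⟩ := hh
  refine (integrable_pow_lagMeasure hα C N).mono' hm.aestronglyMeasurable ?_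
  filter_upwards [ae_pos_lagMeasure hα] with x hx
  exact hb x hx t ht

/-- Functions of polynomial growth have finite moments of all orders. -/
lemma PolyGrowth.memLp (hα : ∀ i, -(1 / 2 : ℝ) ≤ α i) {h : (Fin d → ℝ) → ℝ → ℝ}
    (hh : PolyGrowth h) {t : ℝ} (ht : -1 < t) (hm : Measurable fun x => h x t) {p : ℝ≥0∞}
    (hp : p ≠ ∞) : MemLp (fun x => h x t) p (lagMeasure α) := by
  have := isProbabilityMeasure_lagMeasure hα
  rcases eq_or_ne p 0 with rfl | hp0
  · exact memLp_zero_iff_aestronglyMeasurable.mpr hm.aestronglyMeasurable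
  obtain ⟨C, N, hC, hb⟩ := hh
  have hk : PolyGrowth fun (x : Fin d → ℝ) _ => |1 + C * (1 + ∑ i, x i) ^ N| :=
    ((PolyGrowth.const 1).add ((PolyGrowth.const C).mul (((PolyGrowth.const 1).add
      (PolyGrowth.sum Finset.univ PolyGrowth.coord)).pow N))).mono fun x _ _ _ => (abs_abs _).le
  have hk1 : ∀ x : Fin d → ℝ, (∀ i, 0 < x i) → ∀ t : ℝ, -1 < t →
      1 ≤ |1 + C * (1 + ∑ i, x i) ^ N| := by
    intro x hx _ _
    have := one_le_one_add_sum hx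
    have : 0 ≤ C * (1 + ∑ i, x i) ^ N := by positivity
    rw [abs_of_nonneg] <;> linarith
  have hL : MemLp (fun x : Fin d → ℝ => 1 + C * (1 + ∑ i, x i) ^ N) p (lagMeasure α) := by
    rw [← integrable_norm_rpow_iff (Measurable.aestronglyMeasurable (by fun_prop)) hp0 hp]
    exact (hk.rpow p.toReal one_pos hk1).integrable hα ht (by fun_prop)
  refine hL.mono hm.aestronglyMeasurable ?_
  filter_upwards [ae_pos_lagMeasure hα] with x hx
  refine (hb x hx t ht).trans (le_trans ?_ (le_abs_self _))
  linarith

/-- The integral of a divergence `x_i ∂_i v + (α_i + 1 - x_i) v` vanishes. -/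
lemma integral_divergence (hα : ∀ i, -(1 / 2 : ℝ) ≤ α i) (i : Fin d) {v v' : (Fin d → ℝ) → ℝ}
    (hv : ∀ x : Fin d → ℝ, (∀ j, 0 < x j) →
      HasDerivAt (fun s => v (Function.update x i s)) (v' x) (x i))
    (hm : Measurable v) (hm' : Measurable v') (hg : PolyGrowth fun x _ => v x)
    (hg' : PolyGrowth fun x _ => v' x) :
    ∫ x, (x i * v' x + (α i + 1 - x i) * v x) ∂lagMeasure α = 0 := by
  obtain _ | n := d
  · exact i.elim0
  have := fun i => isProbabilityMeasure_lagMeasure₁ (hα i)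
  have hint : Integrable (fun x => x i * v' x + (α i + 1 - x i) * v x) (lagMeasure α) := by
    have hG := ((PolyGrowth.coord i).mul hg').add
      (((PolyGrowth.const (α i + 1)).sub (PolyGrowth.coord i)).mul hg)
    exact hG.integrable hα (t := 0) (by norm_num) (by fun_prop)
  have hmp := (measurePreserving_piFinSuccAbove (fun j => lagMeasure₁ (α j)) i).symm
  have hα' : ∀ j, -(1 / 2 : ℝ) ≤ (fun j => α (i.succAbove j)) j := fun j => hα _
  have hae := ae_pos_lagMeasure (α := fun j => α (i.succAbove j)) hα'
  rw [lagMeasure] at hint ⊢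
  rw [← hmp.integral_comp' (g := fun x => x i * v' x + (α i + 1 - x i) * v x)]
  change ∫ z, ((fun x => x i * v' x + (α i + 1 - x i) * v x) ∘
    (MeasurableEquiv.piFinSuccAbove (fun _ => ℝ) i).symm) z ∂_ = 0
  have hint' := (hmp.integrable_comp_emb (MeasurableEquiv.measurableEmbedding _)).mpr hint
  rw [integral_prod_symm _ hint']
  refine integral_eq_zero_of_ae ?_
  filter_upwards [hae] with y hy
  simp only [MeasurableEquiv.piFinSuccAbove_symm_apply, Fin.insertNthEquiv_apply,
    Fin.insertNth_apply_same, Function.comp_apply, Pi.zero_apply]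
  obtain ⟨C, N, hC, hb⟩ := hg
  obtain ⟨D, M, hD, hb'⟩ := hg'
  have hpos : ∀ s, 0 < s → ∀ j, 0 < (Fin.insertNth (α := fun _ => ℝ) i s y) j := by
    intro s hs j
    refine Fin.succAboveCases i ?_ (fun k => ?_) j
    · simpa using hs
    · simpa using hy k
  have hy1 := one_le_one_add_sum hy
  have hsum : ∀ s, 0 < s → 1 + ∑ j, (Fin.insertNth (α := fun _ => ℝ) i s y) j ≤
      (1 + ∑ j, y j) * (1 + s) := by
    intro s hs
    rw [Fin.sum_univ_succAbove _ i]
    simp only [Fin.insertNth_apply_same, Fin.insertNth_apply_succAbove]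
    nlinarith
  refine integral_divergence₁ (hα i)
    (v := fun s => v (Fin.insertNth (α := fun _ => ℝ) i s y))
    (v' := fun s => v' (Fin.insertNth (α := fun _ => ℝ) i s y))
    (C := C * (1 + ∑ j, y j) ^ N + D * (1 + ∑ j, y j) ^ M) (N := N + M) ?_ ?_ ?_ ?_
  · intro s hs
    have := hv _ (hpos s hs)
    simpa using this
  · refine hm'.comp ?_
    exact (MeasurableEquiv.piFinSuccAbove (fun _ => ℝ) i).symm.measurable.comp
      (measurable_id.prodMk measurable_const)
  · intro s hs
    have h1 : (1 : ℝ) ≤ 1 + s := by linarith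
    have h0 := one_le_one_add_sum (hpos s hs)
    refine (hb _ (hpos s hs) 0 (by norm_num)).trans ?_
    calc C * (1 + ∑ j, (Fin.insertNth (α := fun _ => ℝ) i s y) j) ^ N
        ≤ C * ((1 + ∑ j, y j) * (1 + s)) ^ N := by gcongr; exact hsum s hs
      _ = C * (1 + ∑ j, y j) ^ N * (1 + s) ^ N := by rw [mul_pow]; ring
      _ ≤ (C * (1 + ∑ j, y j) ^ N + D * (1 + ∑ j, y j) ^ M) * (1 + s) ^ (N + M) := by
        gcongr ?_ * ?_
        · have : 0 ≤ D * (1 + ∑ j, y j) ^ M := by positivity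
          linarith
        · exact pow_le_pow_right₀ h1 (by omega)
  · intro s hs
    have h1 : (1 : ℝ) ≤ 1 + s := by linarith
    have h0 := one_le_one_add_sum (hpos s hs)
    refine (hb' _ (hpos s hs) 0 (by norm_num)).trans ?_
    calc D * (1 + ∑ j, (Fin.insertNth (α := fun _ => ℝ) i s y) j) ^ M
        ≤ D * ((1 + ∑ j, y j) * (1 + s)) ^ M := by gcongr; exact hsum s hs
      _ = D * (1 + ∑ j, y j) ^ M * (1 + s) ^ M := by rw [mul_pow]; ring
      _ ≤ (C * (1 + ∑ j, y j) ^ N + D * (1 + ∑ j, y j) ^ M) * (1 + s) ^ (N + M) := by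
        gcongr ?_ * ?_
        · have : 0 ≤ C * (1 + ∑ j, y j) ^ N := by positivity
          linarith
        · exact pow_le_pow_right₀ h1 (by omega)

end Product

/-! ### Tensor products of polynomials -/

section Tensor

open Polynomial

variable {d : ℕ} {α : Fin d → ℝ}

/-- The function `x ↦ ∏ᵢ qᵢ(xᵢ)`. -/
def tens (q : Fin d → ℝ[X]) (x : Fin d → ℝ) : ℝ := ∏ i, (q i).eval (x i)

lemma tens_update (q : Fin d → ℝ[X]) (i : Fin d) (r : ℝ[X]) (x : Fin d → ℝ) :
    tens (Function.update q i r) x = r.eval (x i) * ∏ j ∈ Finset.univ.erase i, (q j).eval (x j) := by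
  rw [tens, ← Finset.mul_prod_erase _ _ (Finset.mem_univ i), Function.update_self]
  congr 1
  refine Finset.prod_congr rfl fun j hj => ?_
  rw [Function.update_of_ne (Finset.ne_of_mem_erase hj)]

lemma tens_eq (q : Fin d → ℝ[X]) (i : Fin d) (x : Fin d → ℝ) :
    tens q x = (q i).eval (x i) * ∏ j ∈ Finset.univ.erase i, (q j).eval (x j) := by
  rw [← tens_update, Function.update_eq_self]

lemma tens_apply_update (q : Fin d → ℝ[X]) (i : Fin d) (x : Fin d → ℝ) (s : ℝ) :
    tens q (Function.update x i s) =
      (q i).eval s * ∏ j ∈ Finset.univ.erase i, (q j).eval (x j) := by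
  rw [tens_eq q i, Function.update_self]
  congr 1
  refine Finset.prod_congr rfl fun j hj => ?_
  rw [Function.update_of_ne (Finset.ne_of_mem_erase hj)]

/-- The tuple of polynomials whose tensor product is the partial derivative `∂_i` of that of `q`. -/
def dpoly (i : Fin d) (q : Fin d → ℝ[X]) : Fin d → ℝ[X] :=
  Function.update q i (derivative (q i))

lemma hasDerivAt_tens (q : Fin d → ℝ[X]) (i : Fin d) (x : Fin d → ℝ) :
    HasDerivAt (fun s => tens q (Function.update x i s)) (tens (dpoly i q) x) (x i) := by
  simp_rw [tens_apply_update]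
  rw [dpoly, tens_update]
  exact ((q i).hasDerivAt (x i)).mul_const _

@[fun_prop]
lemma continuous_tens (q : Fin d → ℝ[X]) : Continuous (tens q) := by
  unfold tens
  exact continuous_finsetProd _ fun i _ => (q i).continuous.comp (continuous_apply i)

@[fun_prop]
lemma measurable_tens (q : Fin d → ℝ[X]) : Measurable (tens q) := (continuous_tens q).measurable

lemma PolyGrowth.tens (q : Fin d → ℝ[X]) : PolyGrowth (fun x _ => LaguerreRiesz.tens q x) :=
  PolyGrowth.prod _ fun i => PolyGrowth.eval (q i) i

/-- The tuple of normalized Laguerre polynomials of degrees `k`. -/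
def ell (α : Fin d → ℝ) (k : Fin d → ℕ) (i : Fin d) : ℝ[X] := nlag (α i) (k i)

lemma lagNormalized_eq (α : Fin d → ℝ) (k : Fin d → ℕ) : lagNormalized α k = tens (ell α k) := by
  ext x
  simp [lagNormalized, tens, ell, lagNormalized₁_eq]

lemma delta_lagNormalized (α : Fin d → ℝ) (k : Fin d → ℕ) (i : Fin d) (x : Fin d → ℝ) :
    delta i (lagNormalized α k) x = √(x i) * tens (dpoly i (ell α k)) x := by
  rw [delta, lagNormalized_eq, (hasDerivAt_tens _ i x).deriv]

/-- The Laguerre operator in the variable `i` acting on an eigenfunction. -/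
lemma tens_ell_eigen (hα : ∀ i, -(1 / 2 : ℝ) ≤ α i) (k : Fin d → ℕ) (i : Fin d)
    (x : Fin d → ℝ) :
    x i * tens (dpoly i (dpoly i (ell α k))) x + (α i + 1 - x i) * tens (dpoly i (ell α k)) x =
      -(k i * tens (ell α k) x) := by
  have h := congrArg (Polynomial.eval (x i)) (nlag_ode (hα i) (k i))
  simp only [eval_add, eval_mul, eval_sub, eval_X, eval_C, eval_neg] at h
  simp only [dpoly, Function.update_self, Function.update_idem, tens_update]
  rw [tens_eq _ i]
  simp only [ell]
  linear_combination
    (∏ j ∈ Finset.univ.erase i, (nlag (α j) (k j)).eval (x j)) * h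

/-- The Laguerre operator in the variable `i` acting on the derivative `∂_j`, `j ≠ i`, of an
eigenfunction. -/
lemma tens_dpoly_ell_eigen_of_ne (hα : ∀ i, -(1 / 2 : ℝ) ≤ α i) (k : Fin d → ℕ) {i j : Fin d}
    (hij : i ≠ j) (x : Fin d → ℝ) :
    x i * tens (dpoly i (dpoly i (dpoly j (ell α k)))) x +
      (α i + 1 - x i) * tens (dpoly i (dpoly j (ell α k))) x =
      -(k i * tens (dpoly j (ell α k)) x) := by
  have h := congrArg (Polynomial.eval (x i)) (nlag_ode (hα i) (k i))
  simp only [eval_add, eval_mul, eval_sub, eval_X, eval_C, eval_neg] at h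
  generalize hq : dpoly j (ell α k) = q
  have hqi : q i = nlag (α i) (k i) := by
    rw [← hq, dpoly, Function.update_of_ne hij, ell]
  simp only [dpoly, Function.update_self, Function.update_idem, tens_update]
  rw [tens_eq _ i, hqi]
  linear_combination (∏ j ∈ Finset.univ.erase i, (q j).eval (x j)) * h

/-- The Laguerre operator with parameter raised by one in the variable `j` acting on the derivative
`∂_j` of an eigenfunction. -/
lemma tens_dpoly_ell_eigen_self (hα : ∀ i, -(1 / 2 : ℝ) ≤ α i) (k : Fin d → ℕ) (j : Fin d)
    (x : Fin d → ℝ) :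
    x j * tens (dpoly j (dpoly j (dpoly j (ell α k)))) x +
      (α j + 2 - x j) * tens (dpoly j (dpoly j (ell α k))) x =
      -((k j - 1) * tens (dpoly j (ell α k)) x) := by
  have h := congrArg (Polynomial.eval (x j)) (derivative_nlag_ode (hα j) (k j))
  simp only [eval_add, eval_mul, eval_sub, eval_X, eval_C, eval_neg] at h
  generalize hq : dpoly j (ell α k) = q
  have hqi : q j = derivative (nlag (α j) (k j)) := by
    rw [← hq, dpoly, Function.update_self, ell]
  simp only [dpoly, Function.update_self, Function.update_idem, tens_update]
  rw [tens_eq _ j, hqi]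
  linear_combination (∏ i ∈ Finset.univ.erase j, (q i).eval (x i)) * h

lemma integral_ell_mul_ell (hα : ∀ i, -(1 / 2 : ℝ) ≤ α i) (k l : Fin d → ℕ) :
    ∫ x, tens (ell α k) x * tens (ell α l) x ∂lagMeasure α = if k = l then 1 else 0 := by
  have h := integral_prod_lagMeasure hα fun i x => (ell α k i).eval x * (ell α l i).eval x
  simp only [tens, ← Finset.prod_mul_distrib]
  rw [h]
  simp only [ell, integral_nlag_mul_nlag (hα _)]
  split_ifs with hkl
  · subst hkl; simp
  · obtain ⟨i, hi⟩ := Function.ne_iff.mp hkl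
    exact Finset.prod_eq_zero (Finset.mem_univ i) (if_neg hi)

lemma integral_dpoly_ell (hα : ∀ i, -(1 / 2 : ℝ) ≤ α i) (k l : Fin d → ℕ) (j : Fin d) :
    ∫ x, x j * (tens (dpoly j (ell α k)) x * tens (dpoly j (ell α l)) x) ∂lagMeasure α =
      if k = l then (k j : ℝ) else 0 := by
  have h := integral_prod_lagMeasure hα fun i x =>
    (Function.update (fun i => ell α k i * ell α l i) j
      (X * derivative (ell α k j) * derivative (ell α l j)) i).eval x
  have e : ∀ x : Fin d → ℝ, x j * (tens (dpoly j (ell α k)) x * tens (dpoly j (ell α l)) x) =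
      ∏ i, (Function.update (fun i => ell α k i * ell α l i) j
      (X * derivative (ell α k j) * derivative (ell α l j)) i).eval (x i) := by
    intro x
    have := tens_update (fun i => ell α k i * ell α l i) j
      (X * derivative (ell α k j) * derivative (ell α l j)) x
    rw [tens] at this
    rw [this, dpoly, dpoly, tens_update, tens_update]
    simp only [eval_mul, eval_X, Finset.prod_mul_distrib]
    ring
  simp_rw [e]
  rw [h, ← Finset.mul_prod_erase _ _ (Finset.mem_univ j), Function.update_self]
  have e2 : ∏ i ∈ Finset.univ.erase j, ∫ x, (Function.update (fun i => ell α k i * ell α l i) j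
      (X * derivative (ell α k j) * derivative (ell α l j)) i).eval x ∂lagMeasure₁ (α i) =
      ∏ i ∈ Finset.univ.erase j, if k i = l i then 1 else 0 := by
    refine Finset.prod_congr rfl fun i hi => ?_
    rw [Function.update_of_ne (Finset.ne_of_mem_erase hi)]
    simp only [eval_mul, ell, integral_nlag_mul_nlag (hα _)]
  rw [e2]
  simp only [eval_mul, eval_X, ell, integral_derivative_nlag (hα _)]
  split_ifs with h1 h2 h2
  · subst h2; simp
  · obtain ⟨i, hi⟩ := Function.ne_iff.mp h2
    have hij : i ≠ j := fun h => hi (h ▸ h1)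
    rw [Finset.prod_eq_zero (Finset.mem_erase.mpr ⟨hij, Finset.mem_univ i⟩) (if_neg hi), mul_zero]
  · exact absurd (congrFun h2 j) h1
  · simp

/-- If polynomials `b i n` span `ℝ[X]` for each `i`, then every tensor product is a linear
combination of the tensor products of the `b i n`. -/
lemma tens_mem_span {b : Fin d → ℕ → ℝ[X]} (hb : ∀ i, Submodule.span ℝ (Set.range (b i)) = ⊤)
    (q : Fin d → ℝ[X]) :
    tens q ∈ Submodule.span ℝ (Set.range fun k : Fin d → ℕ => tens fun i => b i (k i)) := by
  have h : ∀ i, ∃ c : ℕ →₀ ℝ, c.sum (fun n r => r • b i n) = q i := fun i => by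
    have : q i ∈ Submodule.span ℝ (Set.range (b i)) := by rw [hb i]; trivial
    exact Finsupp.mem_span_range_iff_exists_finsupp.mp this
  choose c hc using h
  have : tens q = ∑ k ∈ Fintype.piFinset fun i => (c i).support,
      (∏ i, c i (k i)) • tens fun i => b i (k i) := by
    ext x
    simp only [tens, Finset.sum_apply, Pi.smul_apply, smul_eq_mul, ← Finset.prod_mul_distrib]
    rw [← Finset.prod_univ_sum (fun i => (c i).support)
      (fun i n => c i n * (b i n).eval (x i))]
    refine Finset.prod_congr rfl fun i _ => ?_
    rw [← hc i, Finsupp.sum, eval_finsetSum]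
    simp
  rw [this]
  exact Submodule.sum_mem _ fun k _ => Submodule.smul_mem _ _ (Submodule.subset_span ⟨k, rfl⟩)

end Tensor

/-! ### The Bellman function -/

/-- The quantity `S = U ^ (P / 2) + V ^ (Q / 2)`, where `Q = P / (P - 1)` is the exponent conjugate
to `P`. The variables `U` and `V` stand for squared norms. -/
def bellS (P U V : ℝ) : ℝ := U ^ (P / 2) + V ^ (P / (2 * (P - 1)))

/-- The weight `S ^ (1 - 2 / P)` balancing the two gradients in the Hessian estimate. -/
def bellT (P U V : ℝ) : ℝ := bellS P U V ^ ((P - 2) / P)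

/-- The Bellman function `5 (P - 1) V ^ (Q / 2) + U S ^ (1 - 2 / P)`, a smooth variant of the
Nazarov–Treil function, in terms of the squared norms `U`, `V` of its two vector arguments. -/
def bell (P U V : ℝ) : ℝ := 5 * (P - 1) * V ^ (P / (2 * (P - 1))) + U * bellT P U V

/-- The partial derivative of `bell` in `U`. -/
def bellU (P U V : ℝ) : ℝ :=
  bellT P U V * (1 + (P - 2) / 2 * (U ^ (P / 2) / bellS P U V))

/-- The partial derivative of `bell` in `V`. -/
def bellV (P U V : ℝ) : ℝ :=
  P / (2 * (P - 1)) * (V ^ (P / (2 * (P - 1))) / V) *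
    (5 * (P - 1) + (P - 2) / P * (U * bellT P U V / bellS P U V))

/-- The second partial derivative of `bell` in `U`. -/
def bellUU (P U V : ℝ) : ℝ :=
  bellT P U V / (4 * U) * (P - 2) * (U ^ (P / 2) / bellS P U V) *
    (P + 2 - 2 * (U ^ (P / 2) / bellS P U V))

/-- The mixed second partial derivative of `bell`. -/
def bellUV (P U V : ℝ) : ℝ :=
  bellT P U V * ((P - 2) / (P - 1)) * (V ^ (P / (2 * (P - 1))) / bellS P U V) ^ 2 / (2 * V)

/-- The second partial derivative of `bell` in `V`. -/
def bellVV (P U V : ℝ) : ℝ :=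
  (1 / (4 * V ^ 2)) * (5 * P * (P / (P - 1) - 2) * V ^ (P / (2 * (P - 1))) +
    U * bellT P U V * ((P - 2) / (P - 1)) * (V ^ (P / (2 * (P - 1))) / bellS P U V) *
      ((2 - 2 * (P / (P - 1))) * (V ^ (P / (2 * (P - 1))) / bellS P U V) - (P - 2) / (P - 1)))

lemma bellS_pos (P : ℝ) {U V : ℝ} (hU : 0 < U) (hV : 0 < V) : 0 < bellS P U V := by
  unfold bellS; positivity

lemma bellT_pos (P : ℝ) {U V : ℝ} (hU : 0 < U) (hV : 0 < V) : 0 < bellT P U V :=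
  Real.rpow_pos_of_pos (bellS_pos P hU hV) _

lemma hasDerivAt_rpow_curve {f : ℝ → ℝ} {f' t : ℝ} (r : ℝ) (hf : HasDerivAt f f' t)
    (h0 : 0 < f t) : HasDerivAt (fun s => f s ^ r) (r * f t ^ r * f' / f t) t := by
  have := hf.rpow_const (p := r) (Or.inl h0.ne')
  convert this using 1
  rw [Real.rpow_sub_one h0.ne']
  ring

lemma hasDerivAt_bellS {U V : ℝ → ℝ} {U' V' t : ℝ} (P : ℝ) (hU : HasDerivAt U U' t)
    (hV : HasDerivAt V V' t) (hU0 : 0 < U t) (hV0 : 0 < V t) :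
    HasDerivAt (fun s => bellS P (U s) (V s))
      (P / 2 * U t ^ (P / 2) * U' / U t +
        P / (2 * (P - 1)) * V t ^ (P / (2 * (P - 1))) * V' / V t) t :=
  (hasDerivAt_rpow_curve _ hU hU0).add (hasDerivAt_rpow_curve _ hV hV0)

lemma hasDerivAt_bellT {U V : ℝ → ℝ} {U' V' t : ℝ} (P : ℝ) (hU : HasDerivAt U U' t)
    (hV : HasDerivAt V V' t) (hU0 : 0 < U t) (hV0 : 0 < V t) :
    HasDerivAt (fun s => bellT P (U s) (V s))
      ((P - 2) / P * bellT P (U t) (V t) * (P / 2 * U t ^ (P / 2) * U' / U t +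
        P / (2 * (P - 1)) * V t ^ (P / (2 * (P - 1))) * V' / V t) / bellS P (U t) (V t)) t :=
  hasDerivAt_rpow_curve _ (hasDerivAt_bellS P hU hV hU0 hV0) (bellS_pos P hU0 hV0)

lemma hasDerivAt_bell {U V : ℝ → ℝ} {U' V' t P : ℝ} (hP : 2 ≤ P) (hU : HasDerivAt U U' t)
    (hV : HasDerivAt V V' t) (hU0 : 0 < U t) (hV0 : 0 < V t) :
    HasDerivAt (fun s => bell P (U s) (V s))
      (bellU P (U t) (V t) * U' + bellV P (U t) (V t) * V') t := by
  have hP1 : P - 1 ≠ 0 := by linarith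
  have hP0 : P ≠ 0 := by linarith
  have hS := (bellS_pos P hU0 hV0).ne'
  have := ((hasDerivAt_rpow_curve (P / (2 * (P - 1))) hV hV0).const_mul (5 * (P - 1))).add
    (hU.mul (hasDerivAt_bellT P hU hV hU0 hV0))
  refine this.congr_deriv ?_
  unfold bellU bellV
  generalize bellS P (U t) (V t) = S at *
  generalize bellT P (U t) (V t) = T at *
  generalize U t ^ (P / 2) = m at *
  generalize V t ^ (P / (2 * (P - 1))) = n at *
  have := hU0.ne'
  have := hV0.ne'
  field_simp
  ring

lemma hasDerivAt_bellU {U V : ℝ → ℝ} {U' V' t P : ℝ} (hP : 2 ≤ P) (hU : HasDerivAt U U' t)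
    (hV : HasDerivAt V V' t) (hU0 : 0 < U t) (hV0 : 0 < V t) :
    HasDerivAt (fun s => bellU P (U s) (V s))
      (bellUU P (U t) (V t) * U' + bellUV P (U t) (V t) * V') t := by
  have hP1 : P - 1 ≠ 0 := by linarith
  have hP0 : P ≠ 0 := by linarith
  have hS := (bellS_pos P hU0 hV0).ne'
  have := (hasDerivAt_bellT P hU hV hU0 hV0).mul
    ((((hasDerivAt_rpow_curve (P / 2) hU hU0).div (hasDerivAt_bellS P hU hV hU0 hV0) hS).const_mul
      ((P - 2) / 2)).const_add 1)
  refine this.congr_deriv ?_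
  unfold bellUU bellUV
  simp only [Pi.div_apply]
  have hn : V t ^ (P / (2 * (P - 1))) = bellS P (U t) (V t) - U t ^ (P / 2) := by
    unfold bellS; ring
  rw [hn]
  generalize bellS P (U t) (V t) = S at *
  generalize bellT P (U t) (V t) = T at *
  generalize U t ^ (P / 2) = m at *
  have := hU0.ne'
  have := hV0.ne'
  field_simp
  ring

lemma hasDerivAt_bellV {U V : ℝ → ℝ} {U' V' t P : ℝ} (hP : 2 ≤ P) (hU : HasDerivAt U U' t)
    (hV : HasDerivAt V V' t) (hU0 : 0 < U t) (hV0 : 0 < V t) :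
    HasDerivAt (fun s => bellV P (U s) (V s))
      (bellUV P (U t) (V t) * U' + bellVV P (U t) (V t) * V') t := by
  have hP1 : P - 1 ≠ 0 := by linarith
  have hP0 : P ≠ 0 := by linarith
  have hS := (bellS_pos P hU0 hV0).ne'
  have := (((hasDerivAt_rpow_curve (P / (2 * (P - 1))) hV hV0).div hV hV0.ne').const_mul
    (P / (2 * (P - 1)))).mul
    ((((hU.mul (hasDerivAt_bellT P hU hV hU0 hV0)).div
      (hasDerivAt_bellS P hU hV hU0 hV0) hS).const_mul ((P - 2) / P)).const_add (5 * (P - 1)))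
  refine this.congr_deriv ?_
  unfold bellVV bellUV
  simp only [Pi.mul_apply, Pi.div_apply]
  have hn : U t ^ (P / 2) = bellS P (U t) (V t) - V t ^ (P / (2 * (P - 1))) := by
    unfold bellS; ring
  rw [hn]
  generalize bellS P (U t) (V t) = S at *
  generalize bellT P (U t) (V t) = T at *
  generalize V t ^ (P / (2 * (P - 1))) = n at *
  have := hU0.ne'
  have := hV0.ne'
  field_simp
  ring

/-- The part of the Hessian estimate in the radial directions; `W = U T`, `y = n / S`,
`g = 2 - Q` and `s = Q - 1`. -/
lemma bell_radial_estimate {W S n y g s a c k : ℝ} (hW : 0 ≤ W) (hWS : W ≤ S) (hy : 0 ≤ y)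
    (hy1 : y ≤ 1) (hn : n = y * S) (hs : 0 ≤ s) (hg : 0 ≤ g) (hgs : g = 1 - s) (hk : 0 ≤ k) :
    W * a ^ 2 + n * c ^ 2 ≤ W * (2 + k) * a ^ 2 + 4 * W * g * y ^ 2 * a * c +
      (5 * (1 + s) * n + W * g * s * y * (1 - 2 * y)) * c ^ 2 := by
  have hS : 0 ≤ S := hW.trans hWS
  have hWy : W * y ≤ n := by rw [hn, mul_comm y]; gcongr
  have hn0 : 0 ≤ n := by rw [hn]; positivity
  have h1 : 0 ≤ W * (a + 2 * g * y ^ 2 * c) ^ 2 := by positivity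
  have h2 : 0 ≤ W * k * a ^ 2 := by positivity
  have h3 : W * y ^ 4 ≤ n := by
    calc W * y ^ 4 = (W * y) * y ^ 3 := by ring
      _ ≤ n * 1 := by gcongr; exact pow_le_one₀ hy hy1
      _ = n := mul_one n
  have h4 : -(n * (g * s)) ≤ W * g * s * y * (1 - 2 * y) := by
    have : W * y * (g * s) * (2 * y - 1) ≤ n * (g * s) * 1 := by
      have e1 : W * y * (g * s) * (2 * y - 1) ≤ W * y * (g * s) * 1 := by
        gcongr
        linarith
      refine e1.trans ?_
      gcongr
    linarith
  have h5 : 0 ≤ 5 * (1 + s) * n + W * g * s * y * (1 - 2 * y) - n - 4 * g ^ 2 * (W * y ^ 4) := by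
    have : 4 * g ^ 2 * (W * y ^ 4) ≤ 4 * g ^ 2 * n := by gcongr
    have : 0 ≤ n * (5 * (1 + s) - g * s - 1 - 4 * g ^ 2) := by
      apply mul_nonneg hn0
      have hs1 : s ≤ 1 := by linarith
      rw [hgs]
      nlinarith
    linarith
  have h6 := mul_nonneg h5 (sq_nonneg c)
  nlinarith

/-- The algebra behind the Hessian estimate for `bell`, with the powers replaced by positive
numbers subject to the two inequalities among them that matter. -/
lemma bell_hessian_algebra {P U V m n S T r s A B : ℝ} (hP : 2 ≤ P) (hU : 0 < U) (hV : 0 < V)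
    (hm : 0 < m) (hn : 0 < n) (hS : S = m + n) (hT : 0 < T) (hUT : U * T ≤ S) (hVT : V ≤ n * T)
    (hr : r ^ 2 ≤ 4 * U * A) (hs : s ^ 2 ≤ 4 * V * B) :
    T * A + B / T ≤
      (T / (4 * U) * (P - 2) * (m / S) * (P + 2 - 2 * (m / S))) * r ^ 2 +
      2 * (T * ((P - 2) / (P - 1)) * (n / S) ^ 2 / (2 * V)) * r * s +
      ((1 / (4 * V ^ 2)) * (5 * P * (P / (P - 1) - 2) * n +
        U * T * ((P - 2) / (P - 1)) * (n / S) *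
          ((2 - 2 * (P / (P - 1))) * (n / S) - (P - 2) / (P - 1)))) * s ^ 2 +
      2 * (T * (1 + (P - 2) / 2 * (m / S))) * A +
      2 * (P / (2 * (P - 1)) * (n / V) * (5 * (P - 1) + (P - 2) / P * (U * T / S))) * B := by
  have hS0 : 0 < S := by rw [hS]; positivity
  have hP1 : 0 < P - 1 := by linarith
  -- split `A` and `B` into the radial parts `U a²`, `V c²`, forced by the hypotheses on `r` and `s`,
  -- and nonnegative remainders
  obtain ⟨a, rfl⟩ : ∃ a, r = 2 * U * a := ⟨r / (2 * U), by field_simp⟩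
  obtain ⟨c, rfl⟩ : ∃ c, s = 2 * V * c := ⟨s / (2 * V), by field_simp⟩
  obtain ⟨A', hA', rfl⟩ : ∃ A', 0 ≤ A' ∧ A = U * a ^ 2 + A' := by
    refine ⟨A - U * a ^ 2, ?_, by ring⟩
    nlinarith
  obtain ⟨B', hB', rfl⟩ : ∃ B', 0 ≤ B' ∧ B = V * c ^ 2 + B' := by
    refine ⟨B - V * c ^ 2, ?_, by ring⟩
    nlinarith
  have hx : m / S = 1 - n / S := by rw [hS]; field_simp; ring
  have hy0 : 0 ≤ n / S := by positivity
  have hy1 : n / S ≤ 1 := by rw [div_le_one hS0]; linarith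
  have hx0 : 0 ≤ 1 - n / S := by linarith
  have hny : n = n / S * S := by field_simp
  have hk : 0 ≤ (P - 2) * (1 - n / S) * (P + 3 - 2 * (1 - n / S)) :=
    mul_nonneg (mul_nonneg (by linarith) hx0) (by linarith)
  have key := bell_radial_estimate (W := U * T) (S := S) (n := n) (y := n / S)
    (g := (P - 2) / (P - 1)) (s := 1 / (P - 1)) (a := a) (c := c)
    (k := (P - 2) * (1 - n / S) * (P + 3 - 2 * (1 - n / S)))
    (by positivity) hUT hy0 hy1 hny (by positivity) (div_nonneg (by linarith) hP1.le)
    (by field_simp; ring) hk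
  have hB1 : V * c ^ 2 / T ≤ n * c ^ 2 := by
    rw [div_le_iff₀ hT]; nlinarith [sq_nonneg c]
  have hB2 : B' / T ≤ P / (P - 1) * (n / V) *
      (5 * (P - 1) + (P - 2) / P * (U * T / S)) * B' := by
    have h1 : 1 / T ≤ n / V := by
      rw [div_le_div_iff₀ hT hV]; linarith
    have h2 : 1 ≤ P / (P - 1) := by rw [le_div_iff₀ hP1]; linarith
    have h3 : 1 ≤ 5 * (P - 1) + (P - 2) / P * (U * T / S) := by
      have : 0 ≤ (P - 2) / P * (U * T / S) :=
        mul_nonneg (div_nonneg (by linarith) (by linarith)) (by positivity)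
      linarith
    calc B' / T = 1 * (1 / T) * 1 * B' := by ring
      _ ≤ _ := by gcongr
  have hA1 : T * A' ≤ T * (2 + (P - 2) * (1 - n / S)) * A' := by
    have : 0 ≤ (P - 2) * (1 - n / S) := mul_nonneg (by linarith) hx0
    gcongr
    nlinarith
  rw [hx]
  have e1 : T * (U * a ^ 2 + A') + (V * c ^ 2 + B') / T =
    U * T * a ^ 2 + V * c ^ 2 / T + T * A' + B' / T := by ring
  rw [e1]
  have hlin : U * T * a ^ 2 + V * c ^ 2 / T + T * A' + B' / T ≤
      (U * T * (2 + (P - 2) * (1 - n / S) * (P + 3 - 2 * (1 - n / S))) * a ^ 2 +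
        4 * (U * T) * ((P - 2) / (P - 1)) * (n / S) ^ 2 * a * c +
      (5 * (1 + 1 / (P - 1)) * n + U * T * ((P - 2) / (P - 1)) * (1 / (P - 1)) * (n / S) *
        (1 - 2 * (n / S))) * c ^ 2) + T * (2 + (P - 2) * (1 - n / S)) * A' +
      P / (P - 1) * (n / V) * (5 * (P - 1) + (P - 2) / P * (U * T / S)) * B' := by linarith
  refine hlin.trans (le_of_eq ?_)
  have hP1' := hP1.ne'
  have hP0 : P ≠ 0 := by linarith
  field_simp
  ring

lemma mul_bellT_le {P U V : ℝ} (hP : 2 ≤ P) (hU : 0 < U) (hV : 0 < V) :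
    U * bellT P U V ≤ bellS P U V := by
  have hS := bellS_pos P hU hV
  have h1 : U ≤ bellS P U V ^ (2 / P) := by
    have hU' : U = (U ^ (P / 2)) ^ (2 / P) := by
      rw [← Real.rpow_mul hU.le]; field_simp; simp
    have hle : U ^ (P / 2) ≤ bellS P U V := by
      unfold bellS
      have : 0 < V ^ (P / (2 * (P - 1))) := by positivity
      linarith
    calc U = (U ^ (P / 2)) ^ (2 / P) := hU'
      _ ≤ _ := Real.rpow_le_rpow (by positivity) hle (by positivity)
  calc U * bellT P U V ≤ bellS P U V ^ (2 / P) * bellT P U V := by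
        gcongr; exact (bellT_pos P hU hV).le
    _ = bellS P U V := by
        unfold bellT
        rw [← Real.rpow_add hS]
        have : 2 / P + (P - 2) / P = 1 := by field_simp; ring
        rw [this, Real.rpow_one]

lemma le_mul_bellT {P U V : ℝ} (hP : 2 ≤ P) (hU : 0 < U) (hV : 0 < V) :
    V ≤ V ^ (P / (2 * (P - 1))) * bellT P U V := by
  have hP1 : P - 1 ≠ 0 := by linarith
  have hV' : 0 < V ^ (P / (2 * (P - 1))) := by positivity
  have h1 : V = V ^ (P / (2 * (P - 1))) * (V ^ (P / (2 * (P - 1)))) ^ ((P - 2) / P) := by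
    rw [← Real.rpow_mul hV.le, ← Real.rpow_add hV]
    have : P / (2 * (P - 1)) + P / (2 * (P - 1)) * ((P - 2) / P) = 1 := by field_simp; ring
    rw [this, Real.rpow_one]
  have h2 : (V ^ (P / (2 * (P - 1)))) ^ ((P - 2) / P) ≤ bellT P U V := by
    apply Real.rpow_le_rpow hV'.le _ (div_nonneg (by linarith) (by linarith))
    unfold bellS
    have : 0 < U ^ (P / 2) := by positivity
    linarith
  calc V = V ^ (P / (2 * (P - 1))) * (V ^ (P / (2 * (P - 1)))) ^ ((P - 2) / P) := h1
    _ ≤ _ := by gcongr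

/-- The Hessian estimate for `bell`: if `U = |f|² + ε²` and `V = |g|² + ε²` with derivatives `r`, `s`
in some direction, in which `f`, `g` have squared derivatives `A`, `B`, then the second order part of
the chain rule dominates `T A + T⁻¹ B`. -/
lemma bell_hessian {P U V r s A B : ℝ} (hP : 2 ≤ P) (hU : 0 < U) (hV : 0 < V)
    (hr : r ^ 2 ≤ 4 * U * A) (hs : s ^ 2 ≤ 4 * V * B) :
    bellT P U V * A + B / bellT P U V ≤
      bellUU P U V * r ^ 2 + 2 * bellUV P U V * r * s + bellVV P U V * s ^ 2 +
      2 * bellU P U V * A + 2 * bellV P U V * B :=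
  bell_hessian_algebra hP hU hV (by positivity) (by positivity) rfl (bellT_pos P hU hV)
    (mul_bellT_le hP hU hV) (le_mul_bellT hP hU hV) hr hs

lemma bellU_nonneg {P U V : ℝ} (hP : 2 ≤ P) (hU : 0 < U) (hV : 0 < V) : 0 ≤ bellU P U V := by
  have := bellT_pos P hU hV
  have := bellS_pos P hU hV
  have : 0 ≤ P - 2 := by linarith
  unfold bellU; positivity

lemma bellV_nonneg {P U V : ℝ} (hP : 2 ≤ P) (hU : 0 < U) (hV : 0 < V) : 0 ≤ bellV P U V := by
  have := bellT_pos P hU hV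
  have := bellS_pos P hU hV
  have : 0 ≤ P - 2 := by linarith
  have : 0 < P - 1 := by linarith
  unfold bellV; positivity

lemma bell_nonneg {P U V : ℝ} (hP : 2 ≤ P) (hU : 0 < U) (hV : 0 < V) : 0 ≤ bell P U V := by
  have := bellT_pos P hU hV
  have : 0 < P - 1 := by linarith
  unfold bell; positivity

/-- The size of the Bellman function; the second term of `bell` is handled by `U T ≤ S`. -/
lemma bell_le {P U V : ℝ} (hP : 2 ≤ P) (hU : 0 < U) (hV : 0 < V) :
    bell P U V ≤ U ^ (P / 2) + 6 * (P - 1) * V ^ (P / (2 * (P - 1))) := by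
  have h := mul_bellT_le hP hU hV
  have : 0 < V ^ (P / (2 * (P - 1))) := by positivity
  unfold bell
  unfold bellS at h
  nlinarith

/-! ### Growth of the Bellman function and its derivatives -/

section BellGrowth

variable {d : ℕ} {f g : (Fin d → ℝ) → ℝ → ℝ} {P ε : ℝ}

lemma PolyGrowth.congr {f g : (Fin d → ℝ) → ℝ → ℝ} (hg : PolyGrowth g)
    (h : ∀ x t, f x t = g x t) : PolyGrowth f :=
  hg.mono fun x _ t _ => by rw [h]

lemma bellS_lower (hP : 2 ≤ P) (hε : 0 < ε)
    (hf' : ∀ x, (∀ i, 0 < x i) → ∀ t, -1 < t → ε ≤ f x t)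
    (hg' : ∀ x, (∀ i, 0 < x i) → ∀ t, -1 < t → ε ≤ g x t) :
    ∀ x, (∀ i, 0 < x i) → ∀ t, -1 < t → ε ^ (P / 2) ≤ LaguerreRiesz.bellS P (f x t) (g x t) := by
  intro x hx t ht
  have h1 := Real.rpow_le_rpow hε.le (hf' x hx t ht) (by linarith : 0 ≤ P / 2)
  have : 0 < g x t := hε.trans_le (hg' x hx t ht)
  have : 0 < g x t ^ (P / (2 * (P - 1))) := by positivity
  unfold bellS
  linarith

lemma PolyGrowth.bellS_inv (hP : 2 ≤ P) (hε : 0 < ε)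
    (hf' : ∀ x, (∀ i, 0 < x i) → ∀ t, -1 < t → ε ≤ f x t)
    (hg' : ∀ x, (∀ i, 0 < x i) → ∀ t, -1 < t → ε ≤ g x t) :
    PolyGrowth (fun x t => (LaguerreRiesz.bellS P (f x t) (g x t))⁻¹) :=
  PolyGrowth.inv (Real.rpow_pos_of_pos hε _) (bellS_lower hP hε hf' hg')

lemma PolyGrowth.bellT (hP : 2 ≤ P) (hε : 0 < ε) (hf : PolyGrowth f) (hg : PolyGrowth g)
    (hf' : ∀ x, (∀ i, 0 < x i) → ∀ t, -1 < t → ε ≤ f x t)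
    (hg' : ∀ x, (∀ i, 0 < x i) → ∀ t, -1 < t → ε ≤ g x t) :
    PolyGrowth (fun x t => LaguerreRiesz.bellT P (f x t) (g x t)) :=
  PolyGrowth.rpow ((hf.rpow _ hε hf').add (hg.rpow _ hε hg')) _ (Real.rpow_pos_of_pos hε _)
    (bellS_lower hP hε hf' hg')

lemma PolyGrowth.bell (hP : 2 ≤ P) (hε : 0 < ε) (hf : PolyGrowth f) (hg : PolyGrowth g)
    (hf' : ∀ x, (∀ i, 0 < x i) → ∀ t, -1 < t → ε ≤ f x t)
    (hg' : ∀ x, (∀ i, 0 < x i) → ∀ t, -1 < t → ε ≤ g x t) :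
    PolyGrowth (fun x t => LaguerreRiesz.bell P (f x t) (g x t)) :=
  ((PolyGrowth.const _).mul (hg.rpow _ hε hg')).add
    (hf.mul (PolyGrowth.bellT hP hε hf hg hf' hg'))

lemma PolyGrowth.bellU (hP : 2 ≤ P) (hε : 0 < ε) (hf : PolyGrowth f) (hg : PolyGrowth g)
    (hf' : ∀ x, (∀ i, 0 < x i) → ∀ t, -1 < t → ε ≤ f x t)
    (hg' : ∀ x, (∀ i, 0 < x i) → ∀ t, -1 < t → ε ≤ g x t) :
    PolyGrowth (fun x t => LaguerreRiesz.bellU P (f x t) (g x t)) :=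
  (PolyGrowth.bellT hP hε hf hg hf' hg').mul ((PolyGrowth.const 1).add ((PolyGrowth.const _).mul
    ((hf.rpow _ hε hf').mul (PolyGrowth.bellS_inv hP hε hf' hg'))))

lemma PolyGrowth.bellV (hP : 2 ≤ P) (hε : 0 < ε) (hf : PolyGrowth f) (hg : PolyGrowth g)
    (hf' : ∀ x, (∀ i, 0 < x i) → ∀ t, -1 < t → ε ≤ f x t)
    (hg' : ∀ x, (∀ i, 0 < x i) → ∀ t, -1 < t → ε ≤ g x t) :
    PolyGrowth (fun x t => LaguerreRiesz.bellV P (f x t) (g x t)) :=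
  ((PolyGrowth.const _).mul ((hg.rpow _ hε hg').mul (PolyGrowth.inv hε hg'))).mul
    ((PolyGrowth.const _).add ((PolyGrowth.const _).mul
      ((hf.mul (PolyGrowth.bellT hP hε hf hg hf' hg')).mul (PolyGrowth.bellS_inv hP hε hf' hg'))))

lemma PolyGrowth.bellUU (hP : 2 ≤ P) (hε : 0 < ε) (hf : PolyGrowth f) (hg : PolyGrowth g)
    (hf' : ∀ x, (∀ i, 0 < x i) → ∀ t, -1 < t → ε ≤ f x t)
    (hg' : ∀ x, (∀ i, 0 < x i) → ∀ t, -1 < t → ε ≤ g x t) :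
    PolyGrowth (fun x t => LaguerreRiesz.bellUU P (f x t) (g x t)) := by
  have hx := (hf.rpow (P / 2) hε hf').mul (PolyGrowth.bellS_inv hP hε hf' hg')
  refine (((((PolyGrowth.bellT hP hε hf hg hf' hg').mul (PolyGrowth.inv hε hf')).mul
    (PolyGrowth.const ((P - 2) / 4))).mul hx).mul
    ((PolyGrowth.const (P + 2)).sub ((PolyGrowth.const 2).mul hx))).congr fun x t => ?_
  unfold LaguerreRiesz.bellUU
  rw [mul_comm 4, div_mul_eq_div_div]
  ring

lemma PolyGrowth.bellUV (hP : 2 ≤ P) (hε : 0 < ε) (hf : PolyGrowth f) (hg : PolyGrowth g)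
    (hf' : ∀ x, (∀ i, 0 < x i) → ∀ t, -1 < t → ε ≤ f x t)
    (hg' : ∀ x, (∀ i, 0 < x i) → ∀ t, -1 < t → ε ≤ g x t) :
    PolyGrowth (fun x t => LaguerreRiesz.bellUV P (f x t) (g x t)) := by
  have hy := (hg.rpow (P / (2 * (P - 1))) hε hg').mul (PolyGrowth.bellS_inv hP hε hf' hg')
  refine ((((PolyGrowth.bellT hP hε hf hg hf' hg').mul (PolyGrowth.inv hε hg')).mul
    (PolyGrowth.const ((P - 2) / (P - 1) / 2))).mul (hy.pow 2)).congr fun x t => ?_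
  unfold LaguerreRiesz.bellUV
  rw [mul_comm 2 (g x t), div_mul_eq_div_div _ (g x t)]
  ring

lemma PolyGrowth.bellVV (hP : 2 ≤ P) (hε : 0 < ε) (hf : PolyGrowth f) (hg : PolyGrowth g)
    (hf' : ∀ x, (∀ i, 0 < x i) → ∀ t, -1 < t → ε ≤ f x t)
    (hg' : ∀ x, (∀ i, 0 < x i) → ∀ t, -1 < t → ε ≤ g x t) :
    PolyGrowth (fun x t => LaguerreRiesz.bellVV P (f x t) (g x t)) := by
  have hn := hg.rpow (P / (2 * (P - 1))) hε hg'
  have hy := hn.mul (PolyGrowth.bellS_inv hP hε hf' hg')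
  have hT := PolyGrowth.bellT hP hε hf hg hf' hg'
  refine (((PolyGrowth.const (1 / 4)).mul ((PolyGrowth.inv hε hg').pow 2)).mul
    (((PolyGrowth.const (5 * P * (P / (P - 1) - 2))).mul hn).add
      ((((hf.mul hT).mul (PolyGrowth.const ((P - 2) / (P - 1)))).mul hy).mul
        (((PolyGrowth.const (2 - 2 * (P / (P - 1)))).mul hy).sub
          (PolyGrowth.const ((P - 2) / (P - 1))))))).congr fun x t => ?_
  unfold LaguerreRiesz.bellVV
  have e : 1 / (4 * g x t ^ 2) = 1 / 4 * (g x t)⁻¹ ^ 2 := by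
    rw [one_div, mul_inv, inv_pow, one_div]
  rw [e]
  ring

end BellGrowth

/-! ### Twice differentiable functions of space and time -/

section Jets

variable {d : ℕ}

/-- The restriction of `f` to the line through `(x, t)` in the time direction (`none`) or in the
direction of the `i`-th coordinate (`some i`). -/
def slice (f : (Fin d → ℝ) → ℝ → ℝ) : Option (Fin d) → (Fin d → ℝ) → ℝ → ℝ → ℝ
  | none, x, _ => fun s => f x s
  | some i, x, t => fun s => f (Function.update x i s) t

/-- The parameter at which the line in direction `l` passes through `(x, t)`. -/
def slicePoint : Option (Fin d) → (Fin d → ℝ) → ℝ → ℝ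
  | none, _, t => t
  | some i, x, _ => x i

lemma slice_slicePoint (f : (Fin d → ℝ) → ℝ → ℝ) (l : Option (Fin d)) (x : Fin d → ℝ) (t : ℝ) :
    slice f l x t (slicePoint l x t) = f x t := by
  cases l <;> simp [slice, slicePoint]

/-- A function on `(0,∞)^d × (-1,∞)`, together with its first and second derivatives in the
coordinate directions (`none` is time), all of polynomial growth. -/
structure Jet (d : ℕ) where
  /-- The function. -/
  val : (Fin d → ℝ) → ℝ → ℝ
  /-- The first derivatives. -/
  der : Option (Fin d) → (Fin d → ℝ) → ℝ → ℝ
  /-- The unmixed second derivatives. -/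
  der2 : Option (Fin d) → (Fin d → ℝ) → ℝ → ℝ
  hasDeriv : ∀ l x, (∀ i, 0 < x i) → ∀ t, -1 < t →
    HasDerivAt (slice val l x t) (der l x t) (slicePoint l x t)
  hasDeriv2 : ∀ l x, (∀ i, 0 < x i) → ∀ t, -1 < t →
    HasDerivAt (slice (der l) l x t) (der2 l x t) (slicePoint l x t)
  growth : PolyGrowth val
  growth1 : ∀ l, PolyGrowth (der l)
  growth2 : ∀ l, PolyGrowth (der2 l)
  meas : ∀ t, Measurable fun x => val x t
  meas1 : ∀ l t, Measurable fun x => der l x t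
  meas2 : ∀ l t, Measurable fun x => der2 l x t

namespace Jet

/-- A constant function as a jet. -/
def const (c : ℝ) : Jet d where
  val := fun _ _ => c
  der := fun _ _ _ => 0
  der2 := fun _ _ _ => 0
  hasDeriv := fun l _ _ _ _ => by cases l <;> exact hasDerivAt_const _ _
  hasDeriv2 := fun l _ _ _ _ => by cases l <;> exact hasDerivAt_const _ _
  growth := PolyGrowth.const c
  growth1 := fun _ => PolyGrowth.const 0
  growth2 := fun _ => PolyGrowth.const 0
  meas := fun _ => measurable_const
  meas1 := fun _ _ => measurable_const
  meas2 := fun _ _ => measurable_const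

/-- The coordinate `x_j` as a jet. -/
def coord (j : Fin d) : Jet d where
  val := fun x _ => x j
  der := fun l _ _ => if l = some j then 1 else 0
  der2 := fun _ _ _ => 0
  hasDeriv := fun l x _ t _ => by
    cases l with
    | none => simpa [slice] using hasDerivAt_const _ _
    | some i =>
      by_cases h : i = j
      · subst h
        simpa [slice] using hasDerivAt_id' _
      · simpa [slice, h, Function.update_of_ne (Ne.symm h)] using hasDerivAt_const _ _
  hasDeriv2 := fun l _ _ _ _ => by cases l <;> exact hasDerivAt_const _ _
  growth := PolyGrowth.coord j
  growth1 := fun _ => PolyGrowth.const _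
  growth2 := fun _ => PolyGrowth.const 0
  meas := fun _ => measurable_pi_apply j
  meas1 := fun _ _ => measurable_const
  meas2 := fun _ _ => measurable_const

/-- The sum of two jets. -/
def add (F G : Jet d) : Jet d where
  val := fun x t => F.val x t + G.val x t
  der := fun l x t => F.der l x t + G.der l x t
  der2 := fun l x t => F.der2 l x t + G.der2 l x t
  hasDeriv := fun l x hx t ht => by
    have := (F.hasDeriv l x hx t ht).add (G.hasDeriv l x hx t ht)
    cases l <;> exact this
  hasDeriv2 := fun l x hx t ht => by
    have := (F.hasDeriv2 l x hx t ht).add (G.hasDeriv2 l x hx t ht)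
    cases l <;> exact this
  growth := F.growth.add G.growth
  growth1 := fun l => (F.growth1 l).add (G.growth1 l)
  growth2 := fun l => (F.growth2 l).add (G.growth2 l)
  meas := fun t => (F.meas t).add (G.meas t)
  meas1 := fun l t => (F.meas1 l t).add (G.meas1 l t)
  meas2 := fun l t => (F.meas2 l t).add (G.meas2 l t)

/-- The product of two jets. -/
def mul (F G : Jet d) : Jet d where
  val := fun x t => F.val x t * G.val x t
  der := fun l x t => F.der l x t * G.val x t + F.val x t * G.der l x t
  der2 := fun l x t => F.der2 l x t * G.val x t + F.der l x t * G.der l x t +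
    (F.der l x t * G.der l x t + F.val x t * G.der2 l x t)
  hasDeriv := fun l x hx t ht => by
    have := (F.hasDeriv l x hx t ht).mul (G.hasDeriv l x hx t ht)
    rw [slice_slicePoint, slice_slicePoint] at this
    cases l <;> exact this
  hasDeriv2 := fun l x hx t ht => by
    have := ((F.hasDeriv2 l x hx t ht).mul (G.hasDeriv l x hx t ht)).add
      ((F.hasDeriv l x hx t ht).mul (G.hasDeriv2 l x hx t ht))
    simp only [slice_slicePoint] at this
    cases l <;> exact this
  growth := F.growth.mul G.growth
  growth1 := fun l => ((F.growth1 l).mul G.growth).add (F.growth.mul (G.growth1 l))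
  growth2 := fun l => (((F.growth2 l).mul G.growth).add ((F.growth1 l).mul (G.growth1 l))).add
    (((F.growth1 l).mul (G.growth1 l)).add (F.growth.mul (G.growth2 l)))
  meas := fun t => (F.meas t).mul (G.meas t)
  meas1 := fun l t => ((F.meas1 l t).mul (G.meas t)).add ((F.meas t).mul (G.meas1 l t))
  meas2 := fun l t => (((F.meas2 l t).mul (G.meas t)).add ((F.meas1 l t).mul (G.meas1 l t))).add
    (((F.meas1 l t).mul (G.meas1 l t)).add ((F.meas t).mul (G.meas2 l t)))

/-- A finite sum of jets. -/
def sum {ι : Type*} (s : Finset ι) (F : ι → Jet d) : Jet d where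
  val := fun x t => ∑ j ∈ s, (F j).val x t
  der := fun l x t => ∑ j ∈ s, (F j).der l x t
  der2 := fun l x t => ∑ j ∈ s, (F j).der2 l x t
  hasDeriv := fun l x hx t ht => by
    have := HasDerivAt.fun_sum fun j (_ : j ∈ s) => (F j).hasDeriv l x hx t ht
    cases l <;> exact this
  hasDeriv2 := fun l x hx t ht => by
    have := HasDerivAt.fun_sum fun j (_ : j ∈ s) => (F j).hasDeriv2 l x hx t ht
    cases l <;> exact this
  growth := PolyGrowth.sum s fun j => (F j).growth
  growth1 := fun l => PolyGrowth.sum s fun j => (F j).growth1 l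
  growth2 := fun l => PolyGrowth.sum s fun j => (F j).growth2 l
  meas := fun t => Finset.measurable_fun_sum s fun j _ => (F j).meas t
  meas1 := fun l t => Finset.measurable_fun_sum s fun j _ => (F j).meas1 l t
  meas2 := fun l t => Finset.measurable_fun_sum s fun j _ => (F j).meas2 l t

/-- The composition of the Bellman function with two jets bounded away from zero. -/
def bellman {P ε : ℝ} (hP : 2 ≤ P) (hε : 0 < ε) (U V : Jet d)
    (hU : ∀ x, (∀ i, 0 < x i) → ∀ t, -1 < t → ε ≤ U.val x t)
    (hV : ∀ x, (∀ i, 0 < x i) → ∀ t, -1 < t → ε ≤ V.val x t) : Jet d where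
  val := fun x t => bell P (U.val x t) (V.val x t)
  der := fun l x t => bellU P (U.val x t) (V.val x t) * U.der l x t +
    bellV P (U.val x t) (V.val x t) * V.der l x t
  der2 := fun l x t =>
    (bellUU P (U.val x t) (V.val x t) * U.der l x t +
      bellUV P (U.val x t) (V.val x t) * V.der l x t) * U.der l x t +
      bellU P (U.val x t) (V.val x t) * U.der2 l x t +
    ((bellUV P (U.val x t) (V.val x t) * U.der l x t +
      bellVV P (U.val x t) (V.val x t) * V.der l x t) * V.der l x t +
      bellV P (U.val x t) (V.val x t) * V.der2 l x t)
  hasDeriv := fun l x hx t ht => by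
    have := hasDerivAt_bell hP (U.hasDeriv l x hx t ht) (V.hasDeriv l x hx t ht)
      (by rw [slice_slicePoint]; exact hε.trans_le (hU x hx t ht))
      (by rw [slice_slicePoint]; exact hε.trans_le (hV x hx t ht))
    simp only [slice_slicePoint] at this
    cases l <;> exact this
  hasDeriv2 := fun l x hx t ht => by
    have h1 := hasDerivAt_bellU hP (U.hasDeriv l x hx t ht) (V.hasDeriv l x hx t ht)
      (by rw [slice_slicePoint]; exact hε.trans_le (hU x hx t ht))
      (by rw [slice_slicePoint]; exact hε.trans_le (hV x hx t ht))
    have h2 := hasDerivAt_bellV hP (U.hasDeriv l x hx t ht) (V.hasDeriv l x hx t ht)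
      (by rw [slice_slicePoint]; exact hε.trans_le (hU x hx t ht))
      (by rw [slice_slicePoint]; exact hε.trans_le (hV x hx t ht))
    have := (h1.mul (U.hasDeriv2 l x hx t ht)).add (h2.mul (V.hasDeriv2 l x hx t ht))
    simp only [slice_slicePoint] at this
    cases l <;> exact this
  growth := PolyGrowth.bell hP hε U.growth V.growth hU hV
  growth1 := fun l => ((PolyGrowth.bellU hP hε U.growth V.growth hU hV).mul (U.growth1 l)).add
    ((PolyGrowth.bellV hP hε U.growth V.growth hU hV).mul (V.growth1 l))
  growth2 := fun l =>
    have hUU := PolyGrowth.bellUU hP hε U.growth V.growth hU hV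
    have hUV := PolyGrowth.bellUV hP hε U.growth V.growth hU hV
    have hVV := PolyGrowth.bellVV hP hε U.growth V.growth hU hV
    have hU' := PolyGrowth.bellU hP hε U.growth V.growth hU hV
    have hV' := PolyGrowth.bellV hP hε U.growth V.growth hU hV
    have u := U.growth1 l
    have v := V.growth1 l
    ((((hUU.mul u).add (hUV.mul v)).mul u).add (hU'.mul (U.growth2 l))).add
      ((((hUV.mul u).add (hVV.mul v)).mul v).add (hV'.mul (V.growth2 l)))
  meas := fun t => by
    have := U.meas t; have := V.meas t
    unfold bell bellT bellS; fun_prop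
  meas1 := fun l t => by
    have := U.meas t; have := V.meas t; have := U.meas1 l t; have := V.meas1 l t
    unfold bellU bellV bellT bellS; fun_prop
  meas2 := fun l t => by
    have := U.meas t; have := V.meas t; have := U.meas1 l t; have := V.meas1 l t
    have := U.meas2 l t; have := V.meas2 l t
    unfold bellUU bellUV bellVV bellU bellV bellT bellS; fun_prop

end Jet

/-- The weights of the coordinate directions: `1` in time and `x_i` in the `i`-th coordinate. -/
def weight : Option (Fin d) → (Fin d → ℝ) → ℝ
  | none, _ => 1
  | some i, x => x i

lemma weight_pos {x : Fin d → ℝ} (hx : ∀ i, 0 < x i) (l : Option (Fin d)) : 0 < weight l x := by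
  cases l <;> simp [weight, hx]

/-- The operator `∂_t² + ∑_i (x_i ∂_i² + (α_i + 1 - x_i) ∂_i)`. -/
def Jet.gen (α : Fin d → ℝ) (J : Jet d) (x : Fin d → ℝ) (t : ℝ) : ℝ :=
  J.der2 none x t + ∑ i, (x i * J.der2 (some i) x t + (α i + 1 - x i) * J.der (some i) x t)

lemma Jet.gen_eq (α : Fin d → ℝ) (J : Jet d) (x : Fin d → ℝ) (t : ℝ) :
    J.gen α x t = ∑ l, weight l x * J.der2 l x t + ∑ i, (α i + 1 - x i) * J.der (some i) x t := by
  rw [Jet.gen, Fintype.sum_option, Finset.sum_add_distrib]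
  simp only [weight, one_mul]
  ring

/-- `J.Dominates α a` says that `J` behaves like a squared norm `|f|²` of a solution `f` of the
Poisson equation: there are squared directional derivatives `A l` of `f`, already multiplied by the
weights, which satisfy the Cauchy–Schwarz inequality `|∂_l J|² ≤ 4 J |∂_l f|²` and
`gen J ≥ 2 ∑ |∂_l f|²`; moreover their sum is at least `a`. -/
def Jet.Dominates (α : Fin d → ℝ) (J : Jet d) (a : (Fin d → ℝ) → ℝ → ℝ) : Prop :=
  ∀ x, (∀ i, 0 < x i) → ∀ t, -1 < t → ∃ A : Option (Fin d) → ℝ,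
    (∀ l, weight l x * J.der l x t ^ 2 ≤ 4 * J.val x t * A l) ∧
    2 * ∑ l, A l ≤ J.gen α x t ∧ a x t ≤ ∑ l, A l

/-- The Bellman function of two dominating jets is a subsolution, by `bell_hessian` in each direction
and the arithmetic-geometric mean inequality `T A + T⁻¹ B ≥ 2 √(A B)`. -/
lemma Jet.two_mul_abs_le_gen_bellman {α : Fin d → ℝ} {P ε : ℝ} (hP : 2 ≤ P) (hε : 0 < ε)
    (U V : Jet d) (hU : ∀ x, (∀ i, 0 < x i) → ∀ t, -1 < t → ε ≤ U.val x t)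
    (hV : ∀ x, (∀ i, 0 < x i) → ∀ t, -1 < t → ε ≤ V.val x t)
    {a b : (Fin d → ℝ) → ℝ → ℝ} (ha : U.Dominates α a) (hb : V.Dominates α b)
    {x : Fin d → ℝ} (hx : ∀ i, 0 < x i) {t : ℝ} (ht : -1 < t) (ha0 : 0 ≤ a x t)
    (hb0 : 0 ≤ b x t) {κ : ℝ} (hκ : κ ^ 2 ≤ a x t * b x t) :
    2 * |κ| ≤ (Jet.bellman hP hε U V hU hV).gen α x t := by
  obtain ⟨A, hA1, hA2, hA3⟩ := ha x hx t ht
  obtain ⟨B, hB1, hB2, hB3⟩ := hb x hx t ht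
  have hu := hε.trans_le (hU x hx t ht)
  have hv := hε.trans_le (hV x hx t ht)
  have hT := bellT_pos P hu hv
  have hbU := bellU_nonneg hP hu hv
  have hbV := bellV_nonneg hP hu hv
  have hH : ∀ l, bellT P (U.val x t) (V.val x t) * A l + B l / bellT P (U.val x t) (V.val x t) ≤
      weight l x * (bellUU P (U.val x t) (V.val x t) * U.der l x t ^ 2 +
        2 * bellUV P (U.val x t) (V.val x t) * U.der l x t * V.der l x t +
        bellVV P (U.val x t) (V.val x t) * V.der l x t ^ 2) +
      2 * bellU P (U.val x t) (V.val x t) * A l + 2 * bellV P (U.val x t) (V.val x t) * B l := by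
    intro l
    have hw := weight_pos hx l
    have hs : √(weight l x) * √(weight l x) = weight l x := Real.mul_self_sqrt hw.le
    have := bell_hessian hP hu hv (r := √(weight l x) * U.der l x t)
      (s := √(weight l x) * V.der l x t) (A := A l) (B := B l)
      (by rw [mul_pow, sq (√(weight l x)), hs]; exact hA1 l)
      (by rw [mul_pow, sq (√(weight l x)), hs]; exact hB1 l)
    refine this.trans (le_of_eq ?_)
    rw [mul_pow, mul_pow, sq (√(weight l x)), hs]
    linear_combination
      2 * bellUV P (U.val x t) (V.val x t) * U.der l x t * V.der l x t * hs
  have hsum := Finset.sum_le_sum fun l (_ : l ∈ Finset.univ) => hH l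
  have hgen : (Jet.bellman hP hε U V hU hV).gen α x t =
      ∑ l, weight l x * (bellUU P (U.val x t) (V.val x t) * U.der l x t ^ 2 +
        2 * bellUV P (U.val x t) (V.val x t) * U.der l x t * V.der l x t +
        bellVV P (U.val x t) (V.val x t) * V.der l x t ^ 2) +
      bellU P (U.val x t) (V.val x t) * U.gen α x t +
      bellV P (U.val x t) (V.val x t) * V.gen α x t := by
    have e1 : ∑ l, weight l x * (Jet.bellman hP hε U V hU hV).der2 l x t =
        ∑ l, weight l x * (bellUU P (U.val x t) (V.val x t) * U.der l x t ^ 2 +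
        2 * bellUV P (U.val x t) (V.val x t) * U.der l x t * V.der l x t +
        bellVV P (U.val x t) (V.val x t) * V.der l x t ^ 2) +
        bellU P (U.val x t) (V.val x t) * ∑ l, weight l x * U.der2 l x t +
        bellV P (U.val x t) (V.val x t) * ∑ l, weight l x * V.der2 l x t := by
      rw [Finset.mul_sum, Finset.mul_sum, ← Finset.sum_add_distrib, ← Finset.sum_add_distrib]
      refine Finset.sum_congr rfl fun l _ => ?_
      simp only [Jet.bellman]
      ring
    have e2 : ∑ i, (α i + 1 - x i) * (Jet.bellman hP hε U V hU hV).der (some i) x t =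
        bellU P (U.val x t) (V.val x t) * ∑ i, (α i + 1 - x i) * U.der (some i) x t +
        bellV P (U.val x t) (V.val x t) * ∑ i, (α i + 1 - x i) * V.der (some i) x t := by
      rw [Finset.mul_sum, Finset.mul_sum, ← Finset.sum_add_distrib]
      refine Finset.sum_congr rfl fun l _ => ?_
      simp only [Jet.bellman]
      ring
    rw [Jet.gen_eq, Jet.gen_eq, Jet.gen_eq, e1, e2]
    ring
  simp only [Finset.sum_add_distrib, ← Finset.mul_sum, ← Finset.sum_div] at hsum
  rw [hgen]
  have h1 := mul_le_mul_of_nonneg_left hA2 hbU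
  have h2 := mul_le_mul_of_nonneg_left hB2 hbV
  have h3 : bellT P (U.val x t) (V.val x t) * ∑ l, A l +
      (∑ l, B l) / bellT P (U.val x t) (V.val x t) ≤ _ := hsum
  have h4 : 2 * |κ| ≤ bellT P (U.val x t) (V.val x t) * ∑ l, A l +
      (∑ l, B l) / bellT P (U.val x t) (V.val x t) := by
    generalize bellT P (U.val x t) (V.val x t) = T at hT
    have h5 : κ ^ 2 ≤ (T * ∑ l, A l) * ((∑ l, B l) / T) := by
      refine hκ.trans ?_
      have : (T * ∑ l, A l) * ((∑ l, B l) / T) = (∑ l, A l) * ∑ l, B l := by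
        field_simp
      rw [this]
      gcongr
      exact ha0.trans hA3
    have h6 : 0 ≤ T * ∑ l, A l := mul_nonneg hT.le (ha0.trans hA3)
    have h7 : 0 ≤ (∑ l, B l) / T := div_nonneg (hb0.trans hB3) hT.le
    refine abs_le_of_sq_le_sq' ?_ (by positivity) |>.2
    rw [mul_pow, sq_abs]
    nlinarith [sq_nonneg (T * ∑ l, A l - (∑ l, B l) / T)]
  linarith

end Jets

/-! ### The energy argument -/

section Energy

variable {d : ℕ} {α : Fin d → ℝ}

lemma hasDerivAt_integral_of_polyGrowth (hα : ∀ i, -(1 / 2 : ℝ) ≤ α i)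
    {f f' : (Fin d → ℝ) → ℝ → ℝ}
    (hf : ∀ x, (∀ i, 0 < x i) → ∀ t, -1 < t → HasDerivAt (f x) (f' x t) t)
    (hg : PolyGrowth f) (hg' : PolyGrowth f') (hm : ∀ t, Measurable fun x => f x t)
    (hm' : ∀ t, Measurable fun x => f' x t) {t : ℝ} (ht : -1 < t) :
    HasDerivAt (fun s => ∫ x, f x s ∂lagMeasure α) (∫ x, f' x t ∂lagMeasure α) t := by
  have hint := hg.integrable hα ht (hm t)
  obtain ⟨C, N, hC, hb⟩ := hg'
  refine (hasDerivAt_integral_of_dominated_loc_of_deriv_le (μ := lagMeasure α)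
    (F := fun s x => f x s) (F' := fun s x => f' x s) (s := Set.Ioi (-1)) (x₀ := t)
    (bound := fun x => C * (1 + ∑ i, x i) ^ N) (Ioi_mem_nhds ht)
    (Eventually.of_forall fun s => (hm s).aestronglyMeasurable) hint
    (hm' t).aestronglyMeasurable ?_ (integrable_pow_lagMeasure hα C N) ?_).2
  · filter_upwards [ae_pos_lagMeasure hα] with x hx s hs
    exact hb x hx s hs
  · filter_upwards [ae_pos_lagMeasure hα] with x hx s hs
    exact hf x hx s hs

lemma Jet.integral_gen (hα : ∀ i, -(1 / 2 : ℝ) ≤ α i) (J : Jet d) {t : ℝ} (ht : -1 < t) :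
    ∫ x, J.gen α x t ∂lagMeasure α = ∫ x, J.der2 none x t ∂lagMeasure α := by
  have hfix : ∀ {f : (Fin d → ℝ) → ℝ → ℝ}, PolyGrowth f → PolyGrowth fun x _ => f x t := by
    rintro f ⟨C, N, hC, hb⟩
    exact ⟨C, N, hC, fun x hx _ _ => hb x hx t ht⟩
  have hI : ∀ i, Integrable (fun x => x i * J.der2 (some i) x t +
      (α i + 1 - x i) * J.der (some i) x t) (lagMeasure α) := fun i => by
    have := J.meas1 (some i) t
    have := J.meas2 (some i) t
    exact (((PolyGrowth.coord i).mul (J.growth2 (some i))).add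
      (((PolyGrowth.const (α i + 1)).sub (PolyGrowth.coord i)).mul
        (J.growth1 (some i)))).integrable hα ht (by fun_prop)
  have h0 := (J.growth2 none).integrable hα ht (J.meas2 none t)
  simp only [Jet.gen]
  rw [integral_add h0 (integrable_finsetSum _ fun i _ => hI i),
    integral_finsetSum _ fun i _ => hI i]
  rw [Finset.sum_eq_zero, add_zero]
  intro i _
  exact integral_divergence hα i (fun x hx => J.hasDeriv2 (some i) x hx t ht) (J.meas1 _ t)
    (J.meas2 _ t) (hfix (J.growth1 _)) (hfix (J.growth2 _))

lemma Jet.gen_integrable (hα : ∀ i, -(1 / 2 : ℝ) ≤ α i) (J : Jet d) {t : ℝ} (ht : -1 < t) :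
    Integrable (fun x => J.gen α x t) (lagMeasure α) := by
  have hI : ∀ i, Integrable (fun x => x i * J.der2 (some i) x t +
      (α i + 1 - x i) * J.der (some i) x t) (lagMeasure α) := fun i => by
    have := J.meas1 (some i) t
    have := J.meas2 (some i) t
    exact (((PolyGrowth.coord i).mul (J.growth2 (some i))).add
      (((PolyGrowth.const (α i + 1)).sub (PolyGrowth.coord i)).mul
        (J.growth1 (some i)))).integrable hα ht (by fun_prop)
  exact ((J.growth2 none).integrable hα ht (J.meas2 none t)).add
    (integrable_finsetSum _ fun i _ => hI i)

/-- A function on `(-1, ∞)` with nonnegative second derivative that is bounded above on `[0, ∞)`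
is nonincreasing on `[0, ∞)`. -/
lemma antitone_of_convex_of_bounded {K D D' : ℝ → ℝ} (hK : ∀ t, -1 < t → HasDerivAt K (D t) t)
    (hD : ∀ t, -1 < t → HasDerivAt D (D' t) t) (hD' : ∀ t, -1 < t → 0 ≤ D' t) {M : ℝ}
    (hM : ∀ t, 0 ≤ t → K t ≤ M) {t : ℝ} (ht : 0 ≤ t) : K t ≤ K 0 := by
  have hmono : MonotoneOn D (Set.Ioi (-1)) := by
    refine monotoneOn_of_deriv_nonneg (convex_Ioi _)
      (fun s hs => (hD s hs).continuousAt.continuousWithinAt) ?_ ?_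
    · rw [interior_Ioi]
      exact fun s hs => (hD s hs).differentiableAt.differentiableWithinAt
    · rw [interior_Ioi]
      intro s hs
      rw [(hD s hs).deriv]
      exact hD' s hs
  have hneg : ∀ s, 0 ≤ s → D s ≤ 0 := by
    intro s hs
    by_contra! hpos
    -- a positive slope would make `K` grow at least linearly
    have hlin : ∀ r, s < r → K s + D s * (r - s) ≤ K r := by
      intro r hr
      obtain ⟨c, hc, hc'⟩ := exists_hasDerivAt_eq_slope K D hr
        (fun u hu => (hK u (by linarith [hu.1])).continuousAt.continuousWithinAt)
        (fun u hu => hK u (by linarith [hu.1]))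
      have h1 : D s ≤ D c := hmono (by simp; linarith) (by simp; linarith [hc.1]) hc.1.le
      have h2 : 0 < r - s := by linarith
      rw [eq_div_iff h2.ne'] at hc'
      nlinarith
    have h1 : 0 ≤ M - K s := by linarith [hM s hs]
    have h2 := hlin (s + (M - K s + 1) / D s) (by
      have : 0 < (M - K s + 1) / D s := by positivity
      linarith)
    have h3 := hM (s + (M - K s + 1) / D s) (by positivity)
    have h4 : D s * (s + (M - K s + 1) / D s - s) = M - K s + 1 := by field_simp; ring
    linarith
  rcases ht.eq_or_lt with rfl | ht
  · exact le_rfl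
  obtain ⟨c, hc, hc'⟩ := exists_hasDerivAt_eq_slope K D ht
    (fun u hu => (hK u (by linarith [hu.1])).continuousAt.continuousWithinAt)
    (fun u hu => hK u (by linarith [hu.1]))
  have h1 := hneg c hc.1.le
  rw [hc', div_nonpos_iff] at h1
  rcases h1 with h1 | h1 <;> linarith [h1.1, h1.2]

/-- The energy argument: if `gen J ≥ 2 |κ|` and `H'' = ∫ κ` with `H` vanishing at infinity, then
`∫ J ∓ 2 H` is convex and bounded in time, hence nonincreasing, which bounds `H 0`. -/
lemma Jet.two_mul_abs_le_integral (hα : ∀ i, -(1 / 2 : ℝ) ≤ α i) (J : Jet d)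
    (hJ : ∀ x, (∀ i, 0 < x i) → ∀ t, -1 < t → 0 ≤ J.val x t) {κ : (Fin d → ℝ) → ℝ → ℝ}
    (hκJ : ∀ x, (∀ i, 0 < x i) → ∀ t, -1 < t → 2 * |κ x t| ≤ J.gen α x t)
    (hκ : PolyGrowth κ) (hκm : ∀ t, Measurable fun x => κ x t) {H H' : ℝ → ℝ}
    (hH : ∀ t, HasDerivAt H (H' t) t)
    (hH' : ∀ t, HasDerivAt H' (∫ x, κ x t ∂lagMeasure α) t) (hH0 : Tendsto H atTop (𝓝 0)) :
    2 * |H 0| ≤ ∫ x, J.val x 0 ∂lagMeasure α := by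
  -- the two signs are treated together
  have key : ∀ σ : ℝ, |σ| = 1 → 2 * σ * H 0 ≤ ∫ x, J.val x 0 ∂lagMeasure α := by
    intro σ hσ
    have hE : ∀ t, -1 < t → HasDerivAt (fun s => ∫ x, J.val x s ∂lagMeasure α)
        (∫ x, J.der none x t ∂lagMeasure α) t := fun t ht =>
      hasDerivAt_integral_of_polyGrowth hα (fun x hx t ht => J.hasDeriv none x hx t ht) J.growth
        (J.growth1 none) J.meas (J.meas1 none) ht
    have hE' : ∀ t, -1 < t → HasDerivAt (fun s => ∫ x, J.der none x s ∂lagMeasure α)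
        (∫ x, J.der2 none x t ∂lagMeasure α) t := fun t ht =>
      hasDerivAt_integral_of_polyGrowth hα (fun x hx t ht => J.hasDeriv2 none x hx t ht)
        (J.growth1 none) (J.growth2 none) (J.meas1 none) (J.meas2 none) ht
    obtain ⟨C, N, hC, hb⟩ := J.growth
    have hbound : ∀ t, -1 < t →
        ∫ x, J.val x t ∂lagMeasure α ≤ ∫ x, C * (1 + ∑ i, x i) ^ N ∂lagMeasure α := by
      intro t ht
      refine integral_mono_ae (J.growth.integrable hα ht (J.meas t))
        (integrable_pow_lagMeasure hα C N) ?_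
      filter_upwards [ae_pos_lagMeasure hα] with x hx
      exact (le_abs_self _).trans (hb x hx t ht)
    have hcont : Continuous H := continuous_iff_continuousAt.mpr fun t => (hH t).continuousAt
    obtain ⟨B, hB⟩ : ∃ B, ∀ t, 0 ≤ t → |H t| ≤ B := by
      obtain ⟨T, hT⟩ := (Metric.tendsto_atTop.mp hH0) 1 one_pos
      obtain ⟨B, hB⟩ := (isCompact_Icc (a := (0 : ℝ)) (b := T)).exists_bound_of_continuousOn
        hcont.continuousOn
      refine ⟨max B 1, fun t ht => ?_⟩
      rcases le_total t T with h | h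
      · exact (hB t ⟨ht, h⟩).trans (le_max_left _ _)
      · have := hT t h
        rw [Real.dist_eq, sub_zero] at this
        exact this.le.trans (le_max_right _ _)
    have hanti : ∀ t, 0 ≤ t → ∫ x, J.val x t ∂lagMeasure α - 2 * σ * H t ≤
        ∫ x, J.val x 0 ∂lagMeasure α - 2 * σ * H 0 := by
      intro t ht
      refine antitone_of_convex_of_bounded
        (K := fun t => ∫ x, J.val x t ∂lagMeasure α - 2 * σ * H t)
        (fun t ht => (hE t ht).sub ((hH t).const_mul (2 * σ)))
        (fun t ht => (hE' t ht).sub ((hH' t).const_mul (2 * σ))) ?_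
        (M := ∫ x, C * (1 + ∑ i, x i) ^ N ∂lagMeasure α + 2 * B) ?_ ht
      · intro t ht
        have hκi := hκ.integrable hα ht (hκm t)
        rw [← J.integral_gen hα ht, ← integral_const_mul,
          ← integral_sub (J.gen_integrable hα ht) (hκi.const_mul _)]
        refine integral_nonneg_of_ae ?_
        filter_upwards [ae_pos_lagMeasure hα] with x hx
        have h1 := hκJ x hx t ht
        have h2 : σ * κ x t ≤ |κ x t| := by
          calc σ * κ x t ≤ |σ * κ x t| := le_abs_self _
            _ = |κ x t| := by rw [abs_mul, hσ, one_mul]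
        simp only [Pi.zero_apply]
        linarith
      · intro t ht
        have h1 := hbound t (by linarith)
        have h2 : -(σ * H t) ≤ |H t| := by
          calc -(σ * H t) ≤ |σ * H t| := neg_le_abs _
            _ = |H t| := by rw [abs_mul, hσ, one_mul]
        have h3 := hB t ht
        linarith
    have hlim : Tendsto (fun t => -(2 * σ * H t)) atTop (𝓝 0) := by
      simpa using (hH0.const_mul (2 * σ)).neg
    have : 0 ≤ ∫ x, J.val x 0 ∂lagMeasure α - 2 * σ * H 0 := by
      refine le_of_tendsto hlim ?_
      filter_upwards [eventually_ge_atTop 0] with t ht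
      have h0 : 0 ≤ ∫ x, J.val x t ∂lagMeasure α := by
        refine integral_nonneg_of_ae ?_
        filter_upwards [ae_pos_lagMeasure hα] with x hx
        exact hJ x hx t (by linarith)
      linarith [hanti t ht]
    linarith
  rcases abs_cases (H 0) with ⟨h, -⟩ | ⟨h, -⟩
  · rw [h]
    simpa using key 1 (by simp)
  · rw [h]
    have := key (-1) (by simp)
    linarith

end Energy

/-! ### Poisson extensions -/

section Poisson

open Polynomial

variable {d : ℕ} {α : Fin d → ℝ}

/-- The length `|k|` of a multi-index, as a real number. -/
def len (k : Fin d → ℕ) : ℝ := ∑ j, (k j : ℝ)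

lemma len_nonneg (k : Fin d → ℕ) : 0 ≤ len k := Finset.sum_nonneg fun _ _ => Nat.cast_nonneg _

/-- The Poisson extension `∑ c_k e^{-t√|k|} Q_k(x)` of `∑ c_k Q_k`, where `Q_k` is the tensor
product of the polynomials `Q k i`. -/
def poisson (s : Finset (Fin d → ℕ)) (Q : (Fin d → ℕ) → Fin d → ℝ[X]) (c : (Fin d → ℕ) → ℝ)
    (x : Fin d → ℝ) (t : ℝ) : ℝ :=
  ∑ k ∈ s, c k * Real.exp (-(√(len k) * t)) * tens (Q k) x

lemma PolyGrowth.poisson (s : Finset (Fin d → ℕ)) (Q : (Fin d → ℕ) → Fin d → ℝ[X])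
    (c : (Fin d → ℕ) → ℝ) : PolyGrowth (poisson s Q c) := by
  refine PolyGrowth.sum s fun k => ((PolyGrowth.const (c k)).mul ?_).mul (PolyGrowth.tens (Q k))
  refine (PolyGrowth.const (Real.exp (√(len k)))).mono fun x _ t ht => ?_
  rw [Real.abs_exp, Real.abs_exp]
  apply Real.exp_le_exp.mpr
  nlinarith [Real.sqrt_nonneg (len k)]

lemma measurable_poisson (s : Finset (Fin d → ℕ)) (Q : (Fin d → ℕ) → Fin d → ℝ[X])
    (c : (Fin d → ℕ) → ℝ) (t : ℝ) : Measurable fun x => poisson s Q c x t := by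
  unfold poisson; fun_prop

lemma hasDerivAt_poisson_time (s : Finset (Fin d → ℕ)) (Q : (Fin d → ℕ) → Fin d → ℝ[X])
    (c : (Fin d → ℕ) → ℝ) (x : Fin d → ℝ) (t : ℝ) :
    HasDerivAt (poisson s Q c x) (poisson s Q (fun k => -√(len k) * c k) x t) t := by
  refine HasDerivAt.fun_sum fun k _ => ?_
  have h1 : HasDerivAt (fun t => Real.exp (-(√(len k) * t)))
      (Real.exp (-(√(len k) * t)) * -(√(len k) * 1)) t :=
    (((hasDerivAt_id t).const_mul _).neg).exp
  refine ((h1.const_mul (c k)).mul_const (tens (Q k) x)).congr_deriv ?_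
  ring

lemma hasDerivAt_poisson_space (s : Finset (Fin d → ℕ)) (Q : (Fin d → ℕ) → Fin d → ℝ[X])
    (c : (Fin d → ℕ) → ℝ) (i : Fin d) (x : Fin d → ℝ) (t : ℝ) :
    HasDerivAt (fun r => poisson s Q c (Function.update x i r) t)
      (poisson s (fun k => dpoly i (Q k)) c x t) (x i) :=
  HasDerivAt.fun_sum fun k _ => (hasDerivAt_tens (Q k) i x).const_mul _

/-- The Poisson extension as a jet. -/
def poissonJet (s : Finset (Fin d → ℕ)) (Q : (Fin d → ℕ) → Fin d → ℝ[X])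
    (c : (Fin d → ℕ) → ℝ) : Jet d where
  val := poisson s Q c
  der := fun l => match l with
    | none => poisson s Q (fun k => -√(len k) * c k)
    | some i => poisson s (fun k => dpoly i (Q k)) c
  der2 := fun l => match l with
    | none => poisson s Q (fun k => -√(len k) * (-√(len k) * c k))
    | some i => poisson s (fun k => dpoly i (dpoly i (Q k))) c
  hasDeriv := fun l x _ t _ => match l with
    | none => hasDerivAt_poisson_time s Q c x t
    | some i => hasDerivAt_poisson_space s Q c i x t
  hasDeriv2 := fun l x _ t _ => match l with
    | none => hasDerivAt_poisson_time s Q _ x t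
    | some i => hasDerivAt_poisson_space s _ c i x t
  growth := PolyGrowth.poisson s Q c
  growth1 := fun l => match l with
    | none => PolyGrowth.poisson _ _ _
    | some _ => PolyGrowth.poisson _ _ _
  growth2 := fun l => match l with
    | none => PolyGrowth.poisson _ _ _
    | some _ => PolyGrowth.poisson _ _ _
  meas := measurable_poisson s Q c
  meas1 := fun l => match l with
    | none => measurable_poisson _ _ _
    | some _ => measurable_poisson _ _ _
  meas2 := fun l => match l with
    | none => measurable_poisson _ _ _
    | some _ => measurable_poisson _ _ _

/-- The Poisson extension of a polynomial is annihilated by `gen`. -/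
lemma gen_poissonJet_ell (hα : ∀ i, -(1 / 2 : ℝ) ≤ α i) (s : Finset (Fin d → ℕ))
    (c : (Fin d → ℕ) → ℝ) (x : Fin d → ℝ) (t : ℝ) :
    (poissonJet s (ell α) c).gen α x t = 0 := by
  simp only [Jet.gen, poissonJet, poisson, Finset.mul_sum, ← Finset.sum_add_distrib]
  rw [Finset.sum_comm, ← Finset.sum_add_distrib]
  refine Finset.sum_eq_zero fun k _ => ?_
  have h : ∀ i, x i * (c k * Real.exp (-(√(len k) * t)) * tens (dpoly i (dpoly i (ell α k))) x) +
      (α i + 1 - x i) * (c k * Real.exp (-(√(len k) * t)) * tens (dpoly i (ell α k)) x) =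
      (-(c k * Real.exp (-(√(len k) * t)) * tens (ell α k) x)) * k i := fun i => by
    linear_combination c k * Real.exp (-(√(len k) * t)) * tens_ell_eigen hα k i x
  simp_rw [h]
  rw [← Finset.mul_sum]
  have hs : √(len k) * √(len k) = ∑ i, (k i : ℝ) := Real.mul_self_sqrt (len_nonneg k)
  linear_combination c k * Real.exp (-(√(len k) * t)) * tens (ell α k) x * hs

/-- The equation satisfied by the Poisson extension of the `j`-th component of a vector field of the
form `(√x_j h_j)_j`. -/
lemma gen_poissonJet_dpoly (hα : ∀ i, -(1 / 2 : ℝ) ≤ α i) (s : Finset (Fin d → ℕ))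
    (c : (Fin d → ℕ) → ℝ) (j : Fin d) (x : Fin d → ℝ) (t : ℝ) :
    (poissonJet s (fun k => dpoly j (ell α k)) c).gen α x t =
      (poissonJet s (fun k => dpoly j (ell α k)) c).val x t -
      (poissonJet s (fun k => dpoly j (ell α k)) c).der (some j) x t := by
  simp only [Jet.gen, poissonJet, poisson, Finset.mul_sum, ← Finset.sum_add_distrib,
    ← Finset.sum_sub_distrib]
  rw [Finset.sum_comm, ← Finset.sum_add_distrib]
  refine Finset.sum_congr rfl fun k _ => ?_
  have h : ∀ i, x i * (c k * Real.exp (-(√(len k) * t)) *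
        tens (dpoly i (dpoly i (dpoly j (ell α k)))) x) +
      (α i + 1 - x i) * (c k * Real.exp (-(√(len k) * t)) *
        tens (dpoly i (dpoly j (ell α k))) x) =
      (-(c k * Real.exp (-(√(len k) * t)) * tens (dpoly j (ell α k)) x)) * k i +
      if i = j then c k * Real.exp (-(√(len k) * t)) * (tens (dpoly j (ell α k)) x -
        tens (dpoly j (dpoly j (ell α k))) x) else 0 := fun i => by
    split_ifs with hij
    · subst hij
      linear_combination c k * Real.exp (-(√(len k) * t)) * tens_dpoly_ell_eigen_self hα k i x
    · linear_combination c k * Real.exp (-(√(len k) * t)) *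
        tens_dpoly_ell_eigen_of_ne hα k hij x
  simp_rw [h]
  rw [Finset.sum_add_distrib, ← Finset.mul_sum, Finset.sum_ite_eq' Finset.univ j,
    if_pos (Finset.mem_univ j)]
  have hs : √(len k) * √(len k) = ∑ i, (k i : ℝ) := Real.mul_self_sqrt (len_nonneg k)
  linear_combination c k * Real.exp (-(√(len k) * t)) * tens (dpoly j (ell α k)) x * hs

/-- The squared norm `F² + ε` of a scalar Poisson extension. -/
def scalarSq (F : Jet d) (ε : ℝ) : Jet d := (F.mul F).add (Jet.const ε)

/-- The squared norm `∑ x_j h_j² + ε` of the vector field `(√x_j h_j)_j`. -/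
def vectorSq (h : Fin d → Jet d) (ε : ℝ) : Jet d :=
  (Jet.sum Finset.univ fun j => (Jet.coord j).mul ((h j).mul (h j))).add (Jet.const ε)

/-- For `gen F = 0` the chain rule gives `gen (F²) = 2 ∑ |∂_l F|²` exactly. -/
lemma scalarSq_dominates {F : Jet d} (hF : ∀ x t, F.gen α x t = 0) {ε : ℝ} (hε : 0 ≤ ε) :
    (scalarSq F ε).Dominates α fun x t => ∑ j, x j * F.der (some j) x t ^ 2 := by
  intro x hx t ht
  refine ⟨fun l => weight l x * F.der l x t ^ 2, fun l => ?_, ?_, ?_⟩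
  · have := weight_pos hx l
    simp only [scalarSq, Jet.mul, Jet.add, Jet.const]
    have : 0 ≤ ε * (weight l x * F.der l x t ^ 2) := by positivity
    nlinarith
  · have hF' := hF x t
    rw [Jet.gen_eq] at hF' ⊢
    refine le_of_eq ?_
    have e1 : ∑ l, weight l x * (scalarSq F ε).der2 l x t =
        2 * ∑ l, weight l x * F.der l x t ^ 2 +
          2 * F.val x t * ∑ l, weight l x * F.der2 l x t := by
      rw [Finset.mul_sum, Finset.mul_sum, ← Finset.sum_add_distrib]
      refine Finset.sum_congr rfl fun l _ => ?_
      simp only [scalarSq, Jet.mul, Jet.add, Jet.const]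
      ring
    have e2 : ∑ i, (α i + 1 - x i) * (scalarSq F ε).der (some i) x t =
        2 * F.val x t * ∑ i, (α i + 1 - x i) * F.der (some i) x t := by
      rw [Finset.mul_sum]
      refine Finset.sum_congr rfl fun l _ => ?_
      simp only [scalarSq, Jet.mul, Jet.add, Jet.const]
      ring
    rw [e1, e2]
    linear_combination -2 * F.val x t * hF'
  · rw [Fintype.sum_option]
    simp only [weight, one_mul]
    have := sq_nonneg (F.der none x t)
    linarith

/-- The generator of `∑ x_j h_j²` is twice the sum of the squared gradients of the `√x_j h_j` plus
`∑ (x_j + α_j + 1/2) h_j²`, which is nonnegative because `α_j ≥ -1/2`. -/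
lemma vectorSq_dominates (hα : ∀ i, -(1 / 2 : ℝ) ≤ α i) {h : Fin d → Jet d}
    (hh : ∀ j x t, (h j).gen α x t = (h j).val x t - (h j).der (some j) x t) {ε : ℝ}
    (hε : 0 ≤ ε) :
    (vectorSq h ε).Dominates α fun x t => ∑ j, x j * (h j).der none x t ^ 2 := by
  intro x hx t ht
  -- `e i j / √x_i` times `√x_j` is the derivative `√x_i ∂_i` of `√x_j h_j`
  set e : Fin d → Fin d → ℝ := fun i j =>
    x i * (h j).der (some i) x t + if i = j then (h j).val x t / 2 else 0 with he
  refine ⟨fun l => match l with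
    | none => ∑ j, x j * (h j).der none x t ^ 2
    | some i => (∑ j, x j * e i j ^ 2) / x i, fun l => ?_, ?_, ?_⟩
  · have hV : ∑ j, x j * (h j).val x t ^ 2 ≤ (vectorSq h ε).val x t := by
      simp only [vectorSq, Jet.sum, Jet.mul, Jet.add, Jet.const, Jet.coord]
      simp_rw [sq]
      linarith
    have hCS : ∀ u : Fin d → ℝ, (∑ j, x j * ((h j).val x t * u j)) ^ 2 ≤
        (vectorSq h ε).val x t * ∑ j, x j * u j ^ 2 := by
      intro u
      have := Finset.sum_mul_sq_le_sq_mul_sq Finset.univ (fun j => √(x j) * (h j).val x t)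
        (fun j => √(x j) * u j)
      simp only [mul_pow, Real.sq_sqrt (hx _).le] at this
      have e1 : ∀ j, √(x j) * (h j).val x t * (√(x j) * u j) = x j * ((h j).val x t * u j) := by
        intro j
        linear_combination (h j).val x t * u j * Real.mul_self_sqrt (hx j).le
      simp only [e1] at this
      refine this.trans ?_
      have : 0 ≤ ∑ j, x j * u j ^ 2 :=
        Finset.sum_nonneg fun j _ => mul_nonneg (hx j).le (sq_nonneg _)
      gcongr
    cases l with
    | none =>
      have := hCS fun j => (h j).der none x t
      have e1 : (vectorSq h ε).der none x t =
          2 * ∑ j, x j * ((h j).val x t * (h j).der none x t) := by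
        simp only [vectorSq, Jet.sum, Jet.mul, Jet.add, Jet.const, Jet.coord, Finset.mul_sum,
          reduceCtorEq, if_false, add_zero]
        refine Finset.sum_congr rfl fun j _ => ?_
        ring
      rw [e1]
      simp only [weight]
      nlinarith
    | some i =>
      have hi := hx i
      have := hCS fun j => e i j
      have e1 : x i * (vectorSq h ε).der (some i) x t =
          2 * ∑ j, x j * ((h j).val x t * e i j) := by
        simp only [vectorSq, Jet.sum, Jet.mul, Jet.add, Jet.const, Jet.coord, Finset.mul_sum,
          Option.some.injEq, add_zero, he]
        refine Finset.sum_congr rfl fun j _ => ?_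
        split_ifs with hij
        · subst hij; ring
        · ring
      simp only [weight]
      rw [← mul_div_assoc, le_div_iff₀ hi]
      have e2 : x i * (vectorSq h ε).der (some i) x t ^ 2 * x i =
          (x i * (vectorSq h ε).der (some i) x t) ^ 2 := by ring
      rw [e2, e1]
      nlinarith
  · rw [Fintype.sum_option]
    have hgen : (vectorSq h ε).gen α x t = ∑ j, (2 * (x j * (h j).der none x t ^ 2) +
        2 * ∑ i, x j * e i j ^ 2 / x i + (x j + α j + 1 / 2) * (h j).val x t ^ 2) := by
      have e0 : (vectorSq h ε).gen α x t =
          ∑ j, ((Jet.coord j).mul ((h j).mul (h j))).gen α x t := by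
        simp only [vectorSq, Jet.gen, Jet.sum, Jet.add, Jet.const, Finset.mul_sum, add_zero,
          ← Finset.sum_add_distrib]
        rw [Finset.sum_add_distrib, Finset.sum_comm, ← Finset.sum_add_distrib]
      rw [e0]
      refine Finset.sum_congr rfl fun j _ => ?_
      have hj := hh j x t
      have key : ∀ i, x i * ((Jet.coord j).mul ((h j).mul (h j))).der2 (some i) x t +
          (α i + 1 - x i) * ((Jet.coord j).mul ((h j).mul (h j))).der (some i) x t =
          2 * (x j * e i j ^ 2 / x i) + 2 * x j * (h j).val x t * (x i * (h j).der2 (some i) x t +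
            (α i + 1 - x i) * (h j).der (some i) x t) +
          if i = j then 2 * x j * (h j).val x t * (h j).der (some j) x t +
            (α j + 1 / 2 - x j) * (h j).val x t ^ 2 else 0 := by
        intro i
        have hi := (hx i).ne'
        simp only [Jet.mul, Jet.coord, Option.some.injEq, he]
        split_ifs with hij
        · subst hij
          field_simp
          ring
        · field_simp
          ring
      rw [Jet.gen] at hj ⊢
      simp_rw [key]
      rw [Finset.sum_add_distrib, Finset.sum_add_distrib, ← Finset.mul_sum, ← Finset.mul_sum,
        Finset.sum_ite_eq' Finset.univ j, if_pos (Finset.mem_univ j)]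
      simp only [Jet.mul, Jet.coord, reduceCtorEq, if_false]
      linear_combination 2 * x j * (h j).val x t * hj
    rw [hgen]
    simp only [Finset.sum_add_distrib, ← Finset.mul_sum]
    have e3 : ∑ i, (∑ j, x j * e i j ^ 2) / x i = ∑ j, ∑ i, x j * e i j ^ 2 / x i := by
      rw [Finset.sum_comm]
      simp_rw [Finset.sum_div]
    rw [e3]
    have : 0 ≤ ∑ j, (x j + α j + 1 / 2) * (h j).val x t ^ 2 :=
      Finset.sum_nonneg fun j _ => mul_nonneg (by linarith [hα j, hx j]) (sq_nonneg _)
    linarith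
  · rw [Fintype.sum_option]
    have : 0 ≤ ∑ i, (∑ j, x j * e i j ^ 2) / x i :=
      Finset.sum_nonneg fun i _ => div_nonneg
        (Finset.sum_nonneg fun j _ => mul_nonneg (hx j).le (sq_nonneg _)) (hx i).le
    simp only
    linarith

end Poisson

/-! ### The bilinear estimate -/

section Bilinear

open Polynomial

variable {d : ℕ} {α : Fin d → ℝ}

/-- The finite expansion `∑ c_k Q_k(x)`, where `Q_k` is the tensor product of the polynomials
`Q k i`. -/
def expand (s : Finset (Fin d → ℕ)) (Q : (Fin d → ℕ) → Fin d → ℝ[X]) (c : (Fin d → ℕ) → ℝ)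
    (x : Fin d → ℝ) : ℝ :=
  ∑ k ∈ s, c k * tens (Q k) x

@[fun_prop]
lemma measurable_expand (s : Finset (Fin d → ℕ)) (Q : (Fin d → ℕ) → Fin d → ℝ[X])
    (c : (Fin d → ℕ) → ℝ) : Measurable (expand s Q c) := by
  unfold expand; fun_prop

lemma PolyGrowth.expand (s : Finset (Fin d → ℕ)) (Q : (Fin d → ℕ) → Fin d → ℝ[X])
    (c : (Fin d → ℕ) → ℝ) : PolyGrowth fun x _ => expand s Q c x :=
  PolyGrowth.sum s fun k => (PolyGrowth.const (c k)).mul (PolyGrowth.tens (Q k))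

lemma poisson_zero (s : Finset (Fin d → ℕ)) (Q : (Fin d → ℕ) → Fin d → ℝ[X])
    (c : (Fin d → ℕ) → ℝ) (x : Fin d → ℝ) : poisson s Q c x 0 = expand s Q c x := by
  simp [poisson, expand]

lemma expand_const_mul (s : Finset (Fin d → ℕ)) (Q : (Fin d → ℕ) → Fin d → ℝ[X])
    (c : (Fin d → ℕ) → ℝ) (a : ℝ) (x : Fin d → ℝ) :
    expand s Q (fun k => a * c k) x = a * expand s Q c x := by
  simp only [expand, Finset.mul_sum, mul_assoc]

/-- The scalar function with Laguerre coefficients `c`. -/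
def scalarFun (α : Fin d → ℝ) (s : Finset (Fin d → ℕ)) (c : (Fin d → ℕ) → ℝ) :
    (Fin d → ℝ) → ℝ :=
  expand s (ell α) c

/-- The squared norm of the vector field whose `j`-th component is `∑ D_{j,k} δ_j φ_k`. -/
def vectorFunSq (α : Fin d → ℝ) (s : Finset (Fin d → ℕ)) (D : Fin d → (Fin d → ℕ) → ℝ)
    (x : Fin d → ℝ) : ℝ :=
  ∑ j, x j * expand s (fun k => dpoly j (ell α k)) (D j) x ^ 2

/-- The pairing of the Riesz vector of `∑ c_k φ_k` with the vector field with coefficients `D`. -/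
def pairing (s : Finset (Fin d → ℕ)) (c : (Fin d → ℕ) → ℝ) (D : Fin d → (Fin d → ℕ) → ℝ) : ℝ :=
  ∑ j, ∑ k ∈ s, c k * D j k * (k j * (√(len k))⁻¹)

lemma PolyGrowth.vectorFunSq (s : Finset (Fin d → ℕ)) (D : Fin d → (Fin d → ℕ) → ℝ) :
    PolyGrowth fun x _ => vectorFunSq α s D x :=
  PolyGrowth.sum _ fun j => (PolyGrowth.coord j).mul ((PolyGrowth.expand _ _ _).pow 2)

@[fun_prop]
lemma measurable_vectorFunSq (s : Finset (Fin d → ℕ)) (D : Fin d → (Fin d → ℕ) → ℝ) :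
    Measurable (vectorFunSq α s D) := by
  unfold vectorFunSq; fun_prop

@[fun_prop]
lemma measurable_scalarFun (s : Finset (Fin d → ℕ)) (c : (Fin d → ℕ) → ℝ) :
    Measurable (scalarFun α s c) := by
  unfold scalarFun; fun_prop

lemma vectorFunSq_nonneg {s : Finset (Fin d → ℕ)} {D : Fin d → (Fin d → ℕ) → ℝ}
    {x : Fin d → ℝ} (hx : ∀ i, 0 < x i) : 0 ≤ vectorFunSq α s D x :=
  Finset.sum_nonneg fun j _ => mul_nonneg (hx j).le (sq_nonneg _)

/-- Parseval's identity for the partial derivatives of expansions. -/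
lemma integral_dpoly_expand (hα : ∀ i, -(1 / 2 : ℝ) ≤ α i) (s : Finset (Fin d → ℕ))
    (c c' : (Fin d → ℕ) → ℝ) (j : Fin d) :
    ∫ x, x j * (expand s (fun k => dpoly j (ell α k)) c x *
      expand s (fun k => dpoly j (ell α k)) c' x) ∂lagMeasure α =
      ∑ k ∈ s, c k * c' k * k j := by
  have hI : ∀ k l : Fin d → ℕ, Integrable (fun x : Fin d → ℝ => c k * c' l *
      (x j * (tens (dpoly j (ell α k)) x * tens (dpoly j (ell α l)) x))) (lagMeasure α) := by
    intro k l
    exact ((PolyGrowth.coord j).mul ((PolyGrowth.tens (dpoly j (ell α k))).mul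
      (PolyGrowth.tens (dpoly j (ell α l))))).integrable hα (t := 0) (by norm_num)
      (by fun_prop) |>.const_mul _
  have e : ∀ x : Fin d → ℝ, x j * (expand s (fun k => dpoly j (ell α k)) c x *
      expand s (fun k => dpoly j (ell α k)) c' x) = ∑ k ∈ s, ∑ l ∈ s, c k * c' l *
        (x j * (tens (dpoly j (ell α k)) x * tens (dpoly j (ell α l)) x)) := by
    intro x
    rw [expand, expand, Finset.sum_mul_sum, Finset.mul_sum]
    refine Finset.sum_congr rfl fun k _ => ?_
    rw [Finset.mul_sum]
    refine Finset.sum_congr rfl fun l _ => ?_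
    ring
  simp_rw [e]
  rw [integral_finsetSum _ fun k _ => integrable_finsetSum _ fun l _ => hI k l]
  refine Finset.sum_congr rfl fun k hk => ?_
  rw [integral_finsetSum _ fun l _ => hI k l]
  simp_rw [integral_const_mul, integral_dpoly_ell hα]
  simp [hk]

/-- The pairing is controlled by the integral of the Bellman function at time `0`, for either order
of the two arguments. -/
lemma abs_pairing_le_integral (hα : ∀ i, -(1 / 2 : ℝ) ≤ α i) (s : Finset (Fin d → ℕ))
    (c : (Fin d → ℕ) → ℝ) (D : Fin d → (Fin d → ℕ) → ℝ) (J : Jet d)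
    (hJ : ∀ x, (∀ i, 0 < x i) → ∀ t, -1 < t → 0 ≤ J.val x t)
    (hgen : ∀ x, (∀ i, 0 < x i) → ∀ t, -1 < t →
      2 * |∑ j, x j * ((poissonJet s (ell α) c).der (some j) x t *
        (poissonJet s (fun k => dpoly j (ell α k)) (D j)).der none x t)| ≤ J.gen α x t) :
    |pairing s c D| ≤ 2 * ∫ x, J.val x 0 ∂lagMeasure α := by
  -- for `k = 0` the factor `(√(len k))⁻¹` is the junk value `0`, multiplied by `k j = 0`
  have hzero : ∀ (k : Fin d → ℕ) (j : Fin d), √(len k) = 0 → (k j : ℝ) = 0 := by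
    intro k j h
    rw [Real.sqrt_eq_zero (len_nonneg k), len,
      Finset.sum_eq_zero_iff_of_nonneg fun _ _ => Nat.cast_nonneg _] at h
    exact h j (Finset.mem_univ j)
  have hexp : ∀ (k : Fin d → ℕ) (t : ℝ), HasDerivAt (fun t => Real.exp (-(2 * √(len k) * t)))
      (Real.exp (-(2 * √(len k) * t)) * -(2 * √(len k) * 1)) t := fun k t =>
    (((hasDerivAt_id t).const_mul _).neg).exp
  -- `H` is `-1/4` times the pairing of the Poisson extensions at time `t`
  have key := J.two_mul_abs_le_integral hα hJ hgen
    (PolyGrowth.sum _ fun j => (PolyGrowth.coord j).mul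
      ((Jet.growth1 _ _).mul (Jet.growth1 _ _)))
    (fun t => Finset.measurable_fun_sum _ fun j _ => (measurable_pi_apply j).mul
      ((Jet.meas1 _ _ t).mul (Jet.meas1 _ _ t)))
    (H := fun t => ∑ j, ∑ k ∈ s, -(c k * D j k * (k j * (√(len k))⁻¹) / 4) *
      Real.exp (-(2 * √(len k) * t)))
    (H' := fun t => ∑ j, ∑ k ∈ s, (c k * D j k * k j / 2) * Real.exp (-(2 * √(len k) * t)))
    ?_ ?_ ?_
  · have e : |∑ j, ∑ k ∈ s, -(c k * D j k * (k j * (√(len k))⁻¹) / 4) *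
        Real.exp (-(2 * √(len k) * 0))| = |pairing s c D| / 4 := by
      simp only [mul_zero, neg_zero, Real.exp_zero, mul_one, Finset.sum_neg_distrib, abs_neg,
        ← Finset.sum_div]
      rw [abs_div, pairing]
      norm_num
    rw [e] at key
    linarith
  · intro t
    refine HasDerivAt.fun_sum fun j _ => HasDerivAt.fun_sum fun k _ => ?_
    refine ((hexp k t).const_mul _).congr_deriv ?_
    by_cases h : √(len k) = 0
    · rw [hzero k j h]; ring
    · field_simp
      ring
  · intro t
    have e : ∫ x, ∑ j, x j * ((poissonJet s (ell α) c).der (some j) x t *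
        (poissonJet s (fun k => dpoly j (ell α k)) (D j)).der none x t) ∂lagMeasure α =
        ∑ j, ∑ k ∈ s, (c k * Real.exp (-(√(len k) * t))) *
          (-√(len k) * D j k * Real.exp (-(√(len k) * t))) * k j := by
      have e1 : ∀ (j : Fin d) (x : Fin d → ℝ), x j * ((poissonJet s (ell α) c).der (some j) x t *
        (poissonJet s (fun k => dpoly j (ell α k)) (D j)).der none x t) =
        x j * (expand s (fun k => dpoly j (ell α k)) (fun k => c k * Real.exp (-(√(len k) * t))) x *
          expand s (fun k => dpoly j (ell α k))
            (fun k => -√(len k) * D j k * Real.exp (-(√(len k) * t))) x) := fun j x => rfl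
      simp_rw [e1]
      rw [integral_finsetSum]
      · exact Finset.sum_congr rfl fun j _ => integral_dpoly_expand hα _ _ _ _
      · intro j _
        exact ((PolyGrowth.coord j).mul ((PolyGrowth.expand _ _ _).mul
          (PolyGrowth.expand _ _ _))).integrable hα (t := 0) (by norm_num) (by fun_prop)
    rw [e]
    refine HasDerivAt.fun_sum fun j _ => HasDerivAt.fun_sum fun k _ => ?_
    refine ((hexp k t).const_mul _).congr_deriv ?_
    have : Real.exp (-(2 * √(len k) * t)) =
        Real.exp (-(√(len k) * t)) * Real.exp (-(√(len k) * t)) := by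
      rw [← Real.exp_add]; ring_nf
    rw [this]
    ring
  · have : Tendsto (fun t : ℝ => ∑ j : Fin d, ∑ k ∈ s, -(c k * D j k * (k j * (√(len k))⁻¹) / 4) *
        Real.exp (-(2 * √(len k) * t))) atTop (𝓝 (∑ j : Fin d, ∑ k ∈ s, 0)) := by
      refine tendsto_finsetSum _ fun j _ => tendsto_finsetSum _ fun k _ => ?_
      by_cases h : √(len k) = 0
      · simp [h]
      · have hpos : 0 < 2 * √(len k) := by positivity
        have := (Real.tendsto_exp_neg_atTop_nhds_zero.comp
          (tendsto_id.const_mul_atTop hpos)).const_mul (-(c k * D j k * (k j * (√(len k))⁻¹) / 4))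
        simpa using this
    simpa using this

lemma tendsto_integral_add_rpow (hα : ∀ i, -(1 / 2 : ℝ) ≤ α i) {W : (Fin d → ℝ) → ℝ}
    (hW : PolyGrowth fun x _ => W x) (hW0 : ∀ x, (∀ i, 0 < x i) → 0 ≤ W x) (hm : Measurable W)
    {r : ℝ} (hr : 0 < r) :
    Tendsto (fun n : ℕ => ∫ x, (W x + 1 / ((n : ℝ) + 1)) ^ r ∂lagMeasure α) atTop
      (𝓝 (∫ x, W x ^ r ∂lagMeasure α)) := by
  refine tendsto_integral_of_dominated_convergence (fun x => (W x + 1) ^ r) (fun n => ?_) ?_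
    (fun n => ?_) ?_
  · exact Measurable.aestronglyMeasurable (by fun_prop)
  · refine ((hW.add (PolyGrowth.const 1)).rpow r one_pos ?_).integrable hα (t := 0) (by norm_num)
      (by fun_prop)
    intro x hx _ _
    linarith [hW0 x hx]
  · filter_upwards [ae_pos_lagMeasure hα] with x hx
    have h0 := hW0 x hx
    rw [Real.norm_of_nonneg (by positivity)]
    gcongr
    rw [div_le_one (by positivity)]
    have : (0 : ℝ) ≤ n := Nat.cast_nonneg n
    linarith
  · filter_upwards with x
    have h1 : Tendsto (fun n : ℕ => W x + 1 / ((n : ℝ) + 1)) atTop (𝓝 (W x)) := by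
      simpa using tendsto_const_nhds.add (tendsto_one_div_add_atTop_nhds_zero_nat (𝕜 := ℝ))
    exact h1.rpow_const (Or.inr hr.le)

lemma abs_sum_mul_sq_le {x u v : Fin d → ℝ} (hx : ∀ i, 0 < x i) :
    (∑ j, x j * (u j * v j)) ^ 2 ≤ (∑ j, x j * u j ^ 2) * ∑ j, x j * v j ^ 2 := by
  have := Finset.sum_mul_sq_le_sq_mul_sq Finset.univ (fun j => √(x j) * u j)
    (fun j => √(x j) * v j)
  simp only [mul_pow, Real.sq_sqrt (hx _).le] at this
  refine le_trans (le_of_eq ?_) this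
  congr 1
  refine Finset.sum_congr rfl fun j _ => ?_
  linear_combination -(u j * v j) * Real.mul_self_sqrt (hx j).le

/-- The bilinear estimate in additive form, in both orders of the arguments of the Bellman
function. -/
lemma abs_pairing_le_sum (hα : ∀ i, -(1 / 2 : ℝ) ≤ α i) {P : ℝ} (hP : 2 ≤ P)
    (s : Finset (Fin d → ℕ)) (c : (Fin d → ℕ) → ℝ) (D : Fin d → (Fin d → ℕ) → ℝ) :
    |pairing s c D| ≤ 2 * (∫ x, (scalarFun α s c x ^ 2) ^ (P / 2) ∂lagMeasure α +
        6 * (P - 1) * ∫ x, vectorFunSq α s D x ^ (P / (2 * (P - 1))) ∂lagMeasure α) ∧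
    |pairing s c D| ≤ 2 * (∫ x, vectorFunSq α s D x ^ (P / 2) ∂lagMeasure α +
        6 * (P - 1) * ∫ x, (scalarFun α s c x ^ 2) ^ (P / (2 * (P - 1))) ∂lagMeasure α) := by
  have hP1 : 0 < P - 1 := by linarith
  have hgS : PolyGrowth fun x _ => scalarFun α s c x ^ 2 := (PolyGrowth.expand _ _ _).pow 2
  have hgV := PolyGrowth.vectorFunSq (α := α) s D
  have hS0 : ∀ x : Fin d → ℝ, (∀ i, 0 < x i) → 0 ≤ scalarFun α s c x ^ 2 :=
    fun x _ => sq_nonneg _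
  have hV0 : ∀ x : Fin d → ℝ, (∀ i, 0 < x i) → 0 ≤ vectorFunSq α s D x :=
    fun x hx => vectorFunSq_nonneg hx
  have hmS : Measurable fun x => scalarFun α s c x ^ 2 := by fun_prop
  have hmV : Measurable fun x => vectorFunSq α s D x := by fun_prop
  -- the two jets, and the estimate for each `ε > 0`
  set F := poissonJet s (ell α) c with hF
  set h : Fin d → Jet d := fun j => poissonJet s (fun k => dpoly j (ell α k)) (D j) with hh
  have hSdom : ∀ ε : ℝ, 0 < ε → (scalarSq F ε).Dominates α _ := fun ε hε =>
    scalarSq_dominates (gen_poissonJet_ell hα s c) hε.le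
  have hVdom : ∀ ε : ℝ, 0 < ε → (vectorSq h ε).Dominates α _ := fun ε hε =>
    vectorSq_dominates hα (fun j => gen_poissonJet_dpoly hα s (D j) j) hε.le
  have hSlow : ∀ ε : ℝ, ∀ x : Fin d → ℝ, (∀ i, 0 < x i) → ∀ t : ℝ, -1 < t →
      ε ≤ (scalarSq F ε).val x t := by
    intro ε x _ t _
    simp only [scalarSq, Jet.add, Jet.mul, Jet.const]
    nlinarith [mul_self_nonneg (F.val x t)]
  have hVlow : ∀ ε : ℝ, ∀ x : Fin d → ℝ, (∀ i, 0 < x i) → ∀ t : ℝ, -1 < t →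
      ε ≤ (vectorSq h ε).val x t := by
    intro ε x hx t _
    simp only [vectorSq, Jet.add, Jet.mul, Jet.const, Jet.sum, Jet.coord]
    have : 0 ≤ ∑ j, x j * ((h j).val x t * (h j).val x t) :=
      Finset.sum_nonneg fun j _ => mul_nonneg (hx j).le (mul_self_nonneg _)
    linarith
  have hSval : ∀ ε x, (scalarSq F ε).val x 0 = scalarFun α s c x ^ 2 + ε := by
    intro ε x
    simp only [scalarSq, Jet.add, Jet.mul, Jet.const, hF, poissonJet, poisson_zero, scalarFun, sq]
  have hVval : ∀ ε x, (vectorSq h ε).val x 0 = vectorFunSq α s D x + ε := by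
    intro ε x
    simp only [vectorSq, Jet.add, Jet.mul, Jet.const, Jet.sum, Jet.coord, hh, poissonJet,
      poisson_zero, vectorFunSq, sq]
  have hbound : ∀ {W Z : (Fin d → ℝ) → ℝ}, (PolyGrowth fun x _ => W x) →
      (PolyGrowth fun x _ => Z x) → Measurable W → Measurable Z →
      (∀ x, (∀ i, 0 < x i) → 0 ≤ W x) → (∀ x, (∀ i, 0 < x i) → 0 ≤ Z x) → ∀ {ε : ℝ}, 0 < ε →
      ∀ J : Jet d, (∀ x, J.val x 0 = bell P (W x + ε) (Z x + ε)) →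
      ∫ x, J.val x 0 ∂lagMeasure α ≤ ∫ x, (W x + ε) ^ (P / 2) ∂lagMeasure α +
        6 * (P - 1) * ∫ x, (Z x + ε) ^ (P / (2 * (P - 1))) ∂lagMeasure α := by
    intro W Z hW hZ hmW hmZ hW0 hZ0 ε hε J hJ
    have hWi := ((hW.add (PolyGrowth.const ε)).rpow (P / 2) hε (fun x hx _ _ => by
      linarith [hW0 x hx])).integrable hα (t := 0) (by norm_num) (by fun_prop)
    have hZi := ((hZ.add (PolyGrowth.const ε)).rpow (P / (2 * (P - 1))) hε (fun x hx _ _ => by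
      linarith [hZ0 x hx])).integrable hα (t := 0) (by norm_num) (by fun_prop)
    rw [← integral_const_mul, ← integral_add hWi (hZi.const_mul _)]
    refine integral_mono_ae (J.growth.integrable hα (by norm_num) (J.meas 0))
      (hWi.add (hZi.const_mul _)) ?_
    filter_upwards [ae_pos_lagMeasure hα] with x hx
    rw [hJ x]
    exact bell_le hP (by linarith [hW0 x hx]) (by linarith [hZ0 x hx])
  have hlim : ∀ {W Z : (Fin d → ℝ) → ℝ}, (PolyGrowth fun x _ => W x) →
      (PolyGrowth fun x _ => Z x) → Measurable W → Measurable Z →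
      (∀ x, (∀ i, 0 < x i) → 0 ≤ W x) → (∀ x, (∀ i, 0 < x i) → 0 ≤ Z x) →
      (∀ n : ℕ, |pairing s c D| ≤ 2 * (∫ x, (W x + 1 / ((n : ℝ) + 1)) ^ (P / 2) ∂lagMeasure α +
        6 * (P - 1) * ∫ x, (Z x + 1 / ((n : ℝ) + 1)) ^ (P / (2 * (P - 1))) ∂lagMeasure α)) →
      |pairing s c D| ≤ 2 * (∫ x, W x ^ (P / 2) ∂lagMeasure α +
        6 * (P - 1) * ∫ x, Z x ^ (P / (2 * (P - 1))) ∂lagMeasure α) := by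
    intro W Z hW hZ hmW hmZ hW0 hZ0 hn
    exact ge_of_tendsto' (((tendsto_integral_add_rpow hα hW hW0 hmW (by positivity)).add
      ((tendsto_integral_add_rpow hα hZ hZ0 hmZ (by positivity)).const_mul _)).const_mul 2) hn
  constructor
  · refine hlim hgS hgV hmS hmV hS0 hV0 fun n => ?_
    have hε : (0 : ℝ) < 1 / ((n : ℝ) + 1) := by positivity
    refine (abs_pairing_le_integral hα s c D
      (Jet.bellman hP hε _ _ (hSlow _) (hVlow _)) ?_ ?_).trans
      (mul_le_mul_of_nonneg_left (hbound hgS hgV hmS hmV hS0 hV0 hε _ fun x => ?_) zero_le_two)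
    · intro x hx t ht
      exact bell_nonneg hP (hε.trans_le (hSlow _ x hx t ht)) (hε.trans_le (hVlow _ x hx t ht))
    · intro x hx t ht
      refine Jet.two_mul_abs_le_gen_bellman hP hε _ _ (hSlow _) (hVlow _) (hSdom _ hε)
        (hVdom _ hε) hx ht ?_ ?_ (abs_sum_mul_sq_le hx)
      · exact Finset.sum_nonneg fun j _ => mul_nonneg (hx j).le (sq_nonneg _)
      · exact Finset.sum_nonneg fun j _ => mul_nonneg (hx j).le (sq_nonneg _)
    · simp only [Jet.bellman, hSval, hVval]
  · refine hlim hgV hgS hmV hmS hV0 hS0 fun n => ?_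
    have hε : (0 : ℝ) < 1 / ((n : ℝ) + 1) := by positivity
    refine (abs_pairing_le_integral hα s c D
      (Jet.bellman hP hε _ _ (hVlow _) (hSlow _)) ?_ ?_).trans
      (mul_le_mul_of_nonneg_left (hbound hgV hgS hmV hmS hV0 hS0 hε _ fun x => ?_) zero_le_two)
    · intro x hx t ht
      exact bell_nonneg hP (hε.trans_le (hVlow _ x hx t ht)) (hε.trans_le (hSlow _ x hx t ht))
    · intro x hx t ht
      refine Jet.two_mul_abs_le_gen_bellman hP hε _ _ (hVlow _) (hSlow _) (hVdom _ hε)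
        (hSdom _ hε) hx ht ?_ ?_ ((abs_sum_mul_sq_le hx).trans (le_of_eq (mul_comm _ _)))
      · exact Finset.sum_nonneg fun j _ => mul_nonneg (hx j).le (sq_nonneg _)
      · exact Finset.sum_nonneg fun j _ => mul_nonneg (hx j).le (sq_nonneg _)
    · simp only [Jet.bellman, hSval, hVval]

lemma scalarFun_const_mul (s : Finset (Fin d → ℕ)) (c : (Fin d → ℕ) → ℝ) (a : ℝ)
    (x : Fin d → ℝ) : scalarFun α s (fun k => a * c k) x = a * scalarFun α s c x :=
  expand_const_mul _ _ _ _ _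

lemma vectorFunSq_const_mul (s : Finset (Fin d → ℕ)) (D : Fin d → (Fin d → ℕ) → ℝ) (a : ℝ)
    (x : Fin d → ℝ) :
    vectorFunSq α s (fun j k => a * D j k) x = a ^ 2 * vectorFunSq α s D x := by
  simp only [vectorFunSq, expand_const_mul, Finset.mul_sum]
  refine Finset.sum_congr rfl fun j _ => ?_
  ring

lemma pairing_const_mul (s : Finset (Fin d → ℕ)) (c : (Fin d → ℕ) → ℝ)
    (D : Fin d → (Fin d → ℕ) → ℝ) (a b : ℝ) :
    pairing s (fun k => a * c k) (fun j k => b * D j k) = a * b * pairing s c D := by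
  simp only [pairing, Finset.mul_sum]
  refine Finset.sum_congr rfl fun j _ => Finset.sum_congr rfl fun k _ => ?_
  ring

lemma integral_scaled_rpow_le_one {W : (Fin d → ℝ) → ℝ} (hα : ∀ i, -(1 / 2 : ℝ) ≤ α i)
    (hW0 : ∀ x, (∀ i, 0 < x i) → 0 ≤ W x) {r ε : ℝ} (hr : 0 < r) (hε : 0 < ε) :
    ∫ x, (((∫ y, W y ^ (r / 2) ∂lagMeasure α) ^ (1 / r) + ε)⁻¹ ^ 2 * W x) ^ (r / 2)
      ∂lagMeasure α ≤ 1 := by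
  set A := ∫ y, W y ^ (r / 2) ∂lagMeasure α with hA
  have hA0 : 0 ≤ A := by
    refine integral_nonneg_of_ae ?_
    filter_upwards [ae_pos_lagMeasure hα] with x hx
    have := hW0 x hx
    simp only [Pi.zero_apply]
    positivity
  have ha : 0 < A ^ (1 / r) + ε := by positivity
  have e : ∫ x, ((A ^ (1 / r) + ε)⁻¹ ^ 2 * W x) ^ (r / 2) ∂lagMeasure α =
      ((A ^ (1 / r) + ε) ^ r)⁻¹ * A := by
    rw [hA, ← integral_const_mul]
    refine integral_congr_ae ?_
    filter_upwards [ae_pos_lagMeasure hα] with x hx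
    rw [Real.mul_rpow (by positivity) (hW0 x hx), ← Real.rpow_natCast, ← Real.rpow_mul (by positivity)]
    congr 1
    rw [← hA, Real.inv_rpow ha.le]
    congr 2
    push_cast
    ring
  rw [e, inv_mul_le_iff₀ (by positivity), mul_one]
  calc A = (A ^ (1 / r)) ^ r := by rw [← Real.rpow_mul hA0]; field_simp; simp
    _ ≤ _ := Real.rpow_le_rpow (by positivity) (by linarith) hr.le

/-- The bilinear estimate: the pairing of the Riesz vector with a vector field is bounded by the
product of the `L^p` and `L^q` norms, with a constant independent of `d` and `α`. -/
lemma abs_pairing_le (hα : ∀ i, -(1 / 2 : ℝ) ≤ α i) {p : ℝ} (hp : 1 < p)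
    (s : Finset (Fin d → ℕ)) (c : (Fin d → ℕ) → ℝ) (D : Fin d → (Fin d → ℕ) → ℝ) :
    |pairing s c D| ≤ 14 * (max p (p / (p - 1)) - 1) *
      (∫ x, (scalarFun α s c x ^ 2) ^ (p / 2) ∂lagMeasure α) ^ (1 / p) *
      (∫ x, vectorFunSq α s D x ^ (p / (p - 1) / 2) ∂lagMeasure α) ^ (1 / (p / (p - 1))) := by
  have hp1 : 0 < p - 1 := by linarith
  set q := p / (p - 1) with hq
  have hq0 : 0 < q := by positivity
  set P := max p q with hPdef
  have hP : 2 ≤ P := by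
    rcases le_total 2 p with h | h
    · exact h.trans (le_max_left _ _)
    · refine le_trans ?_ (le_max_right _ _)
      rw [hq, le_div_iff₀ hp1]; linarith
  -- for normalized arguments the constant is `2 (1 + 6 (P - 1)) ≤ 14 (P - 1)`, as `P ≥ 2`
  have hsum : ∀ (c : (Fin d → ℕ) → ℝ) (D : Fin d → (Fin d → ℕ) → ℝ),
      ∫ x, (scalarFun α s c x ^ 2) ^ (p / 2) ∂lagMeasure α ≤ 1 →
      ∫ x, vectorFunSq α s D x ^ (q / 2) ∂lagMeasure α ≤ 1 →
      |pairing s c D| ≤ 14 * (P - 1) := by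
    intro c D hc hD
    obtain ⟨h1, h2⟩ := abs_pairing_le_sum hα hP s c D
    rcases le_total q p with h | h
    · have hPp : P = p := max_eq_left h
      have e : P / (2 * (P - 1)) = q / 2 := by rw [hPp, hq]; field_simp
      rw [e, hPp] at h1
      rw [hPp] at hP ⊢
      nlinarith
    · have hPq : P = q := max_eq_right h
      have e : P / (2 * (P - 1)) = p / 2 := by
        have hq1 : q - 1 = 1 / (p - 1) := by rw [hq]; field_simp; ring
        rw [hPq, hq1, hq]
        field_simp
      rw [e, hPq] at h2
      rw [hPq] at hP ⊢
      nlinarith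
  -- `ε` is added to the norms, which may vanish, before dividing by them
  have hε : ∀ ε : ℝ, 0 < ε → |pairing s c D| ≤ 14 * (P - 1) *
      ((∫ x, (scalarFun α s c x ^ 2) ^ (p / 2) ∂lagMeasure α) ^ (1 / p) + ε) *
      ((∫ x, vectorFunSq α s D x ^ (q / 2) ∂lagMeasure α) ^ (1 / q) + ε) := by
    intro ε hε
    have hA := integral_scaled_rpow_le_one (W := fun x => scalarFun α s c x ^ 2) hα
      (fun x _ => sq_nonneg _) (by linarith : 0 < p) hε
    have hB := integral_scaled_rpow_le_one (W := vectorFunSq α s D) hα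
      (fun x hx => vectorFunSq_nonneg hx) hq0 hε
    have hA0 : 0 ≤ (∫ x, (scalarFun α s c x ^ 2) ^ (p / 2) ∂lagMeasure α) := by positivity
    have hB0 : 0 ≤ (∫ x, vectorFunSq α s D x ^ (q / 2) ∂lagMeasure α) := by
      refine integral_nonneg_of_ae ?_
      filter_upwards [ae_pos_lagMeasure hα] with x hx
      have := vectorFunSq_nonneg (α := α) (s := s) (D := D) hx
      simp only [Pi.zero_apply]
      positivity
    set a := (∫ x, (scalarFun α s c x ^ 2) ^ (p / 2) ∂lagMeasure α) ^ (1 / p) + ε with ha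
    set b := (∫ x, vectorFunSq α s D x ^ (q / 2) ∂lagMeasure α) ^ (1 / q) + ε with hb
    have ha0 : 0 < a := by positivity
    have hb0 : 0 < b := by positivity
    have := hsum (fun k => a⁻¹ * c k) (fun j k => b⁻¹ * D j k)
      (by simp only [scalarFun_const_mul, mul_pow]; exact hA)
      (by simp only [vectorFunSq_const_mul]; exact hB)
    rw [pairing_const_mul, abs_mul, abs_of_pos (by positivity), ← mul_inv,
      inv_mul_le_iff₀ (by positivity)] at this
    linarith
  have hlim : Tendsto (fun n : ℕ => 14 * (P - 1) *
      ((∫ x, (scalarFun α s c x ^ 2) ^ (p / 2) ∂lagMeasure α) ^ (1 / p) + 1 / ((n : ℝ) + 1)) *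
      ((∫ x, vectorFunSq α s D x ^ (q / 2) ∂lagMeasure α) ^ (1 / q) + 1 / ((n : ℝ) + 1))) atTop
      (𝓝 (14 * (P - 1) * ((∫ x, (scalarFun α s c x ^ 2) ^ (p / 2) ∂lagMeasure α) ^ (1 / p) + 0) *
      ((∫ x, vectorFunSq α s D x ^ (q / 2) ∂lagMeasure α) ^ (1 / q) + 0))) := by
    have h0 := tendsto_one_div_add_atTop_nhds_zero_nat (𝕜 := ℝ)
    exact ((h0.const_add _).const_mul _).mul (h0.const_add _)
  have := ge_of_tendsto' hlim fun n => hε _ (by positivity)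
  simpa using this

end Bilinear

open Polynomial

/-! ### Density of polynomials in weighted `L^p` spaces -/

/-- Dominated convergence in `L^p`. -/
lemma tendsto_eLpNorm_sub_of_dominated {X E : Type*} [MeasurableSpace X] [NormedAddCommGroup E]
    {ν : Measure X} {p : ℝ≥0∞} (hp0 : p ≠ 0) (hp : p ≠ ∞) {F : ℕ → X → E} {g : X → E} {G : X → ℝ}
    (hF : ∀ n, AEStronglyMeasurable (F n) ν) (hg : AEStronglyMeasurable g ν) (hG : MemLp G p ν)
    (hb : ∀ n, ∀ᵐ x ∂ν, ‖F n x‖ ≤ G x)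
    (hlim : ∀ᵐ x ∂ν, Tendsto (fun n => F n x) atTop (𝓝 (g x))) :
    MemLp g p ν ∧ Tendsto (fun n => eLpNorm (F n - g) p ν) atTop (𝓝 0) := by
  have hgb : ∀ᵐ x ∂ν, ‖g x‖ ≤ G x := by
    filter_upwards [ae_all_iff.mpr hb, hlim] with x h1 h2
    exact le_of_tendsto h2.norm (Eventually.of_forall h1)
  have hgm : MemLp g p ν := hG.mono' hg hgb
  refine ⟨hgm, ?_⟩
  have hp' : 0 < p.toReal := ENNReal.toReal_pos hp0 hp
  suffices Tendsto (fun n => ∫⁻ x, ‖F n x - g x‖ₑ ^ p.toReal ∂ν) atTop (𝓝 0) by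
    simp only [eLpNorm_eq_lintegral_rpow_enorm_toReal hp0 hp]
    convert! ENNReal.continuous_rpow_const.continuousAt.tendsto.comp this
    simp [ENNReal.zero_rpow_of_pos (_root_.inv_pos.mpr hp')]
  have hG2 : MemLp (fun x => 2 * G x) p ν := hG.const_mul 2
  have key := tendsto_lintegral_of_dominated_convergence' (μ := ν)
    (F := fun n x => ‖F n x - g x‖ₑ ^ p.toReal) (f := fun _ => 0)
    (fun x => ‖2 * G x‖ₑ ^ p.toReal)
    (fun n => (((hF n).sub hg).enorm).pow_const _)
    (fun n => by
      filter_upwards [hb n, hgb] with x h1 h2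
      refine ENNReal.rpow_le_rpow ?_ hp'.le
      rw [← ofReal_norm, ← ofReal_norm]
      refine ENNReal.ofReal_le_ofReal ?_
      calc ‖F n x - g x‖ ≤ ‖F n x‖ + ‖g x‖ := norm_sub_le _ _
        _ ≤ 2 * G x := by linarith
        _ ≤ _ := Real.le_norm_self _)
    (lintegral_rpow_enorm_lt_top_of_eLpNorm_lt_top hp0 hp hG2.2).ne
    (by
      filter_upwards [hlim] with x h
      have : Tendsto (fun n => F n x - g x) atTop (𝓝 (g x - g x)) := h.sub tendsto_const_nhds
      convert! ENNReal.continuous_rpow_const.continuousAt.tendsto.comp this.enorm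
      simp [ENNReal.zero_rpow_of_pos hp'])
  simpa using key

section Density

variable {d : ℕ} {ν : Measure (Fin d → ℝ)} {p : ℝ≥0∞} [Fact (1 ≤ p)]

/-- `g` belongs to the closure in `L^p(ν)` of the tensor products of polynomials. -/
def InPolyClosure (p : ℝ≥0∞) [Fact (1 ≤ p)] (ν : Measure (Fin d → ℝ)) (g : (Fin d → ℝ) → ℝ) :
    Prop :=
  ∃ hg : MemLp g p ν, hg.toLp g ∈ (Submodule.span ℝ
    {h : Lp ℝ p ν | ∃ q : Fin d → ℝ[X], h =ᵐ[ν] tens q}).topologicalClosure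

lemma InPolyClosure.congr {g h : (Fin d → ℝ) → ℝ} (hg : InPolyClosure p ν g) (hgh : g =ᵐ[ν] h) :
    InPolyClosure p ν h := by
  obtain ⟨hg, hgm⟩ := hg
  refine ⟨(memLp_congr_ae hgh).mp hg, ?_⟩
  rwa [← MemLp.toLp_congr hg _ hgh]

lemma InPolyClosure.add {g h : (Fin d → ℝ) → ℝ} (hg : InPolyClosure p ν g)
    (hh : InPolyClosure p ν h) : InPolyClosure p ν (g + h) := by
  obtain ⟨hg, hgm⟩ := hg
  obtain ⟨hh, hhm⟩ := hh
  exact ⟨hg.add hh, Submodule.add_mem _ hgm hhm⟩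

lemma InPolyClosure.const_smul {g : (Fin d → ℝ) → ℝ} (hg : InPolyClosure p ν g) (c : ℝ) :
    InPolyClosure p ν (c • g) := by
  obtain ⟨hg, hgm⟩ := hg
  exact ⟨hg.const_smul c, Submodule.smul_mem _ c hgm⟩

lemma InPolyClosure.of_tendsto {F : ℕ → (Fin d → ℝ) → ℝ} {g : (Fin d → ℝ) → ℝ}
    (hF : ∀ n, InPolyClosure p ν (F n)) (hg : MemLp g p ν)
    (h : Tendsto (fun n => eLpNorm (F n - g) p ν) atTop (𝓝 0)) : InPolyClosure p ν g := by
  choose hFm hFc using hF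
  refine ⟨hg, ?_⟩
  exact (Submodule.isClosed_topologicalClosure _).mem_of_tendsto
    ((Lp.tendsto_Lp_iff_tendsto_eLpNorm'' F hFm g hg).mpr h) (Eventually.of_forall hFc)

/-- Bounded measurable functions `w` whose products with all polynomials are approximable by
polynomials. -/
def Multiplies (p : ℝ≥0∞) [Fact (1 ≤ p)] (ν : Measure (Fin d → ℝ)) (w : (Fin d → ℝ) → ℝ) : Prop :=
  Measurable w ∧ (∃ C, ∀ x, |w x| ≤ C) ∧
    ∀ q : Fin d → ℝ[X], InPolyClosure p ν (fun x => tens q x * w x)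

variable (hpos : ∀ᵐ x ∂ν, ∀ i, 0 < x i) {c : ℝ} (hc : 0 < c)
  (hexp : MemLp (fun x : Fin d → ℝ => Real.exp (2 * c * ∑ i, x i)) p ν)

include hpos hc in
lemma exists_abs_tens_le (q : Fin d → ℝ[X]) :
    ∃ C, 0 ≤ C ∧ ∀ᵐ x ∂ν, |tens q x| ≤ C * Real.exp (c * ∑ i, x i) := by
  obtain ⟨C, N, hC, h⟩ := PolyGrowth.tens q
  obtain ⟨C', hC', h'⟩ := exists_pow_le_exp N hc
  refine ⟨C * C', by positivity, ?_⟩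
  filter_upwards [hpos] with x hx
  refine (h x hx 0 (by norm_num)).trans ?_
  rw [mul_assoc]
  exact mul_le_mul_of_nonneg_left (h' _ (Finset.sum_nonneg fun i _ => (hx i).le)) hC

omit [Fact (1 ≤ p)] in
include hpos hc hexp in
lemma memLp_tens (q : Fin d → ℝ[X]) : MemLp (tens q) p ν := by
  obtain ⟨C, hC, h⟩ := exists_abs_tens_le hpos hc q
  refine (hexp.const_mul C).mono' (measurable_tens q).aestronglyMeasurable ?_
  filter_upwards [h, hpos] with x hx hx'
  refine hx.trans (mul_le_mul_of_nonneg_left (Real.exp_le_exp.mpr ?_) hC)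
  have : 0 ≤ ∑ i, x i := Finset.sum_nonneg fun i _ => (hx' i).le
  nlinarith

include hpos hc hexp in
lemma multiplies_one : Multiplies p ν (fun _ => 1) := by
  refine ⟨measurable_const, ⟨1, by simp⟩, fun q => ?_⟩
  simp only [mul_one]
  refine ⟨memLp_tens hpos hc hexp q, ?_⟩
  exact Submodule.le_topologicalClosure _ (Submodule.subset_span ⟨q, MemLp.coeFn_toLp _⟩)

/-- The map `x ↦ (e^{-c x_i})_i` from the orthant into the cube. -/
def expCube (c : ℝ) (x : Fin d → ℝ) (i : Fin d) : unitInterval :=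
  Set.projIcc 0 1 zero_le_one (Real.exp (-(c * x i)))

lemma measurable_expCube (c : ℝ) : Measurable (expCube c : (Fin d → ℝ) → Fin d → unitInterval) :=
  measurable_pi_iff.mpr fun i => continuous_projIcc.measurable.comp (by fun_prop)

lemma expCube_coe (hc : 0 < c) {x : Fin d → ℝ} {i : Fin d} (hx : 0 < x i) :
    (expCube c x i : ℝ) = Real.exp (-(c * x i)) := by
  rw [expCube, Set.projIcc_of_mem]
  exact ⟨(Real.exp_pos _).le, Real.exp_le_one_iff.mpr (by nlinarith)⟩

/-- The Taylor polynomials of `e^{-cx}`. -/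
def expTaylor (c : ℝ) (n : ℕ) : ℝ[X] :=
  ∑ m ∈ Finset.range n, C ((-c) ^ m / m.factorial) * X ^ m

lemma eval_expTaylor (c : ℝ) (n : ℕ) (y : ℝ) :
    (expTaylor c n).eval y = ∑ m ∈ Finset.range n, (-(c * y)) ^ m / m.factorial := by
  simp only [expTaylor, eval_finsetSum, eval_mul, eval_C, eval_pow, eval_X]
  refine Finset.sum_congr rfl fun m _ => ?_
  rw [← neg_mul, mul_pow]; ring

lemma abs_eval_expTaylor_le (hc : 0 < c) (n : ℕ) {y : ℝ} (hy : 0 < y) :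
    |(expTaylor c n).eval y| ≤ Real.exp (c * y) := by
  rw [eval_expTaylor]
  refine (Finset.abs_sum_le_sum_abs _ _).trans (le_trans (le_of_eq ?_)
    (Real.sum_le_exp_of_nonneg (by positivity : 0 ≤ c * y) n))
  refine Finset.sum_congr rfl fun m _ => ?_
  rw [abs_div, abs_pow, abs_neg, abs_of_pos (by positivity : 0 < c * y), Nat.abs_cast]

lemma tendsto_eval_expTaylor (c y : ℝ) :
    Tendsto (fun n => (expTaylor c n).eval y) atTop (𝓝 (Real.exp (-(c * y)))) := by
  simp only [eval_expTaylor]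
  rw [Real.exp_eq_exp_ℝ]
  exact (NormedSpace.expSeries_div_hasSum_exp (-(c * y))).tendsto_sum_nat

variable (hp : p ≠ ∞)

include hpos hc hexp hp in
/-- Multiplying by `e^{-c x_i}` preserves approximability: the Taylor polynomials of this function
are dominated by `e^{c x_i}`, which is integrable against all polynomials. -/
lemma Multiplies.mul_expCube {w : (Fin d → ℝ) → ℝ} (hw : Multiplies p ν w) (i : Fin d) :
    Multiplies p ν (fun x => w x * expCube c x i) := by
  have hp0 : p ≠ 0 := (zero_lt_one.trans_le Fact.out).ne'
  obtain ⟨hwm, ⟨A, hA⟩, hwq⟩ := hw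
  have hEm : Measurable fun x : Fin d → ℝ => ((expCube c x i : unitInterval) : ℝ) :=
    measurable_subtype_coe.comp ((measurable_pi_apply i).comp (measurable_expCube c))
  have hA0 : 0 ≤ A := (abs_nonneg _).trans (hA 0)
  refine ⟨hwm.mul hEm, ⟨A, fun x => ?_⟩, fun q => ?_⟩
  · rw [abs_mul, abs_of_nonneg (expCube c x i).2.1]
    exact (mul_le_of_le_one_right (abs_nonneg _) (expCube c x i).2.2).trans (hA x)
  obtain ⟨C, hC, hq⟩ := exists_abs_tens_le hpos hc q
  let Q : ℕ → Fin d → ℝ[X] := fun n => Function.update q i (q i * expTaylor c n)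
  have hQ : ∀ n x, tens (Q n) x = tens q x * (expTaylor c n).eval (x i) := fun n x => by
    rw [tens_update, tens_eq q i x, eval_mul]; ring
  obtain ⟨h1, h2⟩ := tendsto_eLpNorm_sub_of_dominated (ν := ν) hp0 hp
    (F := fun n x => tens (Q n) x * w x) (g := fun x => tens q x * (w x * expCube c x i))
    (G := fun x => C * A * Real.exp (2 * c * ∑ i, x i))
    (fun n => ((measurable_tens _).mul hwm).aestronglyMeasurable)
    ((measurable_tens _).mul (hwm.mul hEm)).aestronglyMeasurable (hexp.const_mul _)
    (fun n => by
      filter_upwards [hpos, hq] with x hx hqx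
      rw [hQ, Real.norm_eq_abs, abs_mul, abs_mul]
      have hs : x i ≤ ∑ j, x j :=
        Finset.single_le_sum (f := x) (fun j _ => (hx j).le) (Finset.mem_univ i)
      calc |tens q x| * |(expTaylor c n).eval (x i)| * |w x|
          ≤ (C * Real.exp (c * ∑ i, x i)) * Real.exp (c * ∑ i, x i) * A := by
            gcongr
            · exact (abs_eval_expTaylor_le hc n (hx i)).trans
                (Real.exp_le_exp.mpr (mul_le_mul_of_nonneg_left hs hc.le))
            · exact hA x
        _ = C * A * Real.exp (2 * c * ∑ i, x i) := by
            rw [show 2 * c * ∑ i, x i = c * ∑ i, x i + c * ∑ i, x i by ring, Real.exp_add]; ring)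
    (by
      filter_upwards [hpos] with x hx
      simp only [hQ]
      rw [expCube_coe hc (hx i), show tens q x * (w x * Real.exp (-(c * x i))) =
        tens q x * Real.exp (-(c * x i)) * w x by ring]
      exact ((tendsto_eval_expTaylor c (x i)).const_mul _).mul_const _)
  exact InPolyClosure.of_tendsto (fun n => hwq (Q n)) h1 h2

lemma Multiplies.add {w v : (Fin d → ℝ) → ℝ} (hw : Multiplies p ν w) (hv : Multiplies p ν v) :
    Multiplies p ν (w + v) := by
  obtain ⟨hwm, ⟨A, hA⟩, hwq⟩ := hw
  obtain ⟨hvm, ⟨B, hB⟩, hvq⟩ := hv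
  refine ⟨hwm.add hvm, ⟨A + B, fun x => (abs_add_le _ _).trans (add_le_add (hA x) (hB x))⟩,
    fun q => ?_⟩
  convert (hwq q).add (hvq q) using 1
  ext x; simp [mul_add]

lemma Multiplies.const_smul {w : (Fin d → ℝ) → ℝ} (hw : Multiplies p ν w) (r : ℝ) :
    Multiplies p ν (r • w) := by
  obtain ⟨hwm, ⟨A, hA⟩, hwq⟩ := hw
  refine ⟨hwm.const_smul r, ⟨|r| * A, fun x => ?_⟩, fun q => ?_⟩
  · simp only [Pi.smul_apply, smul_eq_mul, abs_mul]
    exact mul_le_mul_of_nonneg_left (hA x) (abs_nonneg _)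
  · convert (hwq q).const_smul r using 1
    ext x; simp; ring

/-- The coordinate functions on the cube. -/
def cubeCoord (i : Fin d) : C(Fin d → unitInterval, ℝ) :=
  ⟨fun s => s i, continuous_subtype_val.comp (continuous_apply i)⟩

include hpos hc hexp hp in
/-- Multiplication by a polynomial in the functions `e^{-c x_i}` preserves approximability. -/
lemma Multiplies.mul_adjoin {a : C(Fin d → unitInterval, ℝ)}
    (ha : a ∈ Algebra.adjoin ℝ (Set.range (cubeCoord (d := d)))) :
    ∀ w : (Fin d → ℝ) → ℝ, Multiplies p ν w → Multiplies p ν (fun x => w x * a (expCube c x)) := by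
  induction ha using Algebra.adjoin_induction with
  | mem a ha =>
    obtain ⟨i, rfl⟩ := ha
    exact fun w hw => hw.mul_expCube hpos hc hexp hp i
  | algebraMap r =>
    intro w hw
    convert hw.const_smul r using 1
    ext x
    simp [mul_comm]
  | add a b _ _ iha ihb =>
    intro w hw
    convert (iha w hw).add (ihb w hw) using 1
    ext x
    simp [mul_add]
  | mul a b _ _ iha ihb =>
    intro w hw
    convert ihb _ (iha w hw) using 1
    ext x
    simp [mul_assoc]

variable [IsFiniteMeasure ν]

include hpos hc hexp hp in
/-- Stone–Weierstrass on the cube: continuous functions of the `e^{-c x_i}` are approximable. -/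
lemma inPolyClosure_comp_expCube {f : (Fin d → unitInterval) → ℝ} (hf : Continuous f) :
    InPolyClosure p ν (fun x => f (expCube c x)) := by
  have hp0 : p ≠ 0 := (zero_lt_one.trans_le Fact.out).ne'
  have hsep : (Algebra.adjoin ℝ (Set.range (cubeCoord (d := d)))).SeparatesPoints := by
    intro s t hst
    obtain ⟨i, hi⟩ := Function.ne_iff.mp hst
    exact ⟨cubeCoord i, ⟨cubeCoord i, Algebra.subset_adjoin ⟨i, rfl⟩, rfl⟩,
      fun h => hi (Subtype.ext h)⟩
  have := fun n : ℕ => ContinuousMap.exists_mem_subalgebra_near_continuous_of_separatesPoints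
    _ hsep f hf (1 / ((n : ℝ) + 1)) (by positivity)
  choose a ha using this
  obtain ⟨M, hM⟩ := (isCompact_range hf).isBounded.exists_norm_le
  have hmem : ∀ n, InPolyClosure p ν fun x => (a n : C(Fin d → unitInterval, ℝ)) (expCube c x) :=
    fun n => by
      have := (Multiplies.mul_adjoin hpos hc hexp hp (a n).2 _
        (multiplies_one hpos hc hexp)).2.2 fun _ => 1
      simpa [tens] using this
  obtain ⟨h1, h2⟩ := tendsto_eLpNorm_sub_of_dominated (ν := ν) hp0 hp
    (F := fun n x => (a n : C(Fin d → unitInterval, ℝ)) (expCube c x))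
    (g := fun x => f (expCube c x)) (G := fun _ => M + 1)
    (fun n => (((a n).1.continuous.measurable).comp (measurable_expCube c)).aestronglyMeasurable)
    ((hf.measurable).comp (measurable_expCube c)).aestronglyMeasurable (memLp_const _)
    (fun n => Eventually.of_forall fun x => by
      have h1 := ha n (expCube c x)
      have h2 := hM _ ⟨expCube c x, rfl⟩
      have h3 : 1 / ((n : ℝ) + 1) ≤ 1 := by
        rw [div_le_one (by positivity)]; linarith [Nat.cast_nonneg (α := ℝ) n]
      have := norm_sub_norm_le ((a n : C(Fin d → unitInterval, ℝ)) (expCube c x)) (f (expCube c x))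
      exact (by linarith [this.trans h1.le] :
        ‖(a n : C(Fin d → unitInterval, ℝ)) (expCube c x)‖ ≤ M + 1))
    (Eventually.of_forall fun x => by
      rw [tendsto_iff_norm_sub_tendsto_zero]
      exact squeeze_zero (fun _ => norm_nonneg _) (fun n => (ha n _).le)
        tendsto_one_div_add_atTop_nhds_zero_nat)
  exact InPolyClosure.of_tendsto hmem h1 h2

include hpos hc hexp hp in
/-- Polynomials are dense in `L^p(ν)` when `ν` has an exponential moment on the orthant. The map
`x ↦ (e^{-c x_i})` transports the question to the cube, where continuous functions are dense and
are uniform limits of polynomials in the functions `e^{-c x_i}`. -/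
lemma inPolyClosure_of_memLp {f : (Fin d → ℝ) → ℝ} (hf : MemLp f p ν) : InPolyClosure p ν f := by
  have hΨ : Measurable (expCube c : (Fin d → ℝ) → Fin d → unitInterval) := measurable_expCube c
  obtain ⟨f', hf'm, hff'⟩ := hf.1.aemeasurable
  have hf' : MemLp f' p ν := (memLp_congr_ae hff').mp hf
  -- the inverse of `expCube` on the orthant; its values at `s i = 0` do not matter
  let g : (Fin d → unitInterval) → ℝ := fun s => f' fun i => -(Real.log (s i)) / c
  have hgm : Measurable g := hf'm.comp (measurable_pi_iff.mpr fun i =>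
    (((Real.measurable_log.comp (measurable_subtype_coe.comp (measurable_pi_apply i))).neg).div_const
      c))
  have hgf : (fun x => g (expCube c x)) =ᵐ[ν] f := by
    filter_upwards [hff', hpos] with x hx hx'
    rw [hx]
    simp only [g]
    congr 1
    ext i
    rw [expCube_coe hc (hx' i), Real.log_exp]
    field_simp
  have hgL : MemLp g p (ν.map (expCube c)) :=
    (memLp_map_measure_iff hgm.aestronglyMeasurable hΨ.aemeasurable).mpr
      ((memLp_congr_ae hgf).mpr hf)
  have := fun n : ℕ => hgL.exists_boundedContinuous_eLpNorm_sub_le hp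
    (ε := (n : ℝ≥0∞)⁻¹) (by simp)
  choose b hb hbm using this
  refine InPolyClosure.congr ?_ hgf
  refine InPolyClosure.of_tendsto
    (fun n => inPolyClosure_comp_expCube hpos hc hexp hp (b n).continuous)
    ((memLp_congr_ae hgf).mpr hf) ?_
  refine tendsto_of_tendsto_of_tendsto_of_le_of_le tendsto_const_nhds
    ENNReal.tendsto_inv_nat_nhds_zero (fun _ => bot_le) fun n => ?_
  refine le_trans (le_of_eq ?_) (hb n)
  rw [eLpNorm_map_measure (hgm.aestronglyMeasurable.sub (b n).continuous.aestronglyMeasurable)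
    hΨ.aemeasurable, eLpNorm_sub_comm]
  rfl

include hpos hc hexp hp in
/-- Quantitative form of the density of polynomials, for polynomials expanded in the tensor
products of one-dimensional bases. -/
lemma exists_expand_eLpNorm_sub_le {b : Fin d → ℕ → ℝ[X]}
    (hb : ∀ i, Submodule.span ℝ (Set.range (b i)) = ⊤) {f : (Fin d → ℝ) → ℝ} (hf : MemLp f p ν)
    {ε : ℝ≥0∞} (hε : ε ≠ 0) :
    ∃ a : (Fin d → ℕ) →₀ ℝ,
      eLpNorm (f - expand a.support (fun k i => b i (k i)) a) p ν ≤ ε := by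
  obtain ⟨hf', hfc⟩ := inPolyClosure_of_memLp hpos hc hexp hp hf
  obtain ⟨h, hh, hd⟩ := EMetric.mem_closure_iff.mp hfc ε (pos_iff_ne_zero.mpr hε)
  have key : ∃ a : (Fin d → ℕ) →₀ ℝ, h =ᵐ[ν] expand a.support (fun k i => b i (k i)) a := by
    have : ∃ u ∈ Submodule.span ℝ (Set.range fun k : Fin d → ℕ => tens fun i => b i (k i)),
        h =ᵐ[ν] u := by
      clear hd
      induction hh using Submodule.span_induction with
      | mem h hh =>
        obtain ⟨q, hq⟩ := hh
        exact ⟨_, tens_mem_span hb q, hq⟩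
      | zero => exact ⟨0, Submodule.zero_mem _, Lp.coeFn_zero _ _ _⟩
      | add g h _ _ ihg ihh =>
        obtain ⟨u, hu, hgu⟩ := ihg
        obtain ⟨v, hv, hhv⟩ := ihh
        exact ⟨u + v, Submodule.add_mem _ hu hv, (Lp.coeFn_add g h).trans (hgu.add hhv)⟩
      | smul r g _ ihg =>
        obtain ⟨u, hu, hgu⟩ := ihg
        exact ⟨r • u, Submodule.smul_mem _ _ hu, (Lp.coeFn_smul r g).trans (hgu.const_smul r)⟩
    obtain ⟨u, hu, hhu⟩ := this
    obtain ⟨a, rfl⟩ := Finsupp.mem_span_range_iff_exists_finsupp.mp hu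
    refine ⟨a, hhu.trans (Eventually.of_forall fun x => ?_)⟩
    simp [Finsupp.sum, expand]
  obtain ⟨a, ha⟩ := key
  refine ⟨a, ?_⟩
  rw [Lp.edist_def] at hd
  refine le_trans (le_of_eq (eLpNorm_congr_ae ?_)) hd.le
  filter_upwards [ha, hf'.coeFn_toLp] with x h1 h2
  simp [h1, h2]

end Density

/-! ### Density in the Laguerre spaces -/

section LaguerreDensity

variable {d : ℕ} {α : Fin d → ℝ}

lemma memLp_exp_lagMeasure (hα : ∀ i, -(1 / 2 : ℝ) ≤ α i) {p : ℝ≥0∞} (hp0 : p ≠ 0) (hp : p ≠ ∞) :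
    MemLp (fun x : Fin d → ℝ => Real.exp (1 / (2 * p.toReal) * ∑ i, x i)) p (lagMeasure α) := by
  have hp' : 0 < p.toReal := ENNReal.toReal_pos hp0 hp
  rw [← integrable_norm_rpow_iff (by fun_prop) hp0 hp]
  refine (integrable_exp_lagMeasure hα).congr (Eventually.of_forall fun x => ?_)
  simp only [Real.norm_eq_abs, Real.abs_exp]
  rw [← Real.exp_mul]
  congr 1
  field_simp

/-- Laguerre expansions are dense in `L^p(μ)`. -/
lemma exists_scalarFun_eLpNorm_sub_le (hα : ∀ i, -(1 / 2 : ℝ) ≤ α i) {p : ℝ≥0∞} [Fact (1 ≤ p)]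
    (hp : p ≠ ∞) {f : (Fin d → ℝ) → ℝ} (hf : MemLp f p (lagMeasure α)) {ε : ℝ≥0∞} (hε : ε ≠ 0) :
    ∃ a : (Fin d → ℕ) →₀ ℝ, eLpNorm (f - scalarFun α a.support a) p (lagMeasure α) ≤ ε := by
  have := isProbabilityMeasure_lagMeasure hα
  have hp0 : p ≠ 0 := (zero_lt_one.trans_le Fact.out).ne'
  have hp' : 0 < p.toReal := ENNReal.toReal_pos hp0 hp
  refine exists_expand_eLpNorm_sub_le (c := 1 / (4 * p.toReal)) (ae_pos_lagMeasure hα)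
    (by positivity) ?_ hp
    (fun i => span_range_nlag (by linarith [hα i])) hf hε
  convert memLp_exp_lagMeasure hα hp0 hp using 4
  field_simp; norm_num

/-- Multiplication by `w` is an isometry from `L^p(|w|^p μ)` into `L^p(μ)`. -/
lemma eLpNorm_withDensity_enorm_rpow {X : Type*} [MeasurableSpace X] {μ : Measure X} {p : ℝ≥0∞}
    (hp0 : p ≠ 0) (hp : p ≠ ∞) {w : X → ℝ} (hw : Measurable w) (h : X → ℝ) :
    eLpNorm h p (μ.withDensity fun x => ‖w x‖ₑ ^ p.toReal) = eLpNorm (fun x => w x * h x) p μ := by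
  simp only [eLpNorm_eq_lintegral_rpow_enorm_toReal hp0 hp]
  rw [lintegral_withDensity_eq_lintegral_mul_non_measurable μ (hw.enorm.pow_const _)
    (Eventually.of_forall fun x => ENNReal.rpow_lt_top_of_nonneg ENNReal.toReal_nonneg (by simp))]
  simp only [Pi.mul_apply, enorm_mul, ENNReal.mul_rpow_of_nonneg _ _ ENNReal.toReal_nonneg]

lemma memLp_withDensity_enorm_rpow {X : Type*} [MeasurableSpace X] {μ : Measure X} {p : ℝ≥0∞}
    (hp0 : p ≠ 0) (hp : p ≠ ∞) {w : X → ℝ} (hw : Measurable w) {h : X → ℝ}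
    (hh : AEStronglyMeasurable h μ) (hwh : MemLp (fun x => w x * h x) p μ) :
    MemLp h p (μ.withDensity fun x => ‖w x‖ₑ ^ p.toReal) :=
  ⟨hh.mono_ac (withDensity_absolutelyContinuous _ _),
    by rw [eLpNorm_withDensity_enorm_rpow hp0 hp hw]; exact hwh.2⟩

/-- The functions `√x_j ∂_j u`, with `u` a Laguerre expansion, are dense in `L^p(μ)`: this is the
density of polynomials in `L^p` of the measure `x_j^{p/2} μ`. -/
lemma exists_delta_expand_eLpNorm_sub_le (hα : ∀ i, -(1 / 2 : ℝ) ≤ α i) (j : Fin d) {p : ℝ≥0∞}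
    [Fact (1 ≤ p)] (hp : p ≠ ∞) {g : (Fin d → ℝ) → ℝ} (hg : MemLp g p (lagMeasure α)) {ε : ℝ≥0∞}
    (hε : ε ≠ 0) :
    ∃ a : (Fin d → ℕ) →₀ ℝ,
      eLpNorm (fun x => g x - √(x j) * expand a.support (fun k => dpoly j (ell α k)) a x) p
        (lagMeasure α) ≤ ε := by
  have := isProbabilityMeasure_lagMeasure hα
  have hp0 : p ≠ 0 := (zero_lt_one.trans_le Fact.out).ne'
  have hp' : 0 < p.toReal := ENNReal.toReal_pos hp0 hp
  have hw : Measurable fun x : Fin d → ℝ => √(x j) := by fun_prop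
  have hexp : MemLp (fun x : Fin d → ℝ => √(x j) * Real.exp (2 * (1 / (8 * p.toReal)) * ∑ i, x i)) p
      (lagMeasure α) := by
    obtain ⟨C, hC, hC'⟩ := exists_pow_le_exp 1 (by positivity : 0 < 1 / (4 * p.toReal))
    refine ((memLp_exp_lagMeasure hα hp0 hp).const_mul C).mono' (by fun_prop) ?_
    filter_upwards [ae_pos_lagMeasure hα] with x hx
    have hs : 0 ≤ ∑ i, x i := Finset.sum_nonneg fun i _ => (hx i).le
    have hs' := Finset.single_le_sum (f := x) (fun j _ => (hx j).le) (Finset.mem_univ j)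
    have h1 : √(x j) ≤ (1 + ∑ i, x i) ^ 1 := by
      rw [pow_one]
      refine Real.sqrt_le_iff.mpr ⟨by linarith, by nlinarith⟩
    rw [Real.norm_eq_abs, abs_of_nonneg (by positivity)]
    calc √(x j) * Real.exp (2 * (1 / (8 * p.toReal)) * ∑ i, x i)
        ≤ (C * Real.exp (1 / (4 * p.toReal) * ∑ i, x i)) *
          Real.exp (2 * (1 / (8 * p.toReal)) * ∑ i, x i) := by
          gcongr; exact h1.trans (hC' _ hs)
      _ = C * Real.exp (1 / (2 * p.toReal) * ∑ i, x i) := by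
          rw [mul_assoc, ← Real.exp_add]; congr 2; field_simp; ring_nf
  have hone : MemLp (fun x : Fin d → ℝ => √(x j) * 1) p (lagMeasure α) := by
    refine hexp.mono' (hw.mul measurable_const).aestronglyMeasurable ?_
    filter_upwards [ae_pos_lagMeasure hα] with x hx
    have hs : 0 ≤ ∑ i, x i := Finset.sum_nonneg fun i _ => (hx i).le
    rw [Real.norm_eq_abs, abs_of_nonneg (by positivity)]
    gcongr
    exact Real.one_le_exp (by positivity)
  let ν := (lagMeasure α).withDensity fun x => ‖√(x j)‖ₑ ^ p.toReal
  have hac : ν ≪ lagMeasure α := withDensity_absolutelyContinuous _ _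
  have hfin : IsFiniteMeasure ν := by
    have h1 := memLp_withDensity_enorm_rpow hp0 hp hw aestronglyMeasurable_const hone
    rw [memLp_const_iff hp0 hp] at h1
    exact ⟨h1.resolve_left one_ne_zero⟩
  let b : Fin d → ℕ → ℝ[X] := fun i n =>
    if i = j then derivative (nlag (α i) n) else nlag (α i) n
  have hb : ∀ i, Submodule.span ℝ (Set.range (b i)) = ⊤ := fun i => by
    by_cases hij : i = j
    · simp only [b, if_pos hij]
      exact span_range_derivative_nlag (by linarith [hα i])
    · simp only [b, if_neg hij]
      exact span_range_nlag (by linarith [hα i])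
  have hbd : (fun (k : Fin d → ℕ) i => b i (k i)) = fun k => dpoly j (ell α k) := by
    ext k i : 2
    by_cases hij : i = j
    · subst hij; simp [b, dpoly, ell]
    · simp [b, dpoly, ell, hij]
  have hgν : MemLp (fun x => g x / √(x j)) p ν := by
    refine memLp_withDensity_enorm_rpow hp0 hp hw (hg.1.mul hw.inv.aestronglyMeasurable) ?_
    refine (memLp_congr_ae ?_).mp hg
    filter_upwards [ae_pos_lagMeasure hα] with x hx
    have := (Real.sqrt_pos.mpr (hx j)).ne'
    field_simp
  -- approximate `g / √x_j` by polynomials in `L^p(ν)`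
  obtain ⟨a, ha⟩ := exists_expand_eLpNorm_sub_le (c := 1 / (8 * p.toReal))
    (hac.ae_le (ae_pos_lagMeasure hα)) (by positivity)
    (memLp_withDensity_enorm_rpow hp0 hp hw (by fun_prop) hexp) hp hb hgν hε
  refine ⟨a, le_trans (le_of_eq ?_) ha⟩
  rw [eLpNorm_withDensity_enorm_rpow hp0 hp hw, hbd]
  refine eLpNorm_congr_ae ?_
  filter_upwards [ae_pos_lagMeasure hα] with x hx
  have := (Real.sqrt_pos.mpr (hx j)).ne'
  simp only [Pi.sub_apply]
  field_simp

end LaguerreDensity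

/-! ### The Riesz transforms on `L²` -/

lemma two_ne_infty : (2 : ℝ≥0∞) ≠ ∞ := ENNReal.ofNat_ne_top

section HilbertSpace

open scoped InnerProductSpace

/-- Two orthonormal families give a bounded operator `f ↦ ∑ ⟨u_i, f⟩ v_i`. -/
lemma exists_hasSum_inner_smul {ι H K : Type*} [NormedAddCommGroup H] [InnerProductSpace ℝ H]
    [NormedAddCommGroup K] [InnerProductSpace ℝ K] [CompleteSpace K] {u : ι → H} {v : ι → K}
    (hu : Orthonormal ℝ u) (hv : Orthonormal ℝ v) :
    ∃ T : H →L[ℝ] K, ∀ f, HasSum (fun i => ⟪u i, f⟫_ℝ • v i) (T f) := by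
  have hsum : ∀ f : H, Summable fun i => ⟪u i, f⟫_ℝ • v i := fun f => by
    have := (hv.orthogonalFamily.summable_iff_norm_sq_summable fun i => ⟪u i, f⟫_ℝ).mpr
      (hu.inner_products_summable (x := f))
    simpa using this
  have hbound : ∀ f : H, ‖∑' i, ⟪u i, f⟫_ℝ • v i‖ ≤ 1 * ‖f‖ := fun f => by
    refine le_of_tendsto (hsum f).hasSum.norm (Eventually.of_forall fun s => ?_)
    rw [one_mul]
    refine le_of_sq_le_sq ?_ (norm_nonneg _)
    have := hv.orthogonalFamily.norm_sum (fun i => ⟪u i, f⟫_ℝ) s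
    simp only [LinearIsometry.toSpanSingleton_apply] at this
    rw [this]
    exact hu.sum_inner_products_le f
  refine ⟨LinearMap.mkContinuous
    { toFun := fun f => ∑' i, ⟪u i, f⟫_ℝ • v i
      map_add' := fun f g => ?_
      map_smul' := fun r f => ?_ } 1 hbound, fun f => (hsum f).hasSum⟩
  · simp only [inner_add_right, add_smul]
    exact (hsum f).tsum_add (hsum g)
  · simp only [inner_smul_right, mul_smul]
    exact (hsum f).tsum_const_smul r

end HilbertSpace

lemma coeFn_sum_smul_toLp {ι X E : Type*} [MeasurableSpace X] [NormedAddCommGroup E]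
    [NormedSpace ℝ E] {μ : Measure X} {p : ℝ≥0∞} (s : Finset ι) (c : ι → ℝ) {g : ι → X → E}
    (hg : ∀ i, MemLp (g i) p μ) :
    (∑ i ∈ s, c i • (hg i).toLp (g i) : Lp E p μ) =ᵐ[μ] fun x => ∑ i ∈ s, c i • g i x := by
  classical
  induction s using Finset.induction_on with
  | empty =>
    simp only [Finset.sum_empty]
    exact Lp.coeFn_zero E p μ
  | insert i s hi ih =>
    rw [Finset.sum_insert hi]
    filter_upwards [Lp.coeFn_add (c i • (hg i).toLp (g i)) (∑ i ∈ s, c i • (hg i).toLp (g i)),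
      Lp.coeFn_smul (c i) ((hg i).toLp (g i)), (hg i).coeFn_toLp, ih] with x h1 h2 h3 h4
    rw [h1, Pi.add_apply, h2, Pi.smul_apply, h3, h4, Finset.sum_insert hi]

section Riesz

open scoped InnerProductSpace

variable {d : ℕ} {α : Fin d → ℝ}

/-- The vector field `|k|^{-1/2} (δ_i φ_k)_i`; it vanishes for `k = 0`. -/
def rieszField (α : Fin d → ℝ) (k : Fin d → ℕ) (x : Fin d → ℝ) : EuclideanSpace ℝ (Fin d) :=
  WithLp.toLp 2 fun i => (√(len k))⁻¹ * (√(x i) * tens (dpoly i (ell α k)) x)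

lemma rieszField_apply (α : Fin d → ℝ) (k : Fin d → ℕ) (x : Fin d → ℝ) (i : Fin d) :
    rieszField α k x i = (√(len k))⁻¹ * (√(x i) * tens (dpoly i (ell α k)) x) := rfl

lemma rieszPartialSum_eq (f : (Fin d → ℝ) → ℝ) (s : Finset {k : Fin d → ℕ // k ≠ 0})
    (x : Fin d → ℝ) : rieszPartialSum α f s x =
      ∑ k ∈ s, (∫ y, f y * tens (ell α k.1) y ∂lagMeasure α) • rieszField α k.1 x := by
  ext i
  simp only [rieszPartialSum, WithLp.ofLp_sum, Finset.sum_apply, WithLp.ofLp_smul, Pi.smul_apply,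
    smul_eq_mul, rieszField_apply, delta_lagNormalized, len]
  exact Finset.sum_congr rfl fun k _ => by rw [lagNormalized_eq]; ring

lemma len_eq_zero_iff {k : Fin d → ℕ} : len k = 0 ↔ k = 0 := by
  simp [len, Finset.sum_eq_zero_iff_of_nonneg, funext_iff]

lemma rieszField_zero (α : Fin d → ℝ) : rieszField α (0 : Fin d → ℕ) = 0 := by
  ext x i
  simp [rieszField_apply, len_eq_zero_iff.mpr rfl]

lemma memLp_sqrt_mul_expand (hα : ∀ i, -(1 / 2 : ℝ) ≤ α i) {p : ℝ≥0∞} (hp : p ≠ ∞) (j : Fin d)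
    (s : Finset (Fin d → ℕ)) (Q : (Fin d → ℕ) → Fin d → ℝ[X]) (c : (Fin d → ℕ) → ℝ) :
    MemLp (fun x => √(x j) * expand s Q c x) p (lagMeasure α) := by
  have h1 : PolyGrowth fun (x : Fin d → ℝ) _ => (1 + x j) * expand s Q c x :=
    ((PolyGrowth.const 1).add (PolyGrowth.coord j)).mul (PolyGrowth.expand s Q c)
  have h2 := h1.memLp hα (t := 0) (by norm_num) (by fun_prop) hp
  refine h2.mono (by fun_prop) ?_
  filter_upwards [ae_pos_lagMeasure hα] with x hx
  rw [norm_mul, norm_mul]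
  refine mul_le_mul_of_nonneg_right ?_ (norm_nonneg _)
  rw [Real.norm_of_nonneg (Real.sqrt_nonneg _), Real.norm_of_nonneg (by linarith [hx j])]
  exact Real.sqrt_le_iff.mpr ⟨by linarith [hx j], by nlinarith [hx j]⟩

lemma memLp_tens_ell (hα : ∀ i, -(1 / 2 : ℝ) ≤ α i) {p : ℝ≥0∞} (hp : p ≠ ∞) (k : Fin d → ℕ) :
    MemLp (tens (ell α k)) p (lagMeasure α) :=
  (PolyGrowth.tens (ell α k)).memLp hα (t := 0) (by norm_num) (measurable_tens _) hp

lemma memLp_rieszField (hα : ∀ i, -(1 / 2 : ℝ) ≤ α i) {p : ℝ≥0∞} [Fact (1 ≤ p)] (hp : p ≠ ∞)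
    (k : Fin d → ℕ) : MemLp (rieszField α k) p (lagMeasure α) := by
  refine MemLp.of_eval_piLp fun i => ?_
  have := (memLp_sqrt_mul_expand hα hp i {k} (fun k => dpoly i (ell α k)) 1).const_mul (√(len k))⁻¹
  simpa [rieszField_apply, expand] using this

/-- `φ_k` as an element of `L^p`. -/
def phiLp (hα : ∀ i, -(1 / 2 : ℝ) ≤ α i) {p : ℝ≥0∞} (hp : p ≠ ∞) (k : Fin d → ℕ) :
    Lp ℝ p (lagMeasure α) :=
  (memLp_tens_ell hα hp k).toLp _

/-- `|k|^{-1/2} (δ_i φ_k)_i` as an element of `L^p`. -/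
def fieldLp (hα : ∀ i, -(1 / 2 : ℝ) ≤ α i) {p : ℝ≥0∞} [Fact (1 ≤ p)] (hp : p ≠ ∞)
    (k : Fin d → ℕ) : Lp (EuclideanSpace ℝ (Fin d)) p (lagMeasure α) :=
  (memLp_rieszField hα hp k).toLp _

lemma inner_phiLp (hα : ∀ i, -(1 / 2 : ℝ) ≤ α i) (k : Fin d → ℕ) (f : Lp ℝ 2 (lagMeasure α)) :
    ⟪phiLp hα two_ne_infty k, f⟫_ℝ = ∫ y, f y * tens (ell α k) y ∂lagMeasure α := by
  rw [L2.inner_def]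
  refine integral_congr_ae ?_
  filter_upwards [(memLp_tens_ell hα two_ne_infty k).coeFn_toLp] with x hx
  simp [phiLp, hx]

lemma orthonormal_phiLp (hα : ∀ i, -(1 / 2 : ℝ) ≤ α i) :
    Orthonormal ℝ (phiLp (p := 2) hα two_ne_infty) := by
  classical
  rw [orthonormal_iff_ite]
  intro k l
  rw [inner_phiLp, eq_comm, ← integral_ell_mul_ell hα k l]
  refine integral_congr_ae ?_
  filter_upwards [(memLp_tens_ell hα two_ne_infty l).coeFn_toLp] with x hx
  simp only [phiLp]
  rw [hx, mul_comm]

/-- `∑_i ∫ δ_i φ_k δ_i φ_l = |k|` if `k = l`, and `0` otherwise, so the factor `|k|^{-1/2}`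
normalizes. -/
lemma orthonormal_fieldLp (hα : ∀ i, -(1 / 2 : ℝ) ≤ α i) :
    Orthonormal ℝ fun k : {k : Fin d → ℕ // k ≠ 0} =>
      fieldLp (p := 2) hα two_ne_infty k.1 := by
  classical
  rw [orthonormal_iff_ite]
  intro k l
  rw [L2.inner_def]
  have h1 : ∫ x, ⟪fieldLp (p := 2) hα two_ne_infty k.1 x,
      fieldLp (p := 2) hα two_ne_infty l.1 x⟫_ℝ ∂lagMeasure α =
      ∫ x, ∑ i, (√(len k.1))⁻¹ * (√(len l.1))⁻¹ * (x i * (tens (dpoly i (ell α k.1)) x *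
        tens (dpoly i (ell α l.1)) x)) ∂lagMeasure α := by
    refine integral_congr_ae ?_
    filter_upwards [(memLp_rieszField (p := 2) hα two_ne_infty k.1).coeFn_toLp,
      (memLp_rieszField (p := 2) hα two_ne_infty l.1).coeFn_toLp,
      ae_pos_lagMeasure hα] with x hk hl hx
    simp only [fieldLp]
    rw [hk, hl, PiLp.inner_apply]
    refine Finset.sum_congr rfl fun i _ => ?_
    have := Real.mul_self_sqrt (hx i).le
    simp only [rieszField_apply, RCLike.inner_apply, conj_trivial]
    linear_combination ((√(len k.1))⁻¹ * (√(len l.1))⁻¹ * (tens (dpoly i (ell α k.1)) x *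
        tens (dpoly i (ell α l.1)) x)) * this
  rw [h1, integral_finsetSum]
  · simp only [integral_const_mul, integral_dpoly_ell hα, Subtype.ext_iff]
    split_ifs with hkl
    · rw [← Finset.mul_sum, hkl]
      have hl : 0 < len l.1 := (len_nonneg _).lt_of_ne' (len_eq_zero_iff.not.mpr l.2)
      change _ * len l.1 = 1
      have := Real.mul_self_sqrt hl.le
      have h3 := (Real.sqrt_pos.mpr hl).ne'
      field_simp
      linarith
    · simp
  · intro i _
    refine Integrable.const_mul (PolyGrowth.integrable hα (t := 0) ((PolyGrowth.coord i).mul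
      ((PolyGrowth.tens _).mul (PolyGrowth.tens _))) (by norm_num) ?_) _
    fun_prop

/-- The vector of Riesz transforms on `L²` as a continuous linear map, whose values are exactly the
sums of the defining series. -/
lemma exists_rieszL2 (hα : ∀ i, -(1 / 2 : ℝ) ≤ α i) :
    ∃ T : Lp ℝ 2 (lagMeasure α) →L[ℝ] Lp (EuclideanSpace ℝ (Fin d)) 2 (lagMeasure α),
      (∀ k, T (phiLp hα two_ne_infty k) = fieldLp hα two_ne_infty k) ∧
      ∀ (f : (Fin d → ℝ) → ℝ) (hf : MemLp f 2 (lagMeasure α))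
        (g : (Fin d → ℝ) → EuclideanSpace ℝ (Fin d)),
        IsRieszVector α f g ↔ g =ᵐ[lagMeasure α] T (hf.toLp f) := by
  obtain ⟨T, hT⟩ := exists_hasSum_inner_smul
    ((orthonormal_phiLp hα).comp (Subtype.val : {k : Fin d → ℕ // k ≠ 0} → _)
      Subtype.val_injective) (orthonormal_fieldLp hα)
  refine ⟨T, fun k => ?_, fun f hf g => ?_⟩
  · refine (hT _).unique ?_
    have ho := orthonormal_iff_ite.mp (orthonormal_phiLp hα)
    by_cases hk : k = 0
    · subst hk
      have h0 : fieldLp (p := 2) hα two_ne_infty (0 : Fin d → ℕ) = 0 := by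
        simp only [fieldLp, rieszField_zero]; exact MemLp.toLp_zero _
      rw [h0]
      convert hasSum_zero using 2 with l
      simp only [Function.comp_apply]
      rw [ho, if_neg l.2, zero_smul]
    · convert! hasSum_ite_eq (⟨k, hk⟩ : {k : Fin d → ℕ // k ≠ 0})
        (fieldLp (p := 2) hα two_ne_infty k) using 1
      ext1 l
      simp only [Function.comp_apply]
      rw [ho]
      split_ifs with h1 h2 h2
      · rw [one_smul, h1]
      · exact absurd (Subtype.ext h1) h2
      · exact absurd (congrArg Subtype.val h2) h1
      · rw [zero_smul]
  · have hps : ∀ s : Finset {k : Fin d → ℕ // k ≠ 0}, MemLp (rieszPartialSum α f s) 2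
        (lagMeasure α) := fun s => by
      have h1 := memLp_finsetSum s fun (k : {k : Fin d → ℕ // k ≠ 0}) _ =>
        (memLp_rieszField (p := 2) hα two_ne_infty k.1).const_smul
          (∫ y, f y * tens (ell α k.1) y ∂lagMeasure α)
      refine (memLp_congr_ae (Eventually.of_forall fun x => ?_)).mp h1
      rw [rieszPartialSum_eq]; rfl
    have hae : ∀ s : Finset {k : Fin d → ℕ // k ≠ 0}, rieszPartialSum α f s =ᵐ[lagMeasure α]
        (∑ k ∈ s, ⟪phiLp hα two_ne_infty k.1, hf.toLp f⟫_ℝ •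
          fieldLp (p := 2) hα two_ne_infty k.1 : Lp _ _ _) := fun s => by
      refine EventuallyEq.trans (Eventually.of_forall fun x => rieszPartialSum_eq f s x)
        (EventuallyEq.trans ?_ (coeFn_sum_smul_toLp s _ fun k : {k : Fin d → ℕ // k ≠ 0} =>
          memLp_rieszField (p := 2) hα two_ne_infty k.1).symm)
      refine Eventually.of_forall fun x => Finset.sum_congr rfl fun k _ => ?_
      rw [inner_phiLp]
      congr 1
      refine integral_congr_ae ?_
      filter_upwards [hf.coeFn_toLp] with y hy
      rw [hy]
    have hlim : Tendsto (fun s => eLpNorm (fun x => T (hf.toLp f) x - rieszPartialSum α f s x) 2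
        (lagMeasure α)) atTop (𝓝 0) := by
      have h1 := (Lp.tendsto_Lp_iff_tendsto_eLpNorm' _ _).mp (hT (hf.toLp f))
      refine h1.congr fun s => ?_
      rw [eLpNorm_sub_comm]
      refine eLpNorm_congr_ae ?_
      filter_upwards [hae s] with x hx
      simp only [Pi.sub_apply]
      rw [hx]; rfl
    constructor
    · rintro ⟨hg, hgl⟩
      refine tendstoInMeasure_ae_unique (u := atTop) (f := rieszPartialSum α f)
        (tendstoInMeasure_of_tendsto_eLpNorm two_ne_zero (fun s => (hps s).1) hg.1 ?_)
        (tendstoInMeasure_of_tendsto_eLpNorm two_ne_zero (fun s => (hps s).1)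
          (Lp.aestronglyMeasurable _) ?_)
      · exact hgl.congr fun s => eLpNorm_sub_comm _ _ _ _
      · exact hlim.congr fun s => eLpNorm_sub_comm _ _ _ _
    · intro hg
      refine ⟨(memLp_congr_ae hg).mpr (Lp.memLp _), hlim.congr fun s => eLpNorm_congr_ae ?_⟩
      filter_upwards [hg] with x hx
      rw [hx]

end Riesz

/-! ### Duality -/

section Duality

open scoped InnerProductSpace

variable {X E : Type*} [MeasurableSpace X] [NormedAddCommGroup E] [InnerProductSpace ℝ E]
  {μ : Measure X} {p q : ℝ}

lemma lpNorm_ofReal {E : Type*} [NormedAddCommGroup E] (hp : 0 < p) {f : X → E}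
    (hf : AEStronglyMeasurable f μ) :
    lpNorm f (ENNReal.ofReal p) μ = (∫ x, ‖f x‖ ^ p ∂μ) ^ (1 / p) := by
  rw [lpNorm_eq_integral_norm_rpow_toReal (by simpa using hp) ENNReal.ofReal_ne_top hf,
    ENNReal.toReal_ofReal hp.le, one_div]

lemma integrable_inner_of_memLp (hpq : p.HolderConjugate q) {V G : X → E}
    (hV : MemLp V (ENNReal.ofReal p) μ) (hG : MemLp G (ENNReal.ofReal q) μ) :
    Integrable (fun x => ⟪V x, G x⟫_ℝ) μ := by
  have := hpq.ennrealOfReal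
  refine (hV.norm.integrable_mul hG.norm).mono' (hV.1.inner hG.1) (Eventually.of_forall fun x => ?_)
  exact norm_inner_le_norm _ _

/-- Hölder's inequality for vector fields. -/
lemma abs_integral_inner_le (hpq : p.HolderConjugate q) {V G : X → E}
    (hV : MemLp V (ENNReal.ofReal p) μ) (hG : MemLp G (ENNReal.ofReal q) μ) :
    |∫ x, ⟪V x, G x⟫_ℝ ∂μ| ≤
      lpNorm V (ENNReal.ofReal p) μ * lpNorm G (ENNReal.ofReal q) μ := by
  have := hpq.ennrealOfReal
  rw [lpNorm_ofReal hpq.pos hV.1, lpNorm_ofReal hpq.symm.pos hG.1]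
  refine abs_integral_le_integral_abs.trans (le_trans (integral_mono_of_nonneg
    (Eventually.of_forall fun x => abs_nonneg _) (hV.norm.integrable_mul hG.norm)
    (Eventually.of_forall fun x => abs_real_inner_le_norm _ _)) ?_)
  exact integral_mul_le_Lp_mul_Lq_of_nonneg hpq (Eventually.of_forall fun x => norm_nonneg _)
    (Eventually.of_forall fun x => norm_nonneg _) hV.norm hG.norm

/-- The converse of Hölder's inequality, tested on `G = ‖V‖ ^ (p - 2) V`. -/
lemma lpNorm_le_of_forall_abs_integral_inner_le (hpq : p.HolderConjugate q) {V : X → E}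
    (hV : MemLp V (ENNReal.ofReal p) μ) {K : ℝ} (hK : 0 ≤ K)
    (h : ∀ G : X → E, MemLp G (ENNReal.ofReal q) μ →
      |∫ x, ⟪V x, G x⟫_ℝ ∂μ| ≤ K * lpNorm G (ENNReal.ofReal q) μ) :
    lpNorm V (ENNReal.ofReal p) μ ≤ K := by
  have hp := hpq.pos
  have hq := hpq.symm.pos
  have hp1 := hpq.lt
  let G : X → E := fun x => ‖V x‖ ^ (p - 2) • V x
  have hVG : ∀ x, ⟪V x, G x⟫_ℝ = ‖V x‖ ^ p := fun x => by
    simp only [G, inner_smul_right, real_inner_self_eq_norm_sq]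
    rcases (norm_nonneg (V x)).eq_or_lt with h0 | h0
    · rw [← h0, Real.zero_rpow hp.ne']; simp
    · rw [← Real.rpow_natCast, ← Real.rpow_add h0]; norm_num
  have hGn : ∀ x, ‖G x‖ = ‖V x‖ ^ (p - 1) := fun x => by
    simp only [G, norm_smul, Real.norm_eq_abs, abs_of_nonneg (Real.rpow_nonneg (norm_nonneg (V x)) _)]
    rcases (norm_nonneg (V x)).eq_or_lt with h0 | h0
    · rw [← h0, mul_zero, Real.zero_rpow (by linarith)]
    · rw [← Real.rpow_add_one h0.ne']; congr 1; ring
  have hGq : ∀ x, ‖G x‖ ^ q = ‖V x‖ ^ p := fun x => by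
    rw [hGn, ← Real.rpow_mul (norm_nonneg _), hpq.sub_one_mul_conj]
  have hGm : AEStronglyMeasurable G μ :=
    (hV.1.norm.aemeasurable.pow_const _).aestronglyMeasurable.smul hV.1
  have hIV : Integrable (fun x => ‖V x‖ ^ p) μ := by
    have := hV.integrable_norm_rpow (by simpa using hp) ENNReal.ofReal_ne_top
    rwa [ENNReal.toReal_ofReal hp.le] at this
  have hGL : MemLp G (ENNReal.ofReal q) μ := by
    rw [← integrable_norm_rpow_iff hGm (by simpa using hq) ENNReal.ofReal_ne_top,
      ENNReal.toReal_ofReal hq.le]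
    simpa only [hGq] using hIV
  have key := h G hGL
  rw [lpNorm_ofReal hq hGm] at key
  rw [lpNorm_ofReal hp hV.1]
  simp only [hVG, hGq] at key
  set I := ∫ x, ‖V x‖ ^ p ∂μ
  have hI : 0 ≤ I := integral_nonneg fun x => Real.rpow_nonneg (norm_nonneg _) _
  rcases hI.eq_or_lt with h0 | h0
  · rw [← h0, Real.zero_rpow (by positivity)]; exact hK
  · rw [abs_of_pos h0] at key
    have h1 : I ^ (1 / p) * I ^ (1 / q) = I := by
      rw [← Real.rpow_add h0, one_div, one_div, hpq.inv_add_inv_eq_one, Real.rpow_one]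
    have h2 : 0 < I ^ (1 / q) := Real.rpow_pos_of_pos h0 _
    exact le_of_mul_le_mul_right (h1.le.trans key) h2

end Duality

/-! ### The `L^p` bound for Laguerre expansions -/

section Expansions

open scoped InnerProductSpace

variable {d : ℕ} {α : Fin d → ℝ}

lemma expand_eq_of_subset {a : (Fin d → ℕ) →₀ ℝ} {s : Finset (Fin d → ℕ)} (h : a.support ⊆ s)
    (Q : (Fin d → ℕ) → Fin d → ℝ[X]) : expand a.support Q a = expand s Q a := by
  ext x
  refine Finset.sum_subset h fun k _ hk => ?_
  rw [Finsupp.notMem_support_iff.mp hk, zero_mul]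

/-- The vector field with `j`-th component `∑ D_{j,k} δ_j φ_k`. -/
def gradField (α : Fin d → ℝ) (s : Finset (Fin d → ℕ)) (D : Fin d → (Fin d → ℕ) → ℝ)
    (x : Fin d → ℝ) : EuclideanSpace ℝ (Fin d) :=
  WithLp.toLp 2 fun j => √(x j) * expand s (fun k => dpoly j (ell α k)) (D j) x

lemma gradField_apply (s : Finset (Fin d → ℕ)) (D : Fin d → (Fin d → ℕ) → ℝ) (x : Fin d → ℝ)
    (j : Fin d) :
    gradField α s D x j = √(x j) * expand s (fun k => dpoly j (ell α k)) (D j) x := rfl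

lemma memLp_gradField (hα : ∀ i, -(1 / 2 : ℝ) ≤ α i) {p : ℝ≥0∞} [Fact (1 ≤ p)] (hp : p ≠ ∞)
    (s : Finset (Fin d → ℕ)) (D : Fin d → (Fin d → ℕ) → ℝ) :
    MemLp (gradField α s D) p (lagMeasure α) :=
  MemLp.of_eval_piLp fun j => memLp_sqrt_mul_expand hα hp j s _ (D j)

lemma norm_gradField_rpow {s : Finset (Fin d → ℕ)} {D : Fin d → (Fin d → ℕ) → ℝ} {x : Fin d → ℝ}
    (hx : ∀ i, 0 < x i) (r : ℝ) : ‖gradField α s D x‖ ^ r = vectorFunSq α s D x ^ (r / 2) := by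
  have h1 : ‖gradField α s D x‖ ^ (2 : ℝ) = vectorFunSq α s D x := by
    rw [Real.rpow_two, EuclideanSpace.norm_sq_eq]
    refine Finset.sum_congr rfl fun j _ => ?_
    rw [gradField_apply, Real.norm_eq_abs, sq_abs, mul_pow, Real.sq_sqrt (hx j).le]
  rw [← h1, ← Real.rpow_mul (norm_nonneg _)]
  congr 1; ring

/-- The coefficients, in the sense of `gradField`, of the Riesz vector of `∑ c_k φ_k`. -/
def rieszCoeff (c : (Fin d → ℕ) → ℝ) (_ : Fin d) (k : Fin d → ℕ) : ℝ := c k * (√(len k))⁻¹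

lemma sum_smul_rieszField (s : Finset (Fin d → ℕ)) (c : (Fin d → ℕ) → ℝ) (x : Fin d → ℝ) :
    ∑ k ∈ s, c k • rieszField α k x = gradField α s (rieszCoeff c) x := by
  ext j
  simp only [WithLp.ofLp_sum, Finset.sum_apply, WithLp.ofLp_smul, Pi.smul_apply, smul_eq_mul,
    rieszField_apply, gradField_apply, expand, Finset.mul_sum, rieszCoeff]
  exact Finset.sum_congr rfl fun k _ => by ring

lemma integral_inner_gradField (hα : ∀ i, -(1 / 2 : ℝ) ≤ α i) (s : Finset (Fin d → ℕ))
    (c : (Fin d → ℕ) → ℝ) (D : Fin d → (Fin d → ℕ) → ℝ) :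
    ∫ x, ⟪gradField α s (rieszCoeff c) x, gradField α s D x⟫_ℝ ∂lagMeasure α = pairing s c D := by
  have h1 : ∫ x, ⟪gradField α s (rieszCoeff c) x, gradField α s D x⟫_ℝ ∂lagMeasure α =
      ∫ x, ∑ j, x j * (expand s (fun k => dpoly j (ell α k)) (rieszCoeff c j) x *
        expand s (fun k => dpoly j (ell α k)) (D j) x) ∂lagMeasure α := by
    refine integral_congr_ae ?_
    filter_upwards [ae_pos_lagMeasure hα] with x hx
    rw [PiLp.inner_apply]
    refine Finset.sum_congr rfl fun j _ => ?_
    have := Real.mul_self_sqrt (hx j).le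
    simp only [gradField_apply, RCLike.inner_apply, conj_trivial]
    linear_combination (expand s (fun k => dpoly j (ell α k)) (rieszCoeff c j) x *
        expand s (fun k => dpoly j (ell α k)) (D j) x) * this
  rw [h1, integral_finsetSum]
  · refine Finset.sum_congr rfl fun j _ => ?_
    rw [integral_dpoly_expand hα]
    exact Finset.sum_congr rfl fun k _ => by simp only [rieszCoeff]; ring
  · intro j _
    refine PolyGrowth.integrable hα (t := 0) ((PolyGrowth.coord j).mul
      ((PolyGrowth.expand _ _ _).mul (PolyGrowth.expand _ _ _))) (by norm_num) ?_
    fun_prop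

lemma norm_le_sum_norm_apply (v : EuclideanSpace ℝ (Fin d)) : ‖v‖ ≤ ∑ j, ‖v j‖ := by
  conv_lhs => rw [← (EuclideanSpace.basisFun (Fin d) ℝ).sum_repr v]
  refine (norm_sum_le _ _).trans (le_of_eq (Finset.sum_congr rfl fun j _ => ?_))
  rw [norm_smul, (EuclideanSpace.basisFun (Fin d) ℝ).norm_eq_one, mul_one]
  rfl

/-- Fields `(δ_j u_j)_j`, with `u_j` Laguerre expansions, are dense in `L^p(μ; ℝ^d)`. -/
lemma exists_gradField_eLpNorm_sub_le (hα : ∀ i, -(1 / 2 : ℝ) ≤ α i) {p : ℝ≥0∞} [Fact (1 ≤ p)]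
    (hp : p ≠ ∞) {G : (Fin d → ℝ) → EuclideanSpace ℝ (Fin d)} (hG : MemLp G p (lagMeasure α))
    {ε : ℝ} (hε : 0 < ε) (s : Finset (Fin d → ℕ)) :
    ∃ (s' : Finset (Fin d → ℕ)) (D : Fin d → (Fin d → ℕ) → ℝ), s ⊆ s' ∧
      lpNorm (G - gradField α s' D) p (lagMeasure α) ≤ ε := by
  classical
  have := fun j => exists_delta_expand_eLpNorm_sub_le hα j hp (hG.eval_piLp j)
    (ε := ENNReal.ofReal (ε / (d + 1))) (by simp; positivity)
  choose a ha using this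
  let s' := s ∪ Finset.univ.biUnion fun j => (a j).support
  refine ⟨s', fun j => a j, Finset.subset_union_left, ?_⟩
  have hsub : ∀ j, (a j).support ⊆ s' := fun j =>
    (Finset.subset_biUnion_of_mem (fun j => (a j).support) (Finset.mem_univ j)).trans
      Finset.subset_union_right
  have hm : MemLp (G - gradField α s' fun j => a j) p (lagMeasure α) :=
    hG.sub (memLp_gradField hα hp _ _)
  rw [← toReal_eLpNorm hm.1]
  refine ENNReal.toReal_le_of_le_ofReal hε.le ?_
  have h1 : eLpNorm (G - gradField α s' fun j => a j) p (lagMeasure α) ≤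
      eLpNorm (∑ j, fun x => ‖(G - gradField α s' fun j => a j) x j‖) p (lagMeasure α) := by
    refine eLpNorm_mono_real fun x => ?_
    rw [Finset.sum_apply]
    exact norm_le_sum_norm_apply _
  refine h1.trans ((eLpNorm_sum_le (fun j _ => (hm.eval_piLp j).norm.1) Fact.out).trans ?_)
  calc ∑ j, eLpNorm (fun x => ‖(G - gradField α s' fun j => a j) x j‖) p (lagMeasure α)
      ≤ ∑ j : Fin d, ENNReal.ofReal (ε / (d + 1)) := by
        refine Finset.sum_le_sum fun j _ => ?_
        refine le_trans (le_of_eq ?_) (ha j)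
        rw [eLpNorm_norm, expand_eq_of_subset (hsub j)]
        rfl
    _ ≤ ENNReal.ofReal ε := by
        rw [Finset.sum_const, Finset.card_univ, Fintype.card_fin, nsmul_eq_mul,
          ← ENNReal.ofReal_natCast, ← ENNReal.ofReal_mul (by positivity)]
        refine ENNReal.ofReal_le_ofReal ?_
        rw [mul_div_assoc', div_le_iff₀ (by positivity)]
        nlinarith

/-- The `L^p` bound for the Riesz vector of a finite Laguerre expansion, by duality from the
bilinear estimate. -/
lemma lpNorm_gradField_rieszCoeff_le (hα : ∀ i, -(1 / 2 : ℝ) ≤ α i) {p : ℝ} (hp : 1 < p)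
    (c : (Fin d → ℕ) →₀ ℝ) :
    lpNorm (gradField α c.support (rieszCoeff c)) (ENNReal.ofReal p) (lagMeasure α) ≤
      14 * (max p (p / (p - 1)) - 1) *
        lpNorm (scalarFun α c.support c) (ENNReal.ofReal p) (lagMeasure α) := by
  have hpq : p.HolderConjugate (p / (p - 1)) := Real.HolderConjugate.conjExponent hp
  set q := p / (p - 1)
  have hF1 : Fact (1 ≤ ENNReal.ofReal p) := ⟨by simpa using hp.le⟩
  have hF2 : Fact (1 ≤ ENNReal.ofReal q) := ⟨by simpa using hpq.symm.lt.le⟩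
  have hM : 0 ≤ 14 * (max p q - 1) := by
    have := le_max_left p q
    linarith
  set M := 14 * (max p q - 1)
  have hV := memLp_gradField hα ENNReal.ofReal_ne_top (p := ENNReal.ofReal p) c.support
    (rieszCoeff c)
  set S := lpNorm (scalarFun α c.support c) (ENNReal.ofReal p) (lagMeasure α)
  have hS : 0 ≤ S := lpNorm_nonneg
  -- the bilinear estimate for fields in the dense class; enlarging the index set to `s'` adds only
  -- zero coefficients
  have hfield : ∀ (s' : Finset (Fin d → ℕ)) (D : Fin d → (Fin d → ℕ) → ℝ), c.support ⊆ s' →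
      |∫ x, ⟪gradField α c.support (rieszCoeff c) x, gradField α s' D x⟫_ℝ ∂lagMeasure α| ≤
        M * S * lpNorm (gradField α s' D) (ENNReal.ofReal q) (lagMeasure α) := fun s' D hs => by
    have h1 : gradField α c.support (rieszCoeff c) = gradField α s' (rieszCoeff c) := by
      ext x j
      rw [gradField_apply, gradField_apply]
      congr 1
      refine Finset.sum_subset hs fun k _ hk => ?_
      rw [rieszCoeff, Finsupp.notMem_support_iff.mp hk, zero_mul, zero_mul]
    rw [h1, integral_inner_gradField hα]
    refine (abs_pairing_le hα hp s' c D).trans (le_of_eq ?_)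
    rw [lpNorm_ofReal hpq.symm.pos
      (memLp_gradField hα ENNReal.ofReal_ne_top (p := ENNReal.ofReal q) _ _).1]
    simp only [S]
    rw [lpNorm_ofReal hpq.pos (measurable_scalarFun _ _).aestronglyMeasurable,
      ← show scalarFun α c.support c = scalarFun α s' c from expand_eq_of_subset hs _]
    have h2 : ∫ x, (scalarFun α c.support c x ^ 2) ^ (p / 2) ∂lagMeasure α =
        ∫ x, ‖scalarFun α c.support c x‖ ^ p ∂lagMeasure α := by
      refine integral_congr_ae (Eventually.of_forall fun x => ?_)
      simp only
      rw [← sq_abs, ← Real.rpow_natCast, ← Real.rpow_mul (abs_nonneg _), Real.norm_eq_abs]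
      congr 1
      push_cast
      ring
    have h3 : ∫ x, vectorFunSq α s' D x ^ (q / 2) ∂lagMeasure α =
        ∫ x, ‖gradField α s' D x‖ ^ q ∂lagMeasure α := by
      refine integral_congr_ae ?_
      filter_upwards [ae_pos_lagMeasure hα] with x hx
      exact (norm_gradField_rpow hx q).symm
    rw [h2, ← h3]
  refine lpNorm_le_of_forall_abs_integral_inner_le hpq hV (by positivity) fun G hG => ?_
  set V := gradField α c.support (rieszCoeff c)
  set N := lpNorm V (ENNReal.ofReal p) (lagMeasure α)
  -- a general field `G` is within `ε` of such a field
  have hε : ∀ ε : ℝ, 0 < ε → |∫ x, ⟪V x, G x⟫_ℝ ∂lagMeasure α| ≤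
      M * S * (lpNorm G (ENNReal.ofReal q) (lagMeasure α) + ε) + N * ε := fun ε hε => by
    obtain ⟨s', D, hs, hD⟩ := exists_gradField_eLpNorm_sub_le hα ENNReal.ofReal_ne_top hG hε
      c.support
    have hH := memLp_gradField hα ENNReal.ofReal_ne_top (p := ENNReal.ofReal q) s' D
    set H := gradField α s' D
    have h1 := hfield s' D hs
    have h2 := abs_integral_inner_le hpq hV (hG.sub hH)
    have h3 : ∫ x, ⟪V x, G x⟫_ℝ ∂lagMeasure α =
        ∫ x, ⟪V x, H x⟫_ℝ ∂lagMeasure α + ∫ x, ⟪V x, (G - H) x⟫_ℝ ∂lagMeasure α := by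
      rw [← integral_add (integrable_inner_of_memLp hpq hV hH)
        (integrable_inner_of_memLp hpq hV (hG.sub hH))]
      simp only [← inner_add_right, Pi.sub_apply, add_sub_cancel]
    have h4 : lpNorm H (ENNReal.ofReal q) (lagMeasure α) ≤
        lpNorm G (ENNReal.ofReal q) (lagMeasure α) + ε := by
      have := lpNorm_sub_le hG (g := G - H) Fact.out
      rw [sub_sub_cancel] at this
      linarith
    rw [h3]
    refine (abs_add_le _ _).trans (add_le_add (h1.trans ?_) (h2.trans ?_))
    · exact mul_le_mul_of_nonneg_left h4 (by positivity)
    · exact mul_le_mul_of_nonneg_left hD lpNorm_nonneg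
  have hlim : Tendsto (fun ε : ℝ => M * S * (lpNorm G (ENNReal.ofReal q) (lagMeasure α) + ε) +
      N * ε) (𝓝[>] 0) (𝓝 (M * S * (lpNorm G (ENNReal.ofReal q) (lagMeasure α) + 0) + N * 0)) :=
    (Continuous.tendsto (by fun_prop) 0).mono_left nhdsWithin_le_nhds
  rw [add_zero, mul_zero, add_zero] at hlim
  exact ge_of_tendsto hlim (eventually_nhdsWithin_of_forall fun ε h => hε ε h)

end Expansions

/-! ### The Riesz transforms on `L^p` -/

section RieszLp

variable {d : ℕ} {α : Fin d → ℝ}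

lemma linearCombination_phiLp_ae (hα : ∀ i, -(1 / 2 : ℝ) ≤ α i) {p : ℝ≥0∞} (hp : p ≠ ∞)
    (a : (Fin d → ℕ) →₀ ℝ) :
    Finsupp.linearCombination ℝ (phiLp hα hp) a =ᵐ[lagMeasure α] scalarFun α a.support a := by
  rw [Finsupp.linearCombination_apply]
  exact coeFn_sum_smul_toLp _ _ fun k => memLp_tens_ell hα hp k

lemma linearCombination_fieldLp_ae (hα : ∀ i, -(1 / 2 : ℝ) ≤ α i) {p : ℝ≥0∞} [Fact (1 ≤ p)]
    (hp : p ≠ ∞) (a : (Fin d → ℕ) →₀ ℝ) :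
    Finsupp.linearCombination ℝ (fieldLp hα hp) a =ᵐ[lagMeasure α]
      gradField α a.support (rieszCoeff a) := by
  rw [Finsupp.linearCombination_apply]
  exact (coeFn_sum_smul_toLp _ _ fun k => memLp_rieszField hα hp k).trans
    (Eventually.of_forall fun x => sum_smul_rieszField _ _ x)

lemma norm_Lp_eq_lpNorm {X E : Type*} [MeasurableSpace X] [NormedAddCommGroup E] {μ : Measure X}
    {p : ℝ≥0∞} (f : Lp E p μ) : ‖f‖ = lpNorm f p μ := by
  rw [Lp.norm_def, toReal_eLpNorm (Lp.aestronglyMeasurable f)]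

lemma norm_linearCombination_fieldLp_le (hα : ∀ i, -(1 / 2 : ℝ) ≤ α i) {p : ℝ≥0∞} [Fact (1 ≤ p)]
    (hp₁ : 1 < p) (hp : p ≠ ∞) (a : (Fin d → ℕ) →₀ ℝ) :
    ‖Finsupp.linearCombination ℝ (fieldLp hα hp) a‖ ≤
      14 * (max p.toReal (p.toReal / (p.toReal - 1)) - 1) *
        ‖Finsupp.linearCombination ℝ (phiLp hα hp) a‖ := by
  have hp' : 1 < p.toReal := by
    rw [← ENNReal.toReal_one]
    exact (ENNReal.toReal_lt_toReal ENNReal.one_ne_top hp).mpr hp₁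
  have key := lpNorm_gradField_rieszCoeff_le hα hp' a
  rw [ENNReal.ofReal_toReal hp] at key
  rw [norm_Lp_eq_lpNorm, norm_Lp_eq_lpNorm, ← toReal_eLpNorm (Lp.aestronglyMeasurable _),
    ← toReal_eLpNorm (Lp.aestronglyMeasurable _),
    eLpNorm_congr_ae (linearCombination_fieldLp_ae hα hp a),
    eLpNorm_congr_ae (linearCombination_phiLp_ae hα hp a),
    toReal_eLpNorm (memLp_gradField hα hp _ _).1,
    toReal_eLpNorm (measurable_scalarFun _ _).aestronglyMeasurable]
  exact key

/-- One sequence of expansions approximates `f` in all `L^p` with `p ≤ r` simultaneously. -/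
lemma exists_tendsto_linearCombination_phiLp (hα : ∀ i, -(1 / 2 : ℝ) ≤ α i) {r : ℝ≥0∞}
    [Fact (1 ≤ r)] (hr : r ≠ ∞) {f : (Fin d → ℝ) → ℝ} (hf : MemLp f r (lagMeasure α)) :
    ∃ a : ℕ → (Fin d → ℕ) →₀ ℝ, ∀ (p : ℝ≥0∞) [Fact (1 ≤ p)] (hp : p ≠ ∞)
      (hfp : MemLp f p (lagMeasure α)), p ≤ r →
      Tendsto (fun n => Finsupp.linearCombination ℝ (phiLp hα hp) (a n)) atTop
        (𝓝 (hfp.toLp f)) := by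
  have := isProbabilityMeasure_lagMeasure hα
  have := fun n : ℕ => exists_scalarFun_eLpNorm_sub_le hα hr hf (ε := (n : ℝ≥0∞)⁻¹) (by simp)
  choose a ha using this
  refine ⟨a, fun p _ hp hfp hpr => ?_⟩
  rw [Lp.tendsto_Lp_iff_tendsto_eLpNorm]
  refine tendsto_of_tendsto_of_tendsto_of_le_of_le tendsto_const_nhds
    ENNReal.tendsto_inv_nat_nhds_zero (fun _ => bot_le) fun n => ?_
  rw [eLpNorm_congr_ae ((linearCombination_phiLp_ae hα hp (a n)).sub (ae_eq_refl f)),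
    eLpNorm_sub_comm]
  exact (eLpNorm_le_eLpNorm_of_exponent_le hpr
    (hf.1.sub (measurable_scalarFun _ _).aestronglyMeasurable)).trans (ha n)

lemma denseRange_linearCombination_phiLp (hα : ∀ i, -(1 / 2 : ℝ) ≤ α i) {p : ℝ≥0∞}
    [Fact (1 ≤ p)] (hp : p ≠ ∞) :
    DenseRange (Finsupp.linearCombination ℝ (phiLp (d := d) hα hp)) := fun f => by
  obtain ⟨a, ha⟩ := exists_tendsto_linearCombination_phiLp hα hp (Lp.memLp f)
  have := ha p hp (Lp.memLp f) le_rfl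
  rw [Lp.toLp_coeFn] at this
  exact mem_closure_of_tendsto this (Eventually.of_forall fun n => ⟨a n, rfl⟩)

end RieszLp

end LaguerreRiesz

end

theorem theorem5p2 (d : ℕ) (α : Fin d → ℝ) (hα : ∀ i, -(1 / 2 : ℝ) ≤ α i)
    (p : ℝ≥0∞) [Fact (1 ≤ p)] (hp₁ : 1 < p) (hp : p ≠ ∞) :
    (∀ f : (Fin d → ℝ) → ℝ, MemLp f 2 (LaguerreRiesz.lagMeasure α) →
      ∃ g : (Fin d → ℝ) → EuclideanSpace ℝ (Fin d), LaguerreRiesz.IsRieszVector α f g) ∧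
    ∃ R : Lp ℝ p (LaguerreRiesz.lagMeasure α) →L[ℝ]
        Lp (EuclideanSpace ℝ (Fin d)) p (LaguerreRiesz.lagMeasure α),
      LaguerreRiesz.ExtendsRiesz α p R ∧
      (∀ R' : Lp ℝ p (LaguerreRiesz.lagMeasure α) →L[ℝ]
        Lp (EuclideanSpace ℝ (Fin d)) p (LaguerreRiesz.lagMeasure α),
        LaguerreRiesz.ExtendsRiesz α p R' → R' = R) ∧
      ∀ f : Lp ℝ p (LaguerreRiesz.lagMeasure α),
        ∫ x, f x ∂(LaguerreRiesz.lagMeasure α) = 0 →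
        ‖R f‖ ≤ 24 * (max p.toReal (p.toReal / (p.toReal - 1)) - 1) * ‖f‖ := by
  open LaguerreRiesz in
  obtain ⟨T, hTφ, hT⟩ := exists_rieszL2 hα
  have := isProbabilityMeasure_lagMeasure hα
  have hp' : 1 < p.toReal := by
    rw [← ENNReal.toReal_one]
    exact (ENNReal.toReal_lt_toReal ENNReal.one_ne_top hp).mpr hp₁
  let e := Finsupp.linearCombination ℝ (phiLp hα hp)
  let v := Finsupp.linearCombination ℝ (fieldLp hα hp)
  have hdense : DenseRange e := denseRange_linearCombination_phiLp hα hp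
  have hbound : ∀ a, ‖v a‖ ≤ 14 * (max p.toReal (p.toReal / (p.toReal - 1)) - 1) * ‖e a‖ :=
    norm_linearCombination_fieldLp_le hα hp₁ hp
  have hTv : ∀ a, T (Finsupp.linearCombination ℝ (phiLp hα two_ne_infty) a) =
      Finsupp.linearCombination ℝ (fieldLp hα two_ne_infty) a := fun a => by
    simp only [Finsupp.linearCombination_apply, map_finsuppSum, map_smul, hTφ]
  have hR : ExtendsRiesz α p (v.extendOfNorm e) := fun f hf => by
    rw [hT f hf]
    -- approximate in `L^r`, `r = max p 2`, hence in `L^p` and in `L²`; the images under both operators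
    -- agree along the sequence, so their limits agree
    have hF : Fact (1 ≤ max p 2) := ⟨(Fact.out : 1 ≤ p).trans (le_max_left _ _)⟩
    have hr : max p 2 ≠ ∞ := (max_lt hp.lt_top two_ne_infty.lt_top).ne
    have hfr : MemLp f (max p 2) (lagMeasure α) := by
      rcases le_total p 2 with h | h
      · rwa [max_eq_right h]
      · rw [max_eq_left h]; exact Lp.memLp f
    obtain ⟨a, ha⟩ := exists_tendsto_linearCombination_phiLp hα hr hfr
    have h1 := ha p hp (Lp.memLp f) (le_max_left _ _)
    rw [Lp.toLp_coeFn] at h1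
    have h2 := ((v.extendOfNorm e).continuous.tendsto f).comp h1
    have h3 := (T.continuous.tendsto _).comp (ha 2 two_ne_infty hf (le_max_right _ _))
    refine tendstoInMeasure_ae_unique (u := atTop)
      ((tendstoInMeasure_of_tendsto_Lp h2).congr' ?_ (ae_eq_refl _))
      (tendstoInMeasure_of_tendsto_Lp h3)
    refine Eventually.of_forall fun n => ?_
    simp only [Function.comp_apply, hTv]
    have h4 : v.extendOfNorm e (e (a n)) = v (a n) :=
      LinearMap.extendOfNorm_eq hdense ⟨_, hbound⟩ (a n)
    change v.extendOfNorm e (e (a n)) =ᵐ[lagMeasure α] _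
    rw [h4]
    exact (linearCombination_fieldLp_ae hα hp (a n)).trans
      (linearCombination_fieldLp_ae hα two_ne_infty (a n)).symm
  refine ⟨fun f hf => ⟨T (hf.toLp f), (hT f hf _).mpr (ae_eq_refl _)⟩, v.extendOfNorm e, hR,
    fun R' hR' => ?_, fun f _ => ?_⟩
  -- two extensions agree on finite expansions, which lie in `L²` and are dense
  · refine ContinuousLinearMap.ext fun f => ?_
    refine congrFun (hdense.equalizer R'.continuous (v.extendOfNorm e).continuous ?_) f
    ext1 a
    have h2 : MemLp (e a) 2 (lagMeasure α) :=
      (memLp_congr_ae (linearCombination_phiLp_ae hα hp a)).mpr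
        ((PolyGrowth.expand _ _ _).memLp hα (t := 0) (by norm_num) (measurable_scalarFun _ _)
          two_ne_infty)
    exact Lp.ext (((hT _ h2 _).mp (hR' _ h2)).trans ((hT _ h2 _).mp (hR _ h2)).symm)
  · refine (LinearMap.norm_extendOfNorm_apply_le hdense _ hbound f).trans ?_
    have := le_max_left p.toReal (p.toReal / (p.toReal - 1))
    gcongr
    · linarith
    · norm_num
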